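/- Let $S=(\mathbb C^n,0)$, with local ring $\mathcal O_S=\mathbb C\{x_1,\dots,x_n\}$, and let $h\in\mathcal O_S$ with $h\neq0$, $h(0)=0$ be such that $\mathcal O_D:=\mathcal O_S/\mathcal O_S h$ is reduced; thus $h$ defines a reduced hypersurface germ $D\subset S$. View $h$ as a map $h\colon S\to T=(\mathbb C,0)$. Notation. $\Omega^p_S(D)=\frac1h\Omega^p_S$ and $\Omega^p(\log D)=\{\omega\in\Omega_S^p(D)\mid d\omega\in\Omega_S^{p+1}(D)\}$ for $p=0,1$; $\Omega^1_{S/T}=\Omega^1_S/\mathcal O_S\,dh$ and $\Omega^1(\log h)=\Omega^1(\log D)/\frac{dh}h\wedge\Omega^0(\log D)$. Let $\mathcal M_D$ be the total ring of fractions of $\mathcal O_D$. Every $\omega\in\Omega^1(\log D)$ can be written as $\omega=\frac{dh}h\frac{\xi}{g}+\frac{\eta}{g}$ with $\xi\in\mathcal O_S$, $\eta\in\Omega_S^1$ and $g\in\mathcal O_S$ restricting to a non-zero-divisor of $\mathcal O_D$; its residue $\rho_D(\omega):=\frac{\xi}{g}|_D\in\mathcal M_D$ is independent of the choices. Let $\mathcal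 R_D=\rho_D(\Omega^1(\log D))\subset\mathcal M_D$, which is an $\mathcal O_D$-submodule containing $\mathcal O_D$, and $\mathcal R_h=\mathcal R_D/\mathcal O_D$. Let $\mathcal J_D\subset\mathcal O_D$ be the ideal generated by $\partial h/\partial x_1,\dots,\partial h/\partial x_n$, and let $Z\subset D$ be the singular locus with $\mathcal O_Z=\mathcal O_D/\mathcal J_D$. The divisor $D$ is free if $\mathrm{Der}(-\log D)=\{\delta\in\mathrm{Der}_{\mathbb C}(\mathcal O_S)\mid\delta(h)\in\mathcal O_S h\}$ is a free $\mathcal O_S$-module. Then $\mathcal J_D\mathcal R_h=0$, so $\mathcal R_h$ is an $\mathcal O_Z$-module, and there is a commutative diagram of $\mathcal O_S$-modules with exact rows and columns $$\begin{array}{ccccccccc} &&0&&0&&0&&\\ &&\downarrow&&\downarrow&&\downarrow&&\\ 0&\to&\mathcal O_S&\xrightarrow{\;h\;}&\mathcal O_S&\to&\mathcal O_D&\to&0\\ &&\downarrow{\scriptstyle dh}&&\downarrow{\scriptstyle dh/h}&&\downarrow&&\\ 0&\to&\Omega^1_S&\to&\Omega^1(\log D)&\xrightarrow{\rho_D}&\mathcal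 R_D&\to&0\\ &&\downarrow&&\downarrow&&\downarrow&&\\ 0&\to&\Omega^1_{S/T}&\to&\Omega^1(\log h)&\to&\mathcal R_h&\to&0\\ &&\downarrow&&\downarrow&&\downarrow&&\\ &&0&&0&&0&& \end{array}$$ in which the unlabelled maps are the inclusions, the projections and the maps induced by them. If $D$ is free, then $Z$ is Cohen–Macaulay with canonical module $\omega_Z=\mathcal R_h$, that is, $\mathcal R_h$ is a canonical module of $\mathcal O_Z$; moreover, $Z$ is Gorenstein if and only if $\mathcal R_D=\mathcal O_D\cdot1+\mathcal O_D\cdot r$ for some $r\in\mathcal M_D$. (If $D$ is smooth, then $Z=\emptyset$ is regarded as Cohen–Macaulay and Gorenstein, with $\omega_\emptyset=0$.) -/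

import Mathlib

open scoped nonZeroDivisors

noncomputable section

namespace LogResidue

/-! ### The germ `S = (ℂⁿ, 0)` -/

/-- The power series `f = ∑ a_d x^d` converges absolutely on some closed polydisc of radius
`r > 0` around the origin. -/
def IsConvergent {n : ℕ} (f : MvPowerSeries (Fin n) ℂ) : Prop :=
  ∃ r : ℝ, 0 < r ∧ Summable fun d : Fin n →₀ ℕ => ‖MvPowerSeries.coeff d f‖ * r ^ d.degree

theorem summable_of_le {n : ℕ} {f : MvPowerSeries (Fin n) ℂ} {r s : ℝ} (hs : 0 ≤ s) (hsr : s ≤ r)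
    (hf : Summable fun d : Fin n →₀ ℕ => ‖MvPowerSeries.coeff d f‖ * r ^ d.degree) :
    Summable fun d : Fin n →₀ ℕ => ‖MvPowerSeries.coeff d f‖ * s ^ d.degree :=
  Summable.of_nonneg_of_le (fun d => by positivity)
    (fun d => by gcongr) hf

theorem isConvergent_C {n : ℕ} (a : ℂ) :
    IsConvergent (MvPowerSeries.C a : MvPowerSeries (Fin n) ℂ) := by
  classical
  refine ⟨1, one_pos, summable_of_ne_finset_zero (s := {0}) fun d hd => ?_⟩
  have : d ≠ 0 := by simpa using hd
  simp [MvPowerSeries.coeff_C, this]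

theorem isConvergent_add {n : ℕ} {f g : MvPowerSeries (Fin n) ℂ} (hf : IsConvergent f)
    (hg : IsConvergent g) : IsConvergent (f + g) := by
  obtain ⟨r, hr, hf⟩ := hf
  obtain ⟨s, hs, hg⟩ := hg
  have h0 : 0 < min r s := lt_min hr hs
  refine ⟨min r s, h0, Summable.of_nonneg_of_le (fun d => by positivity) (fun d => ?_)
    ((summable_of_le h0.le (min_le_left r s) hf).add
      (summable_of_le h0.le (min_le_right r s) hg))⟩
  rw [map_add, ← add_mul]
  gcongr
  exact norm_add_le _ _

theorem norm_coeff_mul_le {n : ℕ} (f g : MvPowerSeries (Fin n) ℂ) {t : ℝ} (ht : 0 ≤ t)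
    (d : Fin n →₀ ℕ) : ‖MvPowerSeries.coeff d (f * g)‖ * t ^ d.degree ≤
      ∑ p ∈ Finset.HasAntidiagonal.antidiagonal d, (‖MvPowerSeries.coeff p.1 f‖ * t ^ p.1.degree) *
          (‖MvPowerSeries.coeff p.2 g‖ * t ^ p.2.degree) := by
  rw [MvPowerSeries.coeff_mul]
  refine (mul_le_mul_of_nonneg_right (norm_sum_le _ _) (pow_nonneg ht _)).trans_eq ?_
  rw [Finset.sum_mul]
  refine Finset.sum_congr rfl fun p hp => ?_
  rw [← Finset.HasAntidiagonal.mem_antidiagonal.mp hp, norm_mul, map_add, pow_add]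
  ring

theorem isConvergent_mul {n : ℕ} {f g : MvPowerSeries (Fin n) ℂ} (hf : IsConvergent f)
    (hg : IsConvergent g) : IsConvergent (f * g) := by
  obtain ⟨r, hr, hf⟩ := hf
  obtain ⟨s, hs, hg⟩ := hg
  have h0 : 0 < min r s := lt_min hr hs
  have hf' := summable_of_le h0.le (min_le_left r s) hf
  have hg' := summable_of_le h0.le (min_le_right r s) hg
  have hprod := hf'.mul_of_nonneg hg' (fun d => mul_nonneg (norm_nonneg _) (pow_nonneg h0.le _))
    (fun d => mul_nonneg (norm_nonneg _) (pow_nonneg h0.le _))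
  refine ⟨min r s, h0, Summable.of_nonneg_of_le
    (fun d => mul_nonneg (norm_nonneg _) (pow_nonneg h0.le _))
    (fun d => norm_coeff_mul_le f g h0.le d) ?_⟩
  exact summable_sum_mul_antidiagonal_of_summable_mul
    (f := fun d : Fin n →₀ ℕ => ‖MvPowerSeries.coeff d f‖ * (min r s) ^ d.degree)
    (g := fun d : Fin n →₀ ℕ => ‖MvPowerSeries.coeff d g‖ * (min r s) ^ d.degree) hprod

theorem isConvergent_pderiv {n : ℕ} (i : Fin n) {f : MvPowerSeries (Fin n) ℂ}
    (hf : IsConvergent f) : IsConvergent (MvPowerSeries.pderiv ℂ i f) := by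
  obtain ⟨r, hr, hf⟩ := hf
  refine ⟨r / 2, by positivity, ?_⟩
  have hinj : Function.Injective fun d : Fin n →₀ ℕ => d + Finsupp.single i 1 :=
    fun a b hab => add_right_cancel hab
  have h1 := (hf.comp_injective hinj).mul_right r⁻¹
  refine Summable.of_nonneg_of_le (fun d => by positivity) (fun d => ?_) h1
  simp only [Function.comp_apply, MvPowerSeries.coeff_pderiv, map_add, Finsupp.degree_single,
    pow_succ]
  have hd : ((d i : ℝ) + 1) ≤ 2 ^ d.degree := by
    have h2 : d i + 1 ≤ 2 ^ d.degree :=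
      (Nat.succ_le_succ (Finsupp.le_degree i d)).trans Nat.lt_two_pow_self
    exact_mod_cast h2
  have hn : ‖((d i : ℂ) + 1)‖ = (d i : ℝ) + 1 := by
    rw [← Nat.cast_succ, Complex.norm_natCast, Nat.cast_succ]
  rw [norm_mul, hn, div_pow]
  have h3 : ((d i : ℝ) + 1) / 2 ^ d.degree ≤ 1 := by
    rw [div_le_one (by positivity)]; exact hd
  calc ‖MvPowerSeries.coeff (d + Finsupp.single i 1) f‖ * ((d i : ℝ) + 1)
        * (r ^ d.degree / 2 ^ d.degree)
      = (‖MvPowerSeries.coeff (d + Finsupp.single i 1) f‖ * r ^ d.degree)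
        * (((d i : ℝ) + 1) / 2 ^ d.degree) := by ring
    _ ≤ (‖MvPowerSeries.coeff (d + Finsupp.single i 1) f‖ * r ^ d.degree) * 1 := by gcongr
    _ = _ := by field_simp

/-- The `ℂ`-algebra `ℂ{x₁, …, xₙ}` of convergent power series. -/
def convergentSeries (n : ℕ) : Subalgebra ℂ (MvPowerSeries (Fin n) ℂ) where
  carrier := {f | IsConvergent f}
  mul_mem' := isConvergent_mul
  add_mem' := isConvergent_add
  algebraMap_mem' a := isConvergent_C a

/-- `𝒪_S`, the local ring of `S = (ℂⁿ, 0)`. -/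
def OS (n : ℕ) : Type := convergentSeries n

instance (n : ℕ) : CommRing (OS n) := inferInstanceAs (CommRing (convergentSeries n))

instance (n : ℕ) : Algebra ℂ (OS n) := inferInstanceAs (Algebra ℂ (convergentSeries n))

instance (n : ℕ) : IsDomain (OS n) :=
  haveI : IsDomain (MvPowerSeries (Fin n) ℂ) := NoZeroDivisors.to_isDomain _
  inferInstanceAs (IsDomain (convergentSeries n))

/-- The value `f(0)` of a germ. -/
def valueAtZero {n : ℕ} (f : OS n) : ℂ := MvPowerSeries.constantCoeff f.1

/-- The field of germs of meromorphic functions on `S`. -/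
abbrev MS (n : ℕ) : Type := FractionRing (OS n)

/-- The coordinate vector field `∂/∂xᵢ` on `𝒪_S`. -/
def partialS {n : ℕ} (i : Fin n) : Derivation ℂ (OS n) (OS n) where
  toFun f := ⟨MvPowerSeries.pderiv ℂ i f.1, isConvergent_pderiv i f.2⟩
  map_add' _ _ := Subtype.ext (map_add _ _ _)
  map_smul' _ _ := Subtype.ext (Derivation.map_smul _ _ _)
  map_one_eq_zero' := Subtype.ext (Derivation.map_one_eq_zero _)
  leibniz' _ _ := Subtype.ext (Derivation.leibniz _ _ _)

theorem partialS_comm {n : ℕ} (i j : Fin n) (f : OS n) :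
    partialS i (partialS j f) = partialS j (partialS i f) := by
  classical
  apply Subtype.ext
  change MvPowerSeries.pderiv ℂ i (MvPowerSeries.pderiv ℂ j f.1)
    = MvPowerSeries.pderiv ℂ j (MvPowerSeries.pderiv ℂ i f.1)
  rcases eq_or_ne i j with rfl | hij
  · rfl
  ext d
  simp only [MvPowerSeries.coeff_pderiv, Finsupp.add_apply, Finsupp.single_apply, hij, hij.symm,
    if_false, add_zero]
  rw [add_right_comm]
  ring

/-! ### Extension of a derivation to the field of fractions -/

section FracDer

variable {A : Type} [CommRing A] [IsDomain A]

theorem exists_div (x : FractionRing A) : ∃ a b : A, b ≠ 0 ∧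
    x = algebraMap A (FractionRing A) a / algebraMap A (FractionRing A) b := by
  obtain ⟨a, b, hb, h⟩ := IsFractionRing.div_surjective (A := A) x
  exact ⟨a, b, nonZeroDivisors.ne_zero hb, h.symm⟩

variable [Algebra ℂ A]

/-- The quotient rule, applied to some representation of `x` as a fraction; it does not depend
on the representation, see `fracDerFun_div`. -/
def fracDerFun (δ : Derivation ℂ A A) (x : FractionRing A) : FractionRing A :=
  let p := IsLocalization.sec A⁰ x
  (algebraMap A (FractionRing A) (δ p.1) * algebraMap A (FractionRing A) p.2
      - algebraMap A (FractionRing A) p.1 * algebraMap A (FractionRing A) (δ p.2))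
    / algebraMap A (FractionRing A) p.2 ^ 2

theorem fracDerFun_div (δ : Derivation ℂ A A) (a b : A) (hb : b ≠ 0) :
    fracDerFun δ (algebraMap A (FractionRing A) a / algebraMap A (FractionRing A) b) =
      (algebraMap A (FractionRing A) (δ a) * algebraMap A (FractionRing A) b
        - algebraMap A (FractionRing A) a * algebraMap A (FractionRing A) (δ b))
      / algebraMap A (FractionRing A) b ^ 2 := by
  have hinj := IsFractionRing.injective A (FractionRing A)
  have hb' : algebraMap A (FractionRing A) b ≠ 0 := by
    simpa using hb
  set x := algebraMap A (FractionRing A) a / algebraMap A (FractionRing A) b with hx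
  have hsec := IsLocalization.sec_spec A⁰ x
  unfold fracDerFun
  set p := IsLocalization.sec A⁰ x
  obtain ⟨c, e, he⟩ := p
  have he0 : e ≠ 0 := nonZeroDivisors.ne_zero he
  have he' : algebraMap A (FractionRing A) e ≠ 0 := by simpa using he0
  simp only at hsec ⊢
  have key : a * e = c * b := by
    apply hinj
    rw [map_mul, map_mul, ← hsec, hx]
    field_simp
  have key2 : δ a * e + a * δ e = δ c * b + c * δ b := by
    have := congrArg δ key
    simp only [Derivation.leibniz, smul_eq_mul] at this
    linear_combination this
  have k1 := congrArg (algebraMap A (FractionRing A)) key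
  have k2 := congrArg (algebraMap A (FractionRing A)) key2
  simp only [map_mul, map_add] at k1 k2
  rw [div_eq_div_iff (pow_ne_zero 2 he') (pow_ne_zero 2 hb')]
  linear_combination
    (-(algebraMap A (FractionRing A) b) * algebraMap A (FractionRing A) e) * k2
    + (algebraMap A (FractionRing A) b * algebraMap A (FractionRing A) (δ e)
      + algebraMap A (FractionRing A) e * algebraMap A (FractionRing A) (δ b)) * k1

/-- The unique extension of a derivation of a domain to its field of fractions. -/
def fracDer (δ : Derivation ℂ A A) : Derivation ℂ (FractionRing A) (FractionRing A) where
  toFun := fracDerFun δ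
  map_add' x y := by
    obtain ⟨a, b, hb, rfl⟩ := exists_div x
    obtain ⟨c, e, he, rfl⟩ := exists_div y
    have hb' : algebraMap A (FractionRing A) b ≠ 0 := by simpa using hb
    have he' : algebraMap A (FractionRing A) e ≠ 0 := by simpa using he
    have h1 : algebraMap A (FractionRing A) a / algebraMap A (FractionRing A) b
        + algebraMap A (FractionRing A) c / algebraMap A (FractionRing A) e
        = algebraMap A (FractionRing A) (a * e + b * c)
          / algebraMap A (FractionRing A) (b * e) := by
      simp only [map_add, map_mul]; field_simp
    rw [h1, fracDerFun_div δ _ _ (mul_ne_zero hb he), fracDerFun_div δ _ _ hb,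
      fracDerFun_div δ _ _ he]
    simp only [Derivation.leibniz, smul_eq_mul, map_add, map_mul]
    field_simp
    ring
  map_smul' z x := by
    obtain ⟨a, b, hb, rfl⟩ := exists_div x
    have hb' : algebraMap A (FractionRing A) b ≠ 0 := by simpa using hb
    have h1 : z • (algebraMap A (FractionRing A) a / algebraMap A (FractionRing A) b)
        = algebraMap A (FractionRing A) (z • a) / algebraMap A (FractionRing A) b := by
      rw [Algebra.smul_def, Algebra.smul_def, map_mul,
        ← IsScalarTower.algebraMap_apply ℂ A (FractionRing A), mul_div_assoc]
    rw [h1, fracDerFun_div δ _ _ hb, fracDerFun_div δ _ _ hb, Derivation.map_smul]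
    simp only [RingHom.id_apply, Algebra.smul_def, map_mul,
      ← IsScalarTower.algebraMap_apply ℂ A (FractionRing A)]
    ring
  map_one_eq_zero' := by
    have := fracDerFun_div δ (1 : A) 1 one_ne_zero
    simpa using this
  leibniz' x y := by
    obtain ⟨a, b, hb, rfl⟩ := exists_div x
    obtain ⟨c, e, he, rfl⟩ := exists_div y
    have hb' : algebraMap A (FractionRing A) b ≠ 0 := by simpa using hb
    have he' : algebraMap A (FractionRing A) e ≠ 0 := by simpa using he
    have h1 : algebraMap A (FractionRing A) a / algebraMap A (FractionRing A) b
        * (algebraMap A (FractionRing A) c / algebraMap A (FractionRing A) e)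
        = algebraMap A (FractionRing A) (a * c)
          / algebraMap A (FractionRing A) (b * e) := by
      simp only [map_mul]; field_simp
    change fracDerFun δ _ = _ • fracDerFun δ _ + _ • fracDerFun δ _
    rw [h1, fracDerFun_div δ _ _ (mul_ne_zero hb he), fracDerFun_div δ _ _ hb,
      fracDerFun_div δ _ _ he]
    simp only [Derivation.leibniz, smul_eq_mul, map_add, map_mul]
    field_simp
    ring

theorem fracDer_div (δ : Derivation ℂ A A) (a b : A) (hb : b ≠ 0) :
    fracDer δ (algebraMap A (FractionRing A) a / algebraMap A (FractionRing A) b) =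
      (algebraMap A (FractionRing A) (δ a) * algebraMap A (FractionRing A) b
        - algebraMap A (FractionRing A) a * algebraMap A (FractionRing A) (δ b))
      / algebraMap A (FractionRing A) b ^ 2 :=
  fracDerFun_div δ a b hb

theorem fracDer_algebraMap (δ : Derivation ℂ A A) (a : A) :
    fracDer δ (algebraMap A (FractionRing A) a) = algebraMap A (FractionRing A) (δ a) := by
  have := fracDer_div δ a 1 one_ne_zero
  simpa using this

end FracDer

/-! ### Differential forms -/

/-- `∂/∂xᵢ` on meromorphic functions. -/
def partialM {n : ℕ} (i : Fin n) : Derivation ℂ (MS n) (MS n) := fracDer (partialS i)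

/-- `Ω¹_S`, free over `𝒪_S` on `dx₁, …, dxₙ`: the family `η` stands for `∑ᵢ ηᵢ dxᵢ`. -/
abbrev OmegaS (n : ℕ) : Type := Fin n → OS n

/-- Meromorphic `1`-forms on `S`: the family `ω` stands for `∑ᵢ ωᵢ dxᵢ`. -/
abbrev OmegaM (n : ℕ) : Type := Fin n → MS n

/-- The differential `df` of a holomorphic function. -/
def dS {n : ℕ} (f : OS n) : OmegaS n := fun i => partialS i f

/-- The exterior derivative of a meromorphic `1`-form: the coefficient of `dxᵢ ∧ dxⱼ` in `dω` is
`∂ωⱼ/∂xᵢ - ∂ωᵢ/∂xⱼ`. -/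
def dM {n : ℕ} (ω : OmegaM n) (i j : Fin n) : MS n := partialM i (ω j) - partialM j (ω i)

section Divisor

variable {n : ℕ} (h : OS n)

/-- `𝒪_S(D) = h⁻¹ 𝒪_S`, for the divisor `D = {h = 0}`. -/
def poleModule : Submodule (OS n) (MS n) where
  carrier := {x | ∃ a : OS n, algebraMap (OS n) (MS n) h * x = algebraMap (OS n) (MS n) a}
  add_mem' := by
    rintro x y ⟨a, ha⟩ ⟨b, hb⟩
    exact ⟨a + b, by rw [mul_add, ha, hb, map_add]⟩
  zero_mem' := ⟨0, by simp⟩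
  smul_mem' := by
    rintro c x ⟨a, ha⟩
    exact ⟨c * a, by rw [Algebra.smul_def, mul_left_comm, ha, map_mul]⟩

theorem algebraMap_mem_poleModule (a : OS n) : algebraMap (OS n) (MS n) a ∈ poleModule h :=
  ⟨h * a, by rw [map_mul]⟩

theorem partialM_smul (i : Fin n) (c : OS n) (x : MS n) :
    partialM i (c • x) = c • partialM i x + partialS i c • x := by
  rw [Algebra.smul_def c x, Derivation.leibniz, partialM, fracDer_algebraMap, smul_eq_mul,
    smul_eq_mul, Algebra.smul_def, Algebra.smul_def]
  ring

/-- `Ω⁰(log D) = {f ∈ 𝒪_S(D) | df ∈ Ω¹_S(D)}`. -/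
def logForms0 : Submodule (OS n) (MS n) where
  carrier := {f | f ∈ poleModule h ∧ ∀ i, partialM i f ∈ poleModule h}
  add_mem' := by
    rintro f g ⟨hf, hf'⟩ ⟨hg, hg'⟩
    exact ⟨add_mem hf hg, fun i => by rw [map_add]; exact add_mem (hf' i) (hg' i)⟩
  zero_mem' := ⟨zero_mem _, fun i => by rw [map_zero]; exact zero_mem _⟩
  smul_mem' := by
    rintro c f ⟨hf, hf'⟩
    exact ⟨Submodule.smul_mem _ _ hf, fun i => by
      rw [partialM_smul]
      exact add_mem (Submodule.smul_mem _ _ (hf' i)) (Submodule.smul_mem _ _ hf)⟩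

/-- `Ω¹(log D) = {ω ∈ Ω¹_S(D) | dω ∈ Ω²_S(D)}`. -/
def logForms1 : Submodule (OS n) (OmegaM n) where
  carrier := {ω | (∀ i, ω i ∈ poleModule h) ∧ ∀ i j, dM ω i j ∈ poleModule h}
  add_mem' := by
    rintro ω θ ⟨h1, h2⟩ ⟨k1, k2⟩
    refine ⟨fun i => add_mem (h1 i) (k1 i), fun i j => ?_⟩
    have : dM (ω + θ) i j = dM ω i j + dM θ i j := by
      simp only [dM, Pi.add_apply, map_add]; ring
    rw [this]
    exact add_mem (h2 i j) (k2 i j)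
  zero_mem' := by
    refine ⟨fun i => zero_mem _, fun i j => ?_⟩
    simp [dM]
  smul_mem' := by
    rintro c ω ⟨h1, h2⟩
    refine ⟨fun i => Submodule.smul_mem _ _ (h1 i), fun i j => ?_⟩
    have : dM (c • ω) i j = c • dM ω i j + partialS i c • ω j - partialS j c • ω i := by
      simp only [dM, Pi.smul_apply, partialM_smul, smul_sub]; ring
    rw [this]
    exact sub_mem (add_mem (Submodule.smul_mem _ _ (h2 i j)) (Submodule.smul_mem _ _ (h1 j)))
      (Submodule.smul_mem _ _ (h1 i))

/-- `Der(-log D) = {δ ∈ Θ_S | dh(δ) = δ(h) ∈ 𝒪_S h}`, where `Θ_S = Der_ℂ(𝒪_S)`. -/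
def derLog : Submodule (OS n) (Derivation ℂ (OS n) (OS n)) where
  carrier := {δ | δ h ∈ Ideal.span {h}}
  add_mem' := fun {δ ε} hδ hε => by
    change (δ + ε) h ∈ Ideal.span {h}
    rw [Derivation.add_apply]
    exact Ideal.add_mem _ hδ hε
  zero_mem' := by
    change (0 : Derivation ℂ (OS n) (OS n)) h ∈ Ideal.span {h}
    simp
  smul_mem' := fun c δ hδ => by
    change (c • δ) h ∈ Ideal.span {h}
    rw [Derivation.smul_apply]
    exact Ideal.mul_mem_left _ _ hδ

/-- `D` is a free divisor. -/
def IsFreeDivisor : Prop := Module.Free (OS n) (derLog h)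

/-- The meromorphic form `dh / h`. -/
def dlog : OmegaM n :=
  fun i => algebraMap (OS n) (MS n) (partialS i h) / algebraMap (OS n) (MS n) h

theorem mul_dlog (i : Fin n) :
    algebraMap (OS n) (MS n) h * dlog h i = algebraMap (OS n) (MS n) (partialS i h) := by
  rcases eq_or_ne h 0 with rfl | h0
  · simp
  · have : algebraMap (OS n) (MS n) h ≠ 0 := by simpa using h0
    unfold dlog
    field_simp

theorem dlog_mem : dlog h ∈ logForms1 h := by
  refine ⟨fun i => ⟨partialS i h, mul_dlog h i⟩, fun i j => ?_⟩
  rcases eq_or_ne h 0 with rfl | h0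
  · exact ⟨0, by simp⟩
  · have : dM (dlog h) i j = 0 := by
      unfold dM dlog partialM
      rw [fracDer_div _ _ _ h0, fracDer_div _ _ _ h0, partialS_comm i j h]
      ring
    rw [this]
    exact zero_mem _

/-- A holomorphic `1`-form, considered as a meromorphic one. -/
def toMero : OmegaS n →ₗ[OS n] OmegaM n :=
  LinearMap.pi fun i => Algebra.linearMap (OS n) (MS n) ∘ₗ LinearMap.proj i

theorem toMero_mem (η : OmegaS n) : toMero η ∈ logForms1 h := by
  refine ⟨fun i => algebraMap_mem_poleModule h (η i), fun i j => ?_⟩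
  have : dM (toMero η) i j
      = algebraMap (OS n) (MS n) (partialS i (η j) - partialS j (η i)) := by
    rw [map_sub]
    change fracDer _ (algebraMap (OS n) (MS n) (η j)) - fracDer _ (algebraMap (OS n) (MS n) (η i))
      = _
    rw [fracDer_algebraMap, fracDer_algebraMap]
  rw [this]
  exact algebraMap_mem_poleModule h _

/-- The inclusion `Ω¹_S ⊆ Ω¹(log D)`. -/
def omegaIncl : OmegaS n →ₗ[OS n] logForms1 h :=
  LinearMap.codRestrict (logForms1 h) toMero (toMero_mem h)

/-- `Ω¹_{S/T} = Ω¹_S / 𝒪_S dh`, the forms relative to `h : S → T = (ℂ, 0)`. -/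
abbrev RelForms : Type := OmegaS n ⧸ Submodule.span (OS n) {dS h}

/-- `(dh/h) ∧ Ω⁰(log D)`, as a submodule of `Ω¹(log D)`. -/
def dlogWedge : Submodule (OS n) (logForms1 h) :=
  ((logForms0 h).map
    ((LinearMap.toSpanSingleton (MS n) (OmegaM n) (dlog h)).restrictScalars (OS n))).comap
    (logForms1 h).subtype

/-- `Ω¹(log h) = Ω¹(log D) / (dh/h) ∧ Ω⁰(log D)`. -/
abbrev RelLogForms : Type := logForms1 h ⧸ dlogWedge h

/-! ### Residues -/

/-- `𝒪_D = 𝒪_S / 𝒪_S h`. -/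
abbrev OD : Type := OS n ⧸ Ideal.span {h}

/-- `ℳ_D = Q(𝒪_D)`, the total ring of fractions. -/
abbrev MD : Type := FractionRing (OD h)

/-- `m ∈ ℳ_D` is a residue of `ω`: there are `ξ ∈ 𝒪_S`, `η ∈ Ω¹_S` and `g ∈ 𝒪_S`, restricting to a
non-zero-divisor of `𝒪_D`, such that `ω = (dh/h) (ξ/g) + η/g` and `m = (ξ/g)|_D`
(both equations are written after multiplication by `g`). -/
def IsResidue (ω : OmegaM n) (m : MD h) : Prop :=
  ∃ (ξ : OS n) (η : OmegaS n) (g : OS n), algebraMap (OS n) (OD h) g ∈ (OD h)⁰ ∧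
    g • ω = ξ • dlog h + toMero η ∧
    algebraMap (OS n) (MD h) g * m = algebraMap (OS n) (MD h) ξ

theorem isResidue_dlog : IsResidue h (dlog h) 1 :=
  ⟨1, 0, 1, by rw [map_one]; exact one_mem _, by simp, by simp⟩

/-- `ℛ_D`, the module of all residues of logarithmic `1`-forms. -/
def RD : Submodule (OD h) (MD h) where
  carrier := {m | ∃ ω ∈ logForms1 h, IsResidue h ω m}
  add_mem' := by
    rintro m m' ⟨ω, hω, ξ, η, g, hg, h1, h2⟩ ⟨ω', hω', ξ', η', g', hg', h1', h2'⟩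
    refine ⟨ω + ω', add_mem hω hω', g' * ξ + g * ξ', g' • η + g • η', g * g',
      by rw [map_mul]; exact mul_mem hg hg', ?_, ?_⟩
    · have e1 : (g * g') • (ω + ω') = g' • (g • ω) + g • (g' • ω') := by
        rw [smul_add, mul_smul, mul_comm g g', mul_smul, smul_comm g g' ω', smul_comm g' g ω]
      rw [e1, h1, h1', map_add, map_smul, map_smul, smul_add, smul_add, add_smul, mul_smul,
        mul_smul]
      abel
    · rw [map_add, map_mul, map_mul, map_mul]
      linear_combination (algebraMap (OS n) (MD h) g') * h2 + (algebraMap (OS n) (MD h) g) * h2'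
  zero_mem' := ⟨0, zero_mem _, 0, 0, 1, by rw [map_one]; exact one_mem _, by simp, by simp⟩
  smul_mem' := by
    rintro c m ⟨ω, hω, ξ, η, g, hg, h1, h2⟩
    obtain ⟨c, rfl⟩ := Ideal.Quotient.mk_surjective c
    refine ⟨c • ω, Submodule.smul_mem _ _ hω, c * ξ, c • η, g, hg, ?_, ?_⟩
    · rw [smul_comm, h1, smul_add, mul_smul, map_smul]
    · have e : (Ideal.Quotient.mk (Ideal.span {h}) c) • m = algebraMap (OS n) (MD h) c * m := by
        rw [Algebra.smul_def, IsScalarTower.algebraMap_apply (OS n) (OD h) (MD h)]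
        rfl
      rw [e, map_mul, mul_left_comm, h2]

theorem one_mem_RD : (1 : MD h) ∈ RD h := ⟨dlog h, dlog_mem h, isResidue_dlog h⟩

/-- `ρ` is Saito's residue map: every logarithmic form has one and only one residue, and `ρ` sends
the form to it. At most one linear map has this property. -/
def IsResidueMap (ρ : logForms1 h →ₗ[OS n] RD h) : Prop :=
  ∀ (ω : logForms1 h) (m : MD h), IsResidue h (ω : OmegaM n) m ↔ m = (ρ ω : MD h)

/-- The inclusion `𝒪_D ⊆ ℛ_D`. -/
def inclRD : OD h →ₗ[OD h] RD h :=
  LinearMap.toSpanSingleton (OD h) (RD h) ⟨1, one_mem_RD h⟩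

/-- `ℛ_h = ℛ_D / 𝒪_D`. -/
abbrev Rh : Type := RD h ⧸ LinearMap.range (inclRD h)

/-! ### The singular locus -/

/-- The Jacobian ideal `𝒥_D ⊆ 𝒪_D`, generated by the partial derivatives of `h`. -/
def jacobianIdeal : Ideal (OD h) :=
  Ideal.span (Set.range fun i : Fin n => algebraMap (OS n) (OD h) (partialS i h))

/-- `𝒪_Z = 𝒪_D / 𝒥_D`, where `Z` is the singular locus of `D`. It is the zero ring if `D` is
smooth. -/
abbrev OZ : Type := OD h ⧸ jacobianIdeal h

theorem partial_smul_mem {m : MD h} (hm : m ∈ RD h) (i : Fin n) :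
    ∃ a : OD h, algebraMap (OS n) (OD h) (partialS i h) • m = algebraMap (OD h) (MD h) a := by
  obtain ⟨ω, hω, ξ, η, g, hg, h1, h2⟩ := hm
  obtain ⟨α, hα⟩ := hω.1 i
  refine ⟨algebraMap (OS n) (OD h) α, ?_⟩
  have key : g * α = ξ * partialS i h + h * η i := by
    apply IsFractionRing.injective (OS n) (MS n)
    have h3 := congrFun h1 i
    rw [Pi.add_apply, Pi.smul_apply, Pi.smul_apply, Algebra.smul_def, Algebra.smul_def] at h3
    have h4 : toMero η i = algebraMap (OS n) (MS n) (η i) := rfl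
    rw [h4] at h3
    simp only [map_mul, map_add]
    rw [← hα, ← mul_dlog h i]
    linear_combination (algebraMap (OS n) (MS n) h) * h3
  have hh : algebraMap (OS n) (OD h) h = 0 :=
    Ideal.Quotient.eq_zero_iff_mem.mpr (Ideal.mem_span_singleton_self h)
  have key2 := congrArg (fun x => algebraMap (OD h) (MD h) (algebraMap (OS n) (OD h) x)) key
  simp only [map_mul, map_add, hh, zero_mul, add_zero] at key2
  simp only [IsScalarTower.algebraMap_apply (OS n) (OD h) (MD h)] at h2
  have hu : IsUnit (algebraMap (OD h) (MD h) (algebraMap (OS n) (OD h) g)) :=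
    IsLocalization.map_units (MD h) (⟨_, hg⟩ : (OD h)⁰)
  apply hu.mul_left_cancel
  rw [Algebra.smul_def]
  linear_combination
    (algebraMap (OD h) (MD h) (algebraMap (OS n) (OD h) (partialS i h))) * h2 - key2

/-- `ℛ_h` is annihilated by the Jacobian ideal. -/
theorem isTorsionBySet_Rh : Module.IsTorsionBySet (OD h) (Rh h) (jacobianIdeal h) := by
  rw [jacobianIdeal, ← Module.isTorsionBySet_iff_is_torsion_by_span]
  rintro x ⟨_, i, rfl⟩
  obtain ⟨m, rfl⟩ := Submodule.mkQ_surjective _ x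
  obtain ⟨a, ha⟩ := partial_smul_mem h m.2 i
  change algebraMap (OS n) (OD h) (partialS i h) • Submodule.mkQ _ m = 0
  rw [← map_smul, Submodule.mkQ_apply, Submodule.Quotient.mk_eq_zero]
  refine ⟨a, Subtype.ext ?_⟩
  change a • (1 : MD h) = algebraMap (OS n) (OD h) (partialS i h) • (m : MD h)
  rw [ha, Algebra.smul_def, mul_one]

/-- The `𝒪_Z`-module structure on `ℛ_h`: the class of `a ∈ 𝒪_D` acts like `a`. -/
instance instModuleOZRh : Module (OZ h) (Rh h) := (isTorsionBySet_Rh h).module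

end Divisor

/-! ### Exact sequences -/

/-- `0 → M → N → P → 0` is exact. -/
def IsShortExact {R M N P : Type} [CommRing R] [AddCommGroup M] [Module R M] [AddCommGroup N]
    [Module R N] [AddCommGroup P] [Module R P] (f : M →ₗ[R] N) (g : N →ₗ[R] P) : Prop :=
  Function.Injective f ∧ Function.Exact f g ∧ Function.Surjective g

/-! ### Cohen–Macaulay and Gorenstein germs, canonical modules

The following notions are applied to the ring `A` of functions on a germ of a space. It is a local
ring, or the zero ring if the germ is empty; the empty germ is Cohen–Macaulay and Gorenstein, and
its canonical module is zero. -/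

/-- The depth of a module over a local ring: the supremum of the lengths of the regular sequences
in the maximal ideal. -/
def depth (A : Type) [CommRing A] [IsLocalRing A] (M : Type) [AddCommGroup M] [Module A M] : ℕ∞ :=
  ⨆ (rs : List A) (_ : (∀ r ∈ rs, r ∈ IsLocalRing.maximalIdeal A) ∧
    RingTheory.Sequence.IsRegular M rs), (rs.length : ℕ∞)

/-- The injective dimension of `M` over `A` is finite. -/
def HasFiniteInjDim (A : Type) [CommRing A] (M : Type) [AddCommGroup M] [Module A M] : Prop :=
  ∃ d : ℕ, CategoryTheory.HasInjectiveDimensionLE (ModuleCat.of A M) d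

/-- Noetherian local with `depth A = dim A`, or zero. -/
def IsCohenMacaulay (A : Type) [CommRing A] : Prop :=
  Subsingleton A ∨ ∃ _ : IsLocalRing A, IsNoetherianRing A ∧
    (depth A A : WithBot ℕ∞) = ringKrullDim A

/-- Noetherian local of finite injective dimension over itself, or zero. -/
def IsGorenstein (A : Type) [CommRing A] : Prop :=
  Subsingleton A ∨ ∃ _ : IsLocalRing A, IsNoetherianRing A ∧ HasFiniteInjDim A A

/-- `M` is a canonical module of the Cohen–Macaulay ring `A`: a maximal Cohen–Macaulay module
(finitely generated of depth `d = dim A`) of type one (`Ext^d_A(k, M)` is one-dimensional over the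
residue field `k`) and of finite injective dimension; over the zero ring, `M = 0`. -/
def IsCanonicalModule (A : Type) [CommRing A] (M : Type) [AddCommGroup M] [Module A M] : Prop :=
  IsCohenMacaulay A ∧
    ((Subsingleton A ∧ Subsingleton M) ∨
      ∃ (_ : IsLocalRing A) (d : ℕ), ringKrullDim A = d ∧ Module.Finite A M ∧ depth A M = d ∧
        Nonempty (CategoryTheory.Abelian.Ext (ModuleCat.of A (IsLocalRing.ResidueField A))
          (ModuleCat.of A M) d ≃ₗ[A] IsLocalRing.ResidueField A) ∧
        HasFiniteInjDim A M)

end LogResidue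

end

open scoped ENNReal

noncomputable section

namespace LogResidue

/-! ### Weighted norms of power series -/

/-! Everything rests on one element: some combination g = ∑ cᵢ ∂h/∂xᵢ is a non-zero-divisor of 𝒪_D
(`exists_partial_combination`). If all partials of h lay in a minimal prime P of (h), reducedness
would make P stable under every ∂/∂xᵢ, and a proper ideal with this property is zero, whereas h ∈ P.

A form ∑ aᵢ dxᵢ / h is logarithmic exactly when h divides all ∂ᵢh aⱼ - ∂ⱼh aᵢ. Multiplying by cᵢ and
summing gives g aⱼ = (∑ cᵢ aᵢ) ∂ⱼh + h ηⱼ, so (∑ cᵢ aᵢ)/g is a residue. The same g gives uniqueness,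
the equality Ω⁰(log D) = 𝒪_S and the exactness of the diagram.

Multiplication by g embeds ℛ_h into 𝒪_S/(h, g), with image the annihilator of the ideal of Z
(`mulRh_injective`, `exists_mulRh_eq`). As h, g is a regular sequence in that ideal, ℛ_h represents
N ↦ Ext²(N, 𝒪_S) on 𝒪_Z-modules, by the Rees isomorphism (`exists_rees_class`).

If D is free, the syzygies of ∂₁h, …, ∂ₙh, h form the free module Der(-log D), so 𝒪_Z has a free
resolution of length 2. Hence depth 𝒪_Z ≥ n - 2, while the regular sequence gives dim 𝒪_Z ≤ n - 2,
and Z is Cohen–Macaulay. Dimension shifting along finite free 𝒪_Z-modules (`bijective_extShift`)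
yields Extⁱ over 𝒪_Z of (k, ℛ_h) ≅ Ext^{i+2} over 𝒪_S of (k, 𝒪_S). This vanishes unless i = n - 2,
where it is k: the defining properties of a canonical module, since vanishing of Extⁱ(k, ·) in high
degrees bounds the injective dimension.

A Cohen–Macaulay local ring with canonical module M has finite injective dimension over itself if
and only if M is cyclic (`hasInjectiveDimensionLE_iff_exists_span_eq_top`). This is checked modulo a
maximal regular sequence, where the ring and M have equal finite length and M has a one-dimensional
socle. Finally, ℛ_h = ℛ_D/𝒪_D is cyclic if and only if ℛ_D is generated by 1 and one further
element.

All this needs 𝒪_S to be a Noetherian local ring whose maximal ideal is generated by a regular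
sequence of n elements. That comes from a division theorem for convergent series, proved by
contraction in the weighted norms ∑ |a_d| N(d)⁻ˢ with N(d) = ∏ pⱼ^{dⱼ}. This N is both a
multiplicative weight and, by unique factorization, an injective monomial order, and for large s the
smallest term dominates. -/

/-- The integer `∏ⱼ pⱼ ^ dⱼ`, where `pⱼ` is the `j`-th prime. It orders the exponents `d`. -/
def primeIndex {n : ℕ} (d : Fin n →₀ ℕ) : ℕ := ∏ j : Fin n, Nat.nth Nat.Prime j ^ d j

theorem primeIndex_zero {n : ℕ} : primeIndex (0 : Fin n →₀ ℕ) = 1 := by simp [primeIndex]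

theorem primeIndex_add {n : ℕ} (d e : Fin n →₀ ℕ) :
    primeIndex (d + e) = primeIndex d * primeIndex e := by
  simp [primeIndex, pow_add, Finset.prod_mul_distrib]

theorem primeIndex_pos {n : ℕ} (d : Fin n →₀ ℕ) : 0 < primeIndex d :=
  Finset.prod_pos fun j _ => pow_pos (Nat.prime_nth_prime j).pos _

/-- Unique factorization: `d j` is the multiplicity of the j-th prime. Hence no two monomials tie in
the order, and leading exponents are well defined. -/
theorem primeIndex_injective {n : ℕ} : Function.Injective (primeIndex : (Fin n →₀ ℕ) → ℕ) := by
  have key : ∀ (d : Fin n →₀ ℕ) (j : Fin n),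
      (primeIndex d).factorization (Nat.nth Nat.Prime j) = d j := by
    intro d j
    unfold primeIndex
    rw [Nat.factorization_prod fun (i : Fin n) _ => (pow_pos (Nat.prime_nth_prime i).pos _).ne',
      Finsupp.finsetSum_apply, Finset.sum_eq_single j]
    · rw [(Nat.prime_nth_prime j).factorization_pow]; simp
    · intro i _ hij
      rw [(Nat.prime_nth_prime i).factorization_pow, Finsupp.single_apply, if_neg]
      intro h
      exact hij (Fin.ext (Nat.nth_injective Nat.infinite_setOfPred_prime h))
    · simp
  intro d e hde
  ext j
  rw [← key d j, ← key e j, hde]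

/-- Together with the next bound this squeezes N(d) between two powers with exponent |d|, so that a
series converges on some polydisc if and only if some weighted norm is finite. The base of the upper
bound is a prime larger than all those used. -/
theorem two_pow_degree_le_primeIndex {n : ℕ} (d : Fin n →₀ ℕ) : 2 ^ d.degree ≤ primeIndex d := by
  rw [Finsupp.degree_eq_sum, ← Finset.prod_pow_eq_pow_sum]
  exact Finset.prod_le_prod' fun j _ => Nat.pow_le_pow_left (Nat.prime_nth_prime j).two_le _

theorem primeIndex_le_pow_degree {n : ℕ} (d : Fin n →₀ ℕ) :
    primeIndex d ≤ (Nat.nth Nat.Prime n) ^ d.degree := by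
  rw [Finsupp.degree_eq_sum, ← Finset.prod_pow_eq_pow_sum]
  exact Finset.prod_le_prod' fun j _ => Nat.pow_le_pow_left
    ((Nat.nth_strictMono Nat.infinite_setOfPred_prime).monotone j.2.le) _

/-- The weight `N(d)⁻ˢ` of the exponent `d`. -/
def weight {n : ℕ} (s : ℕ) (d : Fin n →₀ ℕ) : ℝ≥0∞ := ((primeIndex d : ℝ≥0∞)⁻¹) ^ s

theorem weight_add {n : ℕ} (s : ℕ) (d e : Fin n →₀ ℕ) :
    weight s (d + e) = weight s d * weight s e := by
  unfold weight
  rw [primeIndex_add, ← mul_pow, Nat.cast_mul, ENNReal.mul_inv] <;> simp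

theorem weight_ne_zero {n : ℕ} (s : ℕ) (d : Fin n →₀ ℕ) : weight s d ≠ 0 := by simp [weight]

theorem weight_anti {n : ℕ} {s t : ℕ} (hst : s ≤ t) (d : Fin n →₀ ℕ) :
    weight t d ≤ weight s d :=
  pow_le_pow_right_of_le_one' (ENNReal.inv_le_one.mpr (by exact_mod_cast primeIndex_pos d)) hst

/-- The weighted `ℓ¹`-norm `∑ |a_d| N(d)⁻ˢ` of a power series. -/
def weightedNorm {n : ℕ} (s : ℕ) (f : MvPowerSeries (Fin n) ℂ) : ℝ≥0∞ :=
  ∑' d, ‖MvPowerSeries.coeff d f‖ₑ * weight s d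

theorem weightedNorm_anti {n : ℕ} {s t : ℕ} (hst : s ≤ t) (f : MvPowerSeries (Fin n) ℂ) :
    weightedNorm t f ≤ weightedNorm s f :=
  ENNReal.tsum_le_tsum fun d => by gcongr; exact weight_anti hst d

theorem weightedNorm_ne_top_of_isConvergent {n : ℕ} {f : MvPowerSeries (Fin n) ℂ}
    (hf : IsConvergent f) : ∃ s, weightedNorm s f ≠ ⊤ := by
  obtain ⟨r, hr, hf⟩ := hf
  obtain ⟨s, hs⟩ := exists_pow_lt_of_lt_one hr (by norm_num : (2⁻¹ : ℝ) < 1)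
  refine ⟨s, ne_top_of_le_ne_top hf.tsum_ofReal_ne_top (ENNReal.tsum_le_tsum fun d => ?_)⟩
  rw [ENNReal.ofReal_mul (norm_nonneg _), ofReal_norm]
  gcongr
  rw [ENNReal.ofReal_pow hr.le]
  calc weight s d ≤ (((2 : ℝ≥0∞) ^ d.degree)⁻¹) ^ s := by
        unfold weight
        gcongr
        exact_mod_cast two_pow_degree_le_primeIndex d
    _ = ((2⁻¹ : ℝ≥0∞) ^ s) ^ d.degree := by rw [ENNReal.inv_pow, ← pow_mul, ← pow_mul, mul_comm]
    _ ≤ _ := by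
        gcongr
        rw [← ENNReal.ofReal_ofNat 2, ← ENNReal.ofReal_inv_of_pos (by norm_num),
          ← ENNReal.ofReal_pow (by norm_num)]
        exact ENNReal.ofReal_le_ofReal hs.le

theorem isConvergent_of_weightedNorm_ne_top {n : ℕ} {f : MvPowerSeries (Fin n) ℂ} {s : ℕ}
    (hf : weightedNorm s f ≠ ⊤) : IsConvergent f := by
  set P : ℝ := (Nat.nth Nat.Prime n : ℝ) with hP
  have hP0 : 0 < P := Nat.cast_pos.mpr (Nat.prime_nth_prime n).pos
  refine ⟨(P⁻¹) ^ s, by positivity, Summable.of_nonneg_of_le (fun d => by positivity)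
    (fun d => ?_) (ENNReal.summable_toReal hf)⟩
  rw [ENNReal.toReal_mul, toReal_enorm]
  gcongr
  unfold weight
  rw [ENNReal.toReal_pow, ENNReal.toReal_inv, ENNReal.toReal_natCast, ← pow_mul, mul_comm s,
    pow_mul, inv_pow]
  gcongr
  · exact_mod_cast primeIndex_pos d
  · rw [hP]; exact_mod_cast primeIndex_le_pow_degree d

theorem weightedNorm_add_le {n : ℕ} (s : ℕ) (f g : MvPowerSeries (Fin n) ℂ) :
    weightedNorm s (f + g) ≤ weightedNorm s f + weightedNorm s g := by
  unfold weightedNorm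
  rw [← ENNReal.tsum_add]
  refine ENNReal.tsum_le_tsum fun d => ?_
  rw [← add_mul, map_add]
  gcongr
  exact enorm_add_le _ _

theorem weightedNorm_neg {n : ℕ} (s : ℕ) (f : MvPowerSeries (Fin n) ℂ) :
    weightedNorm s (-f) = weightedNorm s f := by
  simp [weightedNorm]

theorem weightedNorm_zero {n : ℕ} (s : ℕ) :
    weightedNorm s (0 : MvPowerSeries (Fin n) ℂ) = 0 := by
  simp [weightedNorm]

theorem weightedNorm_sum_le {n : ℕ} (s : ℕ) {ι : Type*} (t : Finset ι)
    (f : ι → MvPowerSeries (Fin n) ℂ) :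
    weightedNorm s (∑ i ∈ t, f i) ≤ ∑ i ∈ t, weightedNorm s (f i) :=
  Finset.le_sum_of_subadditive _ (weightedNorm_zero s).le (weightedNorm_add_le s) t f

theorem weightedNorm_mul_le {n : ℕ} (s : ℕ) (f g : MvPowerSeries (Fin n) ℂ) :
    weightedNorm s (f * g) ≤ weightedNorm s f * weightedNorm s g := by
  unfold weightedNorm
  rw [← ENNReal.tsum_mul_right]
  simp_rw [← ENNReal.tsum_mul_left]
  rw [← ENNReal.tsum_prod, ← (Finset.HasAntidiagonal.sigmaAntidiagonalEquivProd (A := Fin n →₀ ℕ)).tsum_eq, ENNReal.tsum_sigma']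
  refine ENNReal.tsum_le_tsum fun d => ?_
  rw [MvPowerSeries.coeff_mul, tsum_fintype]
  refine (mul_le_mul_left (enorm_sum_le _ _) _).trans ?_
  rw [Finset.sum_mul, ← Finset.sum_coe_sort]
  refine Finset.sum_le_sum fun p _ => ?_
  have hp := Finset.HasAntidiagonal.mem_antidiagonal.mp p.2
  simp only [Finset.HasAntidiagonal.sigmaAntidiagonalEquivProd_apply]
  have hw : weight s d = weight s p.1.1 * weight s p.1.2 := by rw [← weight_add, hp]
  rw [enorm_mul, hw]
  exact le_of_eq (by ring)

/-- N takes integer values, so every term of `r` has index at least a + 1. Its norm therefore decays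
like (a + 1)⁻ˢ, and (a/(a + 1))ˢ tends to 0. Applied to the tail of a divisor, it makes the leading
term dominate. -/
theorem exists_weightedNorm_le {n : ℕ} {r : MvPowerSeries (Fin n) ℂ} (hr : IsConvergent r)
    {a : ℕ} (ha : 0 < a) (h : ∀ d, MvPowerSeries.coeff d r ≠ 0 → a < primeIndex d) :
    ∃ s₀, ∀ s, s₀ ≤ s → weightedNorm s r ≤ 2⁻¹ * ((a : ℝ≥0∞)⁻¹) ^ s := by
  obtain ⟨t, ht⟩ := weightedNorm_ne_top_of_isConvergent hr
  set b : ℝ≥0∞ := ((a + 1 : ℕ) : ℝ≥0∞) with hb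
  have hb0 : b ≠ 0 := by simp [hb]
  have hbt : b ≠ ⊤ := ENNReal.natCast_ne_top _
  have ha0 : (a : ℝ≥0∞) ≠ 0 := by exact_mod_cast ha.ne'
  have hat : (a : ℝ≥0∞) ≠ ⊤ := ENNReal.natCast_ne_top _
  have h1 : ∀ k, weightedNorm (t + k) r ≤ weightedNorm t r * (b⁻¹) ^ k := by
    intro k
    unfold weightedNorm
    rw [← ENNReal.tsum_mul_right]
    refine ENNReal.tsum_le_tsum fun d => ?_
    by_cases hd : MvPowerSeries.coeff d r = 0
    · simp [hd]
    · rw [mul_assoc]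
      gcongr
      unfold weight
      rw [pow_add]
      gcongr
      rw [hb]
      exact_mod_cast h d hd
  have hq : (a : ℝ≥0∞) * b⁻¹ < 1 := by
    rw [← div_eq_mul_inv, ENNReal.div_lt_iff (Or.inl hb0) (Or.inl hbt), one_mul, hb]
    exact_mod_cast Nat.lt_succ_self a
  have h2 := ENNReal.Tendsto.const_mul (ENNReal.tendsto_pow_atTop_nhds_zero_of_lt_one hq)
    (Or.inr (ENNReal.mul_ne_top ht (ENNReal.pow_ne_top hat : (a : ℝ≥0∞) ^ t ≠ ⊤)))
  rw [mul_zero] at h2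
  obtain ⟨K, hK⟩ := Filter.eventually_atTop.mp
    (h2.eventually_le_const (by norm_num : (0 : ℝ≥0∞) < 2⁻¹))
  refine ⟨t + K, fun s hs => ?_⟩
  obtain ⟨k, rfl⟩ := Nat.exists_eq_add_of_le ((Nat.le_add_right t K).trans hs)
  have hk : K ≤ k := by omega
  calc weightedNorm (t + k) r ≤ weightedNorm t r * (b⁻¹) ^ k := h1 k
    _ = (weightedNorm t r * (a : ℝ≥0∞) ^ t * ((a : ℝ≥0∞) * b⁻¹) ^ k)
        * ((a : ℝ≥0∞)⁻¹) ^ (t + k) := by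
      have e1 : (a : ℝ≥0∞) ^ t * ((a : ℝ≥0∞)⁻¹) ^ t = 1 := by
        rw [← mul_pow, ENNReal.mul_inv_cancel ha0 hat, one_pow]
      have e2 : (a : ℝ≥0∞) ^ k * ((a : ℝ≥0∞)⁻¹) ^ k = 1 := by
        rw [← mul_pow, ENNReal.mul_inv_cancel ha0 hat, one_pow]
      rw [mul_pow, pow_add]
      calc _ = weightedNorm t r * b⁻¹ ^ k * 1 * 1 := by ring
        _ = _ := by nth_rewrite 1 [← e1]; nth_rewrite 1 [← e2]; ring
    _ ≤ _ := by gcongr; exact hK k hk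

theorem exists_leading_exponent {n : ℕ} {f : MvPowerSeries (Fin n) ℂ} (hf : f ≠ 0) :
    ∃ α, MvPowerSeries.coeff α f ≠ 0 ∧
      ∀ d, d ≠ α → MvPowerSeries.coeff d f ≠ 0 → primeIndex α < primeIndex d := by
  have hne : {d | MvPowerSeries.coeff d f ≠ 0}.Nonempty := by
    by_contra hcon
    apply hf
    ext d
    by_contra hd
    exact hcon ⟨d, hd⟩
  refine ⟨Function.argminOn primeIndex _ hne, Function.argminOn_mem primeIndex _ hne,
    fun d hd hd' => lt_of_le_of_ne (Function.argminOn_le primeIndex _ hd')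
      fun h => hd (primeIndex_injective h).symm⟩

/-! ### Division with remainder -/

section Division

variable {n : ℕ} (sel : (Fin n →₀ ℕ) → Option (Fin n →₀ ℕ)) (B : Finset (Fin n →₀ ℕ))
  (r : (Fin n →₀ ℕ) → MvPowerSeries (Fin n) ℂ)

/-- The sum of the terms of `g` assigned to the exponent `β` by `sel`, divided by `x ^ β`. -/
def quotientPart (β : Fin n →₀ ℕ) (g : MvPowerSeries (Fin n) ℂ) : MvPowerSeries (Fin n) ℂ :=
  fun d => if sel (d + β) = some β then MvPowerSeries.coeff (d + β) g else 0

/-- The sum of the terms of `g` which `sel` leaves unassigned. -/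
def remainderPart (g : MvPowerSeries (Fin n) ℂ) : MvPowerSeries (Fin n) ℂ :=
  fun d => if sel d = none then MvPowerSeries.coeff d g else 0

theorem coeff_quotientPart (β d : Fin n →₀ ℕ) (g : MvPowerSeries (Fin n) ℂ) :
    MvPowerSeries.coeff d (quotientPart sel β g) =
      if sel (d + β) = some β then MvPowerSeries.coeff (d + β) g else 0 := rfl

theorem coeff_remainderPart (d : Fin n →₀ ℕ) (g : MvPowerSeries (Fin n) ℂ) :
    MvPowerSeries.coeff d (remainderPart sel g) =
      if sel d = none then MvPowerSeries.coeff d g else 0 := rfl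

/-- The error committed in one step of the division. -/
def divisionStep (g : MvPowerSeries (Fin n) ℂ) : MvPowerSeries (Fin n) ℂ :=
  -∑ β ∈ B, quotientPart sel β g * r β

theorem sum_quotientPart_add_remainderPart (hsel : ∀ d β, sel d = some β → β ∈ B ∧ β ≤ d)
    (g : MvPowerSeries (Fin n) ℂ) :
    ∑ β ∈ B, quotientPart sel β g * MvPowerSeries.monomial β 1 + remainderPart sel g = g := by
  classical
  ext d
  rw [map_add, map_sum, coeff_remainderPart]
  simp only [MvPowerSeries.coeff_mul_monomial, coeff_quotientPart, mul_one]
  have h1 : ∀ β ∈ B, (if β ≤ d then (if sel (d - β + β) = some β then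
      MvPowerSeries.coeff (d - β + β) g else 0) else 0)
      = if sel d = some β then MvPowerSeries.coeff d g else 0 := by
    intro β _
    by_cases hβ : β ≤ d
    · rw [if_pos hβ, tsub_add_cancel_of_le hβ]
    · rw [if_neg hβ, if_neg]
      exact fun h => hβ (hsel d β h).2
  rw [Finset.sum_congr rfl h1]
  rcases hd : sel d with _ | β
  · simp
  · simp [(hsel d β hd).1]

theorem weightedNorm_remainderPart_le (s : ℕ) (g : MvPowerSeries (Fin n) ℂ) :
    weightedNorm s (remainderPart sel g) ≤ weightedNorm s g := by
  refine ENNReal.tsum_le_tsum fun d => ?_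
  rw [coeff_remainderPart]
  split_ifs
  · exact le_rfl
  · simp

theorem weightedNorm_quotientPart_mul_le (s : ℕ) (β : Fin n →₀ ℕ)
    (g : MvPowerSeries (Fin n) ℂ) :
    weightedNorm s (quotientPart sel β g) * weight s β ≤
      ∑' e, if sel e = some β then ‖MvPowerSeries.coeff e g‖ₑ * weight s e else 0 := by
  unfold weightedNorm
  rw [← ENNReal.tsum_mul_right]
  refine le_trans (ENNReal.tsum_le_tsum fun d => ?_)
    (ENNReal.tsum_comp_le_tsum_of_injective (add_left_injective β) _)
  rw [coeff_quotientPart]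
  split_ifs
  · rw [weight_add, mul_assoc]
  · simp

theorem weightedNorm_quotientPart_ne_top {s : ℕ} (β : Fin n →₀ ℕ)
    {g : MvPowerSeries (Fin n) ℂ} (hg : weightedNorm s g ≠ ⊤) :
    weightedNorm s (quotientPart sel β g) ≠ ⊤ := by
  have h1 : weightedNorm s (quotientPart sel β g) * weight s β ≠ ⊤ := by
    refine ne_top_of_le_ne_top hg ((weightedNorm_quotientPart_mul_le sel s β g).trans
      (ENNReal.tsum_le_tsum fun d => ?_))
    split_ifs
    · exact le_rfl
    · exact zero_le
  intro h2
  rw [h2, ENNReal.top_mul (weight_ne_zero s β)] at h1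
  exact h1 rfl

/-- Each exponent is assigned to at most one β, so the quantities ‖q_β‖ · weight(β) add up to at
most ‖g‖, and the bound on `r β` supplies exactly the missing factor weight(β), together with 1/2.
-/
theorem weightedNorm_divisionStep_le {s : ℕ}
    (hr : ∀ β ∈ B, weightedNorm s (r β) ≤ 2⁻¹ * weight s β) (g : MvPowerSeries (Fin n) ℂ) :
    weightedNorm s (divisionStep sel B r g) ≤ 2⁻¹ * weightedNorm s g := by
  unfold divisionStep
  rw [weightedNorm_neg]
  refine (weightedNorm_sum_le s B _).trans ?_
  calc ∑ β ∈ B, weightedNorm s (quotientPart sel β g * r β)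
      ≤ ∑ β ∈ B, 2⁻¹ * ∑' e, (if sel e = some β then
          ‖MvPowerSeries.coeff e g‖ₑ * weight s e else 0) := by
        refine Finset.sum_le_sum fun β hβ => ?_
        refine (weightedNorm_mul_le s _ _).trans ?_
        refine (mul_le_mul_right (hr β hβ) _).trans ?_
        rw [mul_left_comm]
        gcongr
        exact weightedNorm_quotientPart_mul_le sel s β g
    _ = 2⁻¹ * ∑' e, ∑ β ∈ B, (if sel e = some β then
          ‖MvPowerSeries.coeff e g‖ₑ * weight s e else 0) := by
        rw [← Finset.mul_sum, Summable.tsum_finsetSum fun _ _ => ENNReal.summable]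
    _ ≤ _ := by
        unfold weightedNorm
        gcongr with e
        rcases sel e with _ | γ
        · simp
        · simp only [Option.some.injEq, Finset.sum_ite_eq]
          split_ifs
          · exact le_rfl
          · exact zero_le

theorem hasSum_coeff_divisionStep {u : ℕ → MvPowerSeries (Fin n) ℂ}
    {G : MvPowerSeries (Fin n) ℂ}
    (h : ∀ e, HasSum (fun k => MvPowerSeries.coeff e (u k)) (MvPowerSeries.coeff e G))
    (d : Fin n →₀ ℕ) :
    HasSum (fun k => MvPowerSeries.coeff d (divisionStep sel B r (u k)))
      (MvPowerSeries.coeff d (divisionStep sel B r G)) := by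
  classical
  simp only [divisionStep, map_neg, map_sum, MvPowerSeries.coeff_mul, coeff_quotientPart]
  refine HasSum.neg (hasSum_sum fun β _ => hasSum_sum fun p _ => HasSum.mul_right _ ?_)
  split_ifs
  · exact h _
  · exact hasSum_zero

/-- The division step is a contraction, so that `g = G - T G` can be solved for `G`. -/
theorem exists_sub_divisionStep_eq {s : ℕ}
    (hr : ∀ β ∈ B, weightedNorm s (r β) ≤ 2⁻¹ * weight s β)
    {g : MvPowerSeries (Fin n) ℂ} (hg : weightedNorm s g ≠ ⊤) :
    ∃ G, weightedNorm s G ≠ ⊤ ∧ G - divisionStep sel B r G = g := by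
  -- `G` will be the Neumann series ∑ Tᵏ g, summed coefficient by coefficient; the norms of the
  -- terms are bounded by a geometric series.
  set u : ℕ → MvPowerSeries (Fin n) ℂ := fun k => (divisionStep sel B r)^[k] g with hu
  have hu_succ : ∀ k, u (k + 1) = divisionStep sel B r (u k) := fun k =>
    Function.iterate_succ_apply' _ _ _
  have hu_le : ∀ k, weightedNorm s (u k) ≤ (2⁻¹) ^ k * weightedNorm s g := by
    intro k
    induction k with
    | zero => simp [hu]
    | succ k ih =>
      rw [hu_succ, pow_succ', mul_assoc]
      exact (weightedNorm_divisionStep_le sel B r hr _).trans (by gcongr)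
  have hsum_le : ∑' k, weightedNorm s (u k) ≠ ⊤ := by
    refine ne_top_of_le_ne_top ?_ (ENNReal.tsum_le_tsum hu_le)
    rw [ENNReal.tsum_mul_right, ENNReal.tsum_geometric]
    exact ENNReal.mul_ne_top (by simp) hg
  have hcoeff : ∀ (f : MvPowerSeries (Fin n) ℂ) e,
      ‖MvPowerSeries.coeff e f‖ₑ * weight s e ≤ weightedNorm s f := fun f e =>
    ENNReal.le_tsum (f := fun e => ‖MvPowerSeries.coeff e f‖ₑ * weight s e) e
  have hsummable : ∀ e, Summable fun k => MvPowerSeries.coeff e (u k) := by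
    intro e
    refine Summable.of_enorm ?_
    have h1 : (∑' k, ‖MvPowerSeries.coeff e (u k)‖ₑ) * weight s e ≠ ⊤ := by
      rw [← ENNReal.tsum_mul_right]
      exact ne_top_of_le_ne_top hsum_le (ENNReal.tsum_le_tsum fun k => hcoeff (u k) e)
    intro h2
    rw [h2, ENNReal.top_mul (weight_ne_zero s e)] at h1
    exact h1 rfl
  let G : MvPowerSeries (Fin n) ℂ := fun e => ∑' k, MvPowerSeries.coeff e (u k)
  have hG : ∀ e, HasSum (fun k => MvPowerSeries.coeff e (u k)) (MvPowerSeries.coeff e G) :=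
    fun e => (hsummable e).hasSum
  refine ⟨G, ?_, ?_⟩
  · refine ne_top_of_le_ne_top hsum_le ?_
    unfold weightedNorm
    rw [ENNReal.tsum_comm]
    refine ENNReal.tsum_le_tsum fun d => ?_
    rw [ENNReal.tsum_mul_right]
    gcongr
    exact enorm_tsum_le_tsum_enorm
  · ext d
    have h1 := hasSum_coeff_divisionStep sel B r hG d
    simp only [← hu_succ] at h1
    have h2 := (hasSum_nat_add_iff' 1).mpr (hG d)
    rw [map_sub, h1.unique h2]
    simp [hu]

end Division

theorem isConvergent_monomial {n : ℕ} (d : Fin n →₀ ℕ) (a : ℂ) :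
    IsConvergent (MvPowerSeries.monomial d a) := by
  classical
  refine ⟨1, one_pos, summable_of_ne_finset_zero (s := {d}) fun e he => ?_⟩
  have : e ≠ d := by simpa using he
  simp [MvPowerSeries.coeff_monomial, this]

theorem isConvergent_sub {n : ℕ} {f g : MvPowerSeries (Fin n) ℂ} (hf : IsConvergent f)
    (hg : IsConvergent g) : IsConvergent (f - g) :=
  (convergentSeries n).sub_mem hf hg

/-- Division with remainder of a convergent power series by finitely many convergent power series
with leading terms `x ^ β`. -/
theorem exists_division {n : ℕ} (B : Finset (Fin n →₀ ℕ))
    (f : (Fin n →₀ ℕ) → MvPowerSeries (Fin n) ℂ) (hf : ∀ β ∈ B, IsConvergent (f β))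
    (hf1 : ∀ β ∈ B, MvPowerSeries.coeff β (f β) = 1)
    (hlead : ∀ β ∈ B, ∀ d, d ≠ β → MvPowerSeries.coeff d (f β) ≠ 0 →
      primeIndex β < primeIndex d)
    {g : MvPowerSeries (Fin n) ℂ} (hg : IsConvergent g) :
    ∃ (q : (Fin n →₀ ℕ) → MvPowerSeries (Fin n) ℂ) (R : MvPowerSeries (Fin n) ℂ),
      (∀ β, IsConvergent (q β)) ∧ IsConvergent R ∧ g = ∑ β ∈ B, q β * f β + R ∧
      ∀ d, (∃ β ∈ B, β ≤ d) → MvPowerSeries.coeff d R = 0 := by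
  classical
  -- Any choice of a β dividing the exponent will do; only exponents divisible by no β are left to
  -- the remainder.
  let sel : (Fin n →₀ ℕ) → Option (Fin n →₀ ℕ) := fun d =>
    if h : ∃ β ∈ B, β ≤ d then some h.choose else none
  have hsel : ∀ d β, sel d = some β → β ∈ B ∧ β ≤ d := by
    intro d β hd
    by_cases h : ∃ β ∈ B, β ≤ d
    · simp only [sel, h, dite_true, Option.some.injEq] at hd
      rw [← hd]
      exact h.choose_spec
    · simp [sel, h] at hd
  let r : (Fin n →₀ ℕ) → MvPowerSeries (Fin n) ℂ := fun β =>
    f β - MvPowerSeries.monomial β 1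
  have hr : ∀ β ∈ B, ∃ s₀, ∀ s, s₀ ≤ s → weightedNorm s (r β) ≤ 2⁻¹ * weight s β := by
    intro β hβ
    refine exists_weightedNorm_le (isConvergent_sub (hf β hβ) (isConvergent_monomial _ _))
      (primeIndex_pos β) fun d hd => ?_
    by_cases hdβ : d = β
    · subst hdβ
      simp [hf1 d hβ] at hd
    · refine hlead β hβ d hdβ ?_
      simpa [r, MvPowerSeries.coeff_monomial, hdβ] using hd
  choose! s₀ hs₀ using hr
  obtain ⟨t, ht⟩ := weightedNorm_ne_top_of_isConvergent hg
  set s := max t (B.sup s₀)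
  have hgs : weightedNorm s g ≠ ⊤ :=
    ne_top_of_le_ne_top ht (weightedNorm_anti (le_max_left _ _) g)
  obtain ⟨G, hG, hG'⟩ := exists_sub_divisionStep_eq sel B r (s := s)
    (fun β hβ => hs₀ β hβ s ((Finset.le_sup hβ).trans (le_max_right _ _))) hgs
  refine ⟨fun β => quotientPart sel β G, remainderPart sel G,
    fun β => isConvergent_of_weightedNorm_ne_top (weightedNorm_quotientPart_ne_top sel β hG),
    isConvergent_of_weightedNorm_ne_top
      (ne_top_of_le_ne_top hG (weightedNorm_remainderPart_le sel s G)), ?_, ?_⟩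
  -- Splitting G into its quotient parts times x^β and its remainder, and adding ∑ q_β r_β = -T G,
  -- turns each x^β into x^β + r_β = f_β.
  · have h1 := sum_quotientPart_add_remainderPart sel B hsel G
    nth_rewrite 1 [← hG']
    nth_rewrite 1 [← h1]
    simp only [divisionStep, r, mul_sub, Finset.sum_sub_distrib]
    ring
  · intro d hd
    rw [coeff_remainderPart, if_neg]
    simp [sel, hd]

/-- The inclusion of `𝒪_S` into the ring of formal power series. -/
def toSeries (n : ℕ) : OS n →ₐ[ℂ] MvPowerSeries (Fin n) ℂ := (convergentSeries n).val

theorem toSeries_injective (n : ℕ) : Function.Injective (toSeries n) := Subtype.val_injective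

theorem isConvergent_toSeries {n : ℕ} (f : OS n) : IsConvergent (toSeries n f) := f.2

/-- A convergent power series, considered as an element of `𝒪_S`. -/
def ofSeries {n : ℕ} (f : MvPowerSeries (Fin n) ℂ) (hf : IsConvergent f) : OS n := ⟨f, hf⟩

theorem toSeries_ofSeries {n : ℕ} {f : MvPowerSeries (Fin n) ℂ} (hf : IsConvergent f) :
    toSeries n (ofSeries f hf) = f := rfl

theorem valueAtZero_eq {n : ℕ} (f : OS n) :
    valueAtZero f = MvPowerSeries.constantCoeff (toSeries n f) := rfl

theorem valueAtZero_add {n : ℕ} (f g : OS n) :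
    valueAtZero (f + g) = valueAtZero f + valueAtZero g := by simp [valueAtZero_eq]

theorem valueAtZero_mul {n : ℕ} (f g : OS n) :
    valueAtZero (f * g) = valueAtZero f * valueAtZero g := by simp [valueAtZero_eq]

/-- A family of exponents of leading terms suffices to generate an ideal of `𝒪_S`. -/
theorem ideal_fg {n : ℕ} (J : Ideal (OS n)) : J.FG := by
  classical
  let E : Set (Fin n →₀ ℕ) := {α | ∃ f ∈ J, MvPowerSeries.coeff α (toSeries n f) = 1 ∧
    ∀ d, d ≠ α → MvPowerSeries.coeff d (toSeries n f) ≠ 0 → primeIndex α < primeIndex d}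
  -- Dickson's lemma: antichains of exponents are finite. One series for each minimal leading
  -- exponent will generate `J`.
  have hfin : {α | Minimal (· ∈ E) α}.Finite :=
    WellQuasiOrderedLE.finite_of_isAntichain (setOfPred_minimal_antichain _)
  have hE : ∀ α ∈ hfin.toFinset, α ∈ E := fun α hα => ((hfin.mem_toFinset).mp hα).1
  choose! f hfJ hf1 hflead using hE
  refine ⟨hfin.toFinset.image f, le_antisymm ?_ ?_⟩
  · rw [Ideal.span_le]
    intro x hx
    obtain ⟨α, hα, rfl⟩ := Finset.mem_image.mp hx
    exact hfJ α hα
  · intro g hg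
    obtain ⟨q, R, hq, hR, hgq, hR0⟩ := exists_division hfin.toFinset (fun β => toSeries n (f β))
      (fun β _ => isConvergent_toSeries _) hf1 hflead (isConvergent_toSeries g)
    have hg' : g = ∑ β ∈ hfin.toFinset, ofSeries (q β) (hq β) * f β + ofSeries R hR := by
      apply toSeries_injective
      rw [map_add, map_sum]
      simp only [map_mul, toSeries_ofSeries]
      exact hgq
    have hsum : ∑ β ∈ hfin.toFinset, ofSeries (q β) (hq β) * f β ∈ J :=
      Ideal.sum_mem _ fun β hβ => Ideal.mul_mem_left _ _ (hfJ β hβ)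
    have hRJ : ofSeries R hR ∈ J := by
      have : ofSeries R hR = g - ∑ β ∈ hfin.toFinset, ofSeries (q β) (hq β) * f β := by
        rw [eq_sub_iff_add_eq, add_comm]; exact hg'.symm
      rw [this]
      exact sub_mem hg hsum
    -- A non-zero remainder lies in `J`, so its leading exponent is above some minimal one, where
    -- the division has made all its coefficients vanish.
    have hRzero : R = 0 := by
      by_contra hne
      obtain ⟨α, hα, hαlead⟩ := exists_leading_exponent hne
      have hαE : α ∈ E := by
        refine ⟨(MvPowerSeries.coeff α R)⁻¹ • ofSeries R hR,
          Submodule.smul_of_tower_mem J _ hRJ, ?_, fun d hd hd' => hαlead d hd fun h0 => hd' ?_⟩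
        · rw [map_smul, toSeries_ofSeries, map_smul, smul_eq_mul, inv_mul_cancel₀ hα]
        · rw [map_smul, toSeries_ofSeries, map_smul, h0, smul_zero]
      obtain ⟨β, hβα, hβ⟩ := exists_minimal_le_of_wellFoundedLT (· ∈ E) α hαE
      exact hα (hR0 α ⟨β, hfin.mem_toFinset.mpr hβ, hβα⟩)
    have hR0' : ofSeries R hR = 0 := toSeries_injective n (by rw [toSeries_ofSeries, hRzero, map_zero])
    rw [hg', hR0', add_zero]
    exact Ideal.sum_mem _ fun β hβ => Ideal.mul_mem_left _ _
      (Ideal.subset_span (Finset.mem_coe.mpr (Finset.mem_image_of_mem f hβ)))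

instance isNoetherianRing_OS (n : ℕ) : IsNoetherianRing (OS n) :=
  isNoetherianRing_iff_ideal_fg _ |>.mpr ideal_fg

/-- If f(0) ≠ 0, then f/f(0) has leading exponent 0, which divides every exponent. So the division
of 1 by it leaves no remainder, and the inverse is convergent. -/
theorem isUnit_iff_valueAtZero_ne_zero {n : ℕ} (f : OS n) : IsUnit f ↔ valueAtZero f ≠ 0 := by
  constructor
  · rintro ⟨u, rfl⟩ h0
    have h1 := valueAtZero_mul (u : OS n) ((u⁻¹ : (OS n)ˣ) : OS n)
    rw [Units.mul_inv, h0, zero_mul, valueAtZero_eq, map_one, map_one] at h1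
    exact one_ne_zero h1
  · intro h0
    set c := valueAtZero f
    obtain ⟨q, R, hq, hR, h1, hR0⟩ := exists_division {0} (fun _ => toSeries n (c⁻¹ • f))
      (fun β _ => isConvergent_toSeries _)
      (fun β hβ => by
        rw [Finset.mem_singleton.mp hβ, map_smul, map_smul, smul_eq_mul,
          MvPowerSeries.coeff_zero_eq_constantCoeff_apply, ← valueAtZero_eq, inv_mul_cancel₀ h0])
      (fun β hβ d hd _ => by
        rw [Finset.mem_singleton.mp hβ] at hd ⊢
        rw [primeIndex_zero]
        refine lt_of_le_of_ne (primeIndex_pos d) fun h => hd (primeIndex_injective ?_)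
        rw [primeIndex_zero]; exact h.symm) (isConvergent_toSeries (1 : OS n))
    have hRz : R = 0 := by
      ext d
      rw [hR0 d ⟨0, by simp, zero_le⟩, map_zero]
    rw [Finset.sum_singleton, hRz, add_zero] at h1
    refine IsUnit.of_mul_eq_one (c⁻¹ • ofSeries (q 0) (hq 0)) (toSeries_injective n ?_)
    rw [h1, map_mul, map_smul, map_smul, toSeries_ofSeries]
    rw [mul_smul_comm, mul_comm, mul_smul_comm]

instance isLocalRing_OS (n : ℕ) : IsLocalRing (OS n) :=
  IsLocalRing.of_nonunits_add fun a b ha hb => by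
    rw [mem_nonunits_iff, isUnit_iff_valueAtZero_ne_zero, not_not] at *
    rw [valueAtZero_add, ha, hb, add_zero]

theorem mem_maximalIdeal_iff {n : ℕ} (f : OS n) :
    f ∈ IsLocalRing.maximalIdeal (OS n) ↔ valueAtZero f = 0 := by
  rw [IsLocalRing.mem_maximalIdeal, mem_nonunits_iff, isUnit_iff_valueAtZero_ne_zero, not_not]

/-! ### Coordinates -/

/-- The coordinate function `xᵢ`. -/
def coordS {n : ℕ} (i : Fin n) : OS n := ⟨MvPowerSeries.X i, isConvergent_monomial _ _⟩

theorem toSeries_coordS {n : ℕ} (i : Fin n) : toSeries n (coordS i) = MvPowerSeries.X i := rfl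

theorem toSeries_partialS {n : ℕ} (i : Fin n) (f : OS n) :
    toSeries n (partialS i f) = MvPowerSeries.pderiv ℂ i (toSeries n f) := rfl

theorem partialS_coordS {n : ℕ} (i j : Fin n) :
    partialS i (coordS j) = if i = j then 1 else 0 := by
  classical
  apply toSeries_injective
  rw [toSeries_partialS, toSeries_coordS, MvPowerSeries.pderiv_X]
  split_ifs <;> simp_all

/-- If the coefficients of `f` vanish at all exponents prime to `xᵢ`, then `xᵢ` divides `f`. -/
theorem coordS_dvd {n : ℕ} (i : Fin n) (f : OS n)
    (hf : ∀ d : Fin n →₀ ℕ, d i = 0 → MvPowerSeries.coeff d (toSeries n f) = 0) :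
    coordS i ∣ f := by
  classical
  obtain ⟨q, R, hq, hR, h1, hR0⟩ := exists_division {Finsupp.single i 1}
    (fun _ => toSeries n (coordS i)) (fun β _ => isConvergent_toSeries _)
    (fun β hβ => by
      rw [Finset.mem_singleton.mp hβ, toSeries_coordS, MvPowerSeries.coeff_index_single_self_X])
    (fun β hβ d hd h => by
      rw [Finset.mem_singleton.mp hβ] at hd
      rw [toSeries_coordS, MvPowerSeries.coeff_X, if_neg hd] at h
      exact absurd rfl h) (isConvergent_toSeries f)
  rw [Finset.sum_singleton] at h1
  have hRz : R = 0 := by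
    ext d
    rw [map_zero]
    by_cases hd : d i = 0
    · have h2 := congrArg (MvPowerSeries.coeff d) h1
      rw [hf d hd, map_add, toSeries_coordS, MvPowerSeries.X, MvPowerSeries.coeff_mul_monomial,
        if_neg, zero_add] at h2
      · exact h2.symm
      · intro h
        have := h i
        simp [hd] at this
    · exact hR0 d ⟨_, Finset.mem_singleton_self _, by
        rw [Finsupp.single_le_iff]; exact Nat.one_le_iff_ne_zero.mpr hd⟩
  refine ⟨ofSeries _ (hq (Finsupp.single i 1)), toSeries_injective n ?_⟩
  rw [map_mul, toSeries_ofSeries, h1, hRz, add_zero, mul_comm]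

/-- The part of `f` consisting of the terms whose exponents lie in `E`. -/
def restrictTerms {n : ℕ} (E : Set (Fin n →₀ ℕ)) [DecidablePred (· ∈ E)] (f : OS n) : OS n :=
  ofSeries (fun d => if d ∈ E then MvPowerSeries.coeff d (toSeries n f) else 0) <| by
    obtain ⟨s, hs⟩ := weightedNorm_ne_top_of_isConvergent (isConvergent_toSeries f)
    refine isConvergent_of_weightedNorm_ne_top (s := s)
      (ne_top_of_le_ne_top hs (ENNReal.tsum_le_tsum fun d => ?_))
    gcongr
    change ‖ite _ _ _‖ₑ ≤ _
    split_ifs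
    · exact le_rfl
    · simp

theorem coeff_restrictTerms {n : ℕ} (E : Set (Fin n →₀ ℕ)) [DecidablePred (· ∈ E)] (f : OS n)
    (d : Fin n →₀ ℕ) : MvPowerSeries.coeff d (toSeries n (restrictTerms E f)) =
      if d ∈ E then MvPowerSeries.coeff d (toSeries n f) else 0 := rfl

/-- A series lies in the ideal generated by the coordinates `xᵢ`, `i ∈ T`, if and only if its
coefficients at the exponents prime to these coordinates vanish. -/
theorem mem_span_coordS_iff {n : ℕ} (T : Finset (Fin n)) (f : OS n) :
    f ∈ Ideal.span (coordS '' (T : Set (Fin n))) ↔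
      ∀ d : Fin n →₀ ℕ, (∀ i ∈ T, d i = 0) → MvPowerSeries.coeff d (toSeries n f) = 0 := by
  classical
  constructor
  · intro hf
    induction hf using Submodule.span_induction with
    | mem x hx =>
      obtain ⟨i, hi, rfl⟩ := hx
      intro d hd
      rw [toSeries_coordS, MvPowerSeries.coeff_X, if_neg]
      rintro rfl
      simpa using hd i hi
    | zero => simp
    | add x y _ _ hx hy => intro d hd; rw [map_add, map_add, hx d hd, hy d hd, add_zero]
    | smul a x _ hx =>
      intro d hd
      rw [smul_eq_mul, map_mul, MvPowerSeries.coeff_mul]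
      refine Finset.sum_eq_zero fun p hp => ?_
      rw [hx p.2, mul_zero]
      intro i hi
      have h1 := hd i hi
      rw [← Finset.HasAntidiagonal.mem_antidiagonal.mp hp, Finsupp.add_apply] at h1
      omega
  · induction T using Finset.induction_on generalizing f with
    | empty =>
      intro hf
      have : f = 0 := toSeries_injective n (by
        ext d
        rw [hf d (by simp), map_zero, map_zero])
      rw [this]
      exact zero_mem _
    | insert i T hi ih =>
      intro hf
      -- Split off the terms of f free of xᵢ: these are handled by induction, and the rest is
      -- divisible by xᵢ.
      have h1 : restrictTerms {d | d i = 0} f ∈ Ideal.span (coordS '' (T : Set (Fin n))) := by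
        refine ih _ fun d hd => ?_
        rw [coeff_restrictTerms]
        split_ifs with hdi
        · exact hf d (by simpa using ⟨hdi, hd⟩)
        · rfl
      have h2 : coordS i ∣ f - restrictTerms {d | d i = 0} f := by
        refine coordS_dvd i _ fun d hd => ?_
        rw [map_sub, map_sub, coeff_restrictTerms, if_pos (by exact hd), sub_self]
      obtain ⟨q, hq⟩ := h2
      rw [← sub_add_cancel f (restrictTerms {d | d i = 0} f), hq]
      refine add_mem (Ideal.mul_mem_right _ _ (Ideal.subset_span ⟨i, by simp, rfl⟩))
        (Ideal.span_mono (Set.image_mono (by simp)) h1)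

/-- The coordinates of `S`, as a list. -/
def coordList (n : ℕ) : List (OS n) := (List.finRange n).map coordS

theorem ofList_map_coordS {n : ℕ} (l : List (Fin n)) :
    Ideal.ofList (l.map coordS) = Ideal.span (coordS '' (l.toFinset : Set (Fin n))) := by
  rw [Ideal.ofList]
  congr 1
  ext x
  simp

theorem ofList_coordList (n : ℕ) : Ideal.ofList (coordList n) = IsLocalRing.maximalIdeal (OS n) := by
  rw [coordList, ofList_map_coordS]
  ext f
  rw [mem_span_coordS_iff, mem_maximalIdeal_iff]
  constructor
  · intro h
    exact h 0 (by simp)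
  · intro h d hd
    have : d = 0 := by ext i; simpa using hd i (by simp)
    rw [this]
    exact h

/-- Membership in an ideal of coordinates is read off from coefficients, and multiplication by a
further coordinate only shifts exponents in a direction that the condition ignores. -/
theorem isWeaklyRegular_coordList (n : ℕ) :
    RingTheory.Sequence.IsWeaklyRegular (OS n) (coordList n) := by
  classical
  refine ⟨fun i hi => ?_⟩
  have hi' : i < n := by simpa [coordList] using hi
  have e1 : (coordList n)[i] = coordS ⟨i, hi'⟩ := by simp [coordList]
  have e2 : (coordList n).take i = ((List.finRange n).take i).map coordS := by
    rw [coordList, List.map_take]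
  rw [e1, e2, ofList_map_coordS, isSMulRegular_quotient_iff_mem_of_smul_mem]
  intro f hf
  rw [smul_eq_mul, Ideal.mul_top, mem_span_coordS_iff] at *
  intro d hd
  have h1 := hf (d + Finsupp.single ⟨i, hi'⟩ 1) fun j hj => by
    rw [Finsupp.add_apply, hd j hj, zero_add, Finsupp.single_apply, if_neg]
    rintro rfl
    rw [List.mem_toFinset, List.mem_take_iff_getElem] at hj
    obtain ⟨k, hk, hk'⟩ := hj
    rw [List.getElem_finRange] at hk'
    have := congrArg Fin.val hk'
    simp at this hk
    omega
  rw [smul_eq_mul, map_mul, toSeries_coordS, add_comm, MvPowerSeries.X, MvPowerSeries.coeff_add_monomial_mul,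
    one_mul] at h1
  exact h1

/-! ### Derivations of `𝒪_S` -/

/-- By induction on k the values of δ lie in 𝔪ᵏ, because the Leibniz rule on a product with a factor
in 𝔪 gains one power; Krull's intersection theorem finishes. The usual argument on polynomials
followed by continuity is thereby avoided. -/
theorem derivation_eq_zero {n : ℕ} (δ : Derivation ℂ (OS n) (OS n))
    (h : ∀ i, δ (coordS i) = 0) : δ = 0 := by
  let 𝔪 := IsLocalRing.maximalIdeal (OS n)
  have h𝔪 : 𝔪 = Submodule.span (OS n) {r | r ∈ coordList n} := (ofList_coordList n).symm
  have h1 : ∀ k : ℕ, ∀ f, δ f ∈ 𝔪 ^ k := by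
    intro k
    induction k with
    | zero => simp
    | succ k ih =>
      have h2 : ∀ g ∈ 𝔪, δ g ∈ 𝔪 ^ (k + 1) := by
        intro g hg
        rw [h𝔪] at hg
        induction hg using Submodule.span_induction with
        | mem x hx =>
          obtain ⟨i, _, rfl⟩ := List.mem_map.mp hx
          rw [h i]; exact zero_mem _
        | zero => rw [map_zero]; exact zero_mem _
        | add x y _ _ hx hy => rw [map_add]; exact add_mem hx hy
        | smul a x hx hx' =>
          have hxm : x ∈ 𝔪 := by
            rw [h𝔪]; exact hx
          rw [smul_eq_mul, Derivation.leibniz, smul_eq_mul, smul_eq_mul, pow_succ']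
          refine add_mem (Ideal.mul_mem_left _ _ ?_) (Ideal.mul_mem_mul hxm (ih a))
          rw [← pow_succ']; exact hx'
      intro f
      have h3 : f - algebraMap ℂ (OS n) (valueAtZero f) ∈ 𝔪 := by
        rw [mem_maximalIdeal_iff, valueAtZero_eq, map_sub, map_sub, AlgHom.commutes,
          ← valueAtZero_eq, MvPowerSeries.algebraMap_apply, MvPowerSeries.constantCoeff_C]
        simp
      have h4 := h2 _ h3
      rwa [map_sub, Derivation.map_algebraMap, sub_zero] at h4
  ext f
  have h5 : δ f ∈ ⨅ k, 𝔪 ^ k := (Submodule.mem_iInf _).mpr fun k => h1 k f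
  rw [Ideal.iInf_pow_eq_bot_of_isLocalRing _ (IsLocalRing.maximalIdeal.isMaximal _).ne_top] at h5
  simpa using h5

theorem derivation_eq_sum {n : ℕ} (δ : Derivation ℂ (OS n) (OS n)) :
    δ = ∑ i, δ (coordS i) • partialS i := by
  rw [← sub_eq_zero]
  refine derivation_eq_zero _ fun j => ?_
  have h1 : (∑ i, δ (coordS i) • partialS i) (coordS j)
      = ∑ i, (δ (coordS i) • partialS i) (coordS j) := by
    change Derivation.coeFnAddMonoidHom _ _ = _
    rw [map_sum, Finset.sum_apply]
    rfl
  rw [Derivation.sub_apply, h1]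
  simp [partialS_coordS]

/-- A proper ideal of `𝒪_S` which is stable under the coordinate vector fields is zero. -/
theorem eq_zero_of_partialS_stable {n : ℕ} {P : Ideal (OS n)} (hP : P ≠ ⊤)
    (hstable : ∀ f ∈ P, ∀ i, partialS i f ∈ P) : P = ⊥ := by
  have key : ∀ k, ∀ d : Fin n →₀ ℕ, d.degree = k → ∀ f ∈ P,
      MvPowerSeries.coeff d (toSeries n f) = 0 := by
    intro k
    induction k with
    | zero =>
      intro d hd f hf
      rw [Finsupp.degree_eq_zero_iff] at hd
      subst hd
      exact (mem_maximalIdeal_iff f).mp (IsLocalRing.le_maximalIdeal hP hf)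
    | succ k ih =>
      intro d hd f hf
      have hne : d ≠ 0 := by rintro rfl; simp at hd
      obtain ⟨i, hi⟩ := Finsupp.ne_iff.mp hne
      have hle : Finsupp.single i 1 ≤ d := by
        rw [Finsupp.single_le_iff]; exact Nat.one_le_iff_ne_zero.mpr hi
      obtain ⟨e, rfl⟩ := exists_add_of_le hle
      rw [map_add, Finsupp.degree_single, add_comm, Nat.add_right_cancel_iff] at hd
      -- The coefficient of f at e + εᵢ is that of ∂f/∂xᵢ at e divided by eᵢ + 1, so vanishing
      -- climbs one degree at a time.
      have h1 := ih e hd _ (hstable f hf i)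
      rw [toSeries_partialS, MvPowerSeries.coeff_pderiv, mul_eq_zero] at h1
      rcases h1 with h1 | h1
      · rwa [add_comm]
      · exact absurd h1 (Nat.cast_add_one_ne_zero _)
  rw [eq_bot_iff]
  intro f hf
  rw [Ideal.mem_bot]
  apply toSeries_injective
  ext d
  rw [key _ d rfl f hf, map_zero, map_zero]

section HomologicalAlgebra

open CategoryTheory CategoryTheory.Abelian

universe u v

/-! ### Vanishing of `Ext` -/

section ExtVanishing

variable {R : Type u} [CommRing R]

theorem ext_smul_eq_zero_of_smul_left {N X : ModuleCat.{u} R} {r : R} (h : ∀ x : N, r • x = 0)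
    {i : ℕ} (e : Ext N X i) : r • e = 0 := by
  have h0 : r • 𝟙 N = 0 := by
    ext x
    exact h x
  rw [← Ext.mk₀_id_comp e, ← Ext.smul_comp, ← Ext.mk₀_smul, h0, Ext.mk₀_zero, Ext.zero_comp]

theorem ext_comp_smul_id (r : R) {N X : ModuleCat.{u} R} {i : ℕ} (e : Ext N X i) :
    e.comp (Ext.mk₀ (r • 𝟙 X)) (add_zero i) = r • e :=
  (Ext.smul_eq_comp_mk₀ e r).symm

theorem subsingleton_ext_X₂ {S : ShortComplex (ModuleCat.{u} R)} (hS : S.ShortExact)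
    (Y : ModuleCat.{u} R) (i : ℕ) (h₁ : Subsingleton (Ext S.X₁ Y i))
    (h₃ : Subsingleton (Ext S.X₃ Y i)) : Subsingleton (Ext S.X₂ Y i) := by
  refine subsingleton_of_forall_eq 0 fun e => ?_
  obtain ⟨e', rfl⟩ := Ext.contravariant_sequence_exact₂ hS Y e (Subsingleton.elim _ _)
  rw [Subsingleton.elim e' 0, Ext.comp_zero]

theorem subsingleton_ext_of_iso {N N' : ModuleCat.{u} R} (φ : N ≅ N') (Y : ModuleCat.{u} R)
    (i : ℕ) (h : Subsingleton (Ext N Y i)) : Subsingleton (Ext N' Y i) := by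
  refine subsingleton_of_forall_eq 0 fun e => ?_
  rw [← Ext.mk₀_id_comp e, ← φ.inv_hom_id, ← Ext.mk₀_comp_mk₀_assoc,
    Subsingleton.elim ((Ext.mk₀ φ.hom).comp e (zero_add i)) 0, Ext.comp_zero]

theorem subsingleton_ext_of_subsingleton_left {N : ModuleCat.{u} R} [Subsingleton N]
    (Y : ModuleCat.{u} R) (i : ℕ) : Subsingleton (Ext N Y i) := by
  refine subsingleton_of_forall_eq 0 fun e => ?_
  have h0 : 𝟙 N = 0 := by
    ext x
    exact Subsingleton.elim _ _
  rw [← Ext.mk₀_id_comp e, h0, Ext.mk₀_zero, Ext.zero_comp]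

/-- The exact sequence `0 → R/K → R/J → R/(J + aR) → 0` for `K = J : a`, the first map being
multiplication by `a`. -/
abbrev colonComplex (J K : Ideal R) (a : R) (hK : ∀ r, r ∈ K ↔ a * r ∈ J) :
    ShortComplex (ModuleCat.{u} R) :=
  ModuleCat.shortComplexOfCompEqZero
    (Submodule.mapQ K J (LinearMap.mulLeft R a) fun r hr => (hK r).mp hr)
    (Submodule.mapQ J (J ⊔ Ideal.span {a}) LinearMap.id fun r hr => Ideal.mem_sup_left hr) (by
      refine Submodule.linearMap_qext _ (LinearMap.ext_ring ?_)
      change Submodule.Quotient.mk (a * 1) = (0 : R ⧸ (J ⊔ Ideal.span {a}))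
      rw [mul_one, Submodule.Quotient.mk_eq_zero]
      exact Ideal.mem_sup_right (Ideal.mem_span_singleton_self a))

theorem colonComplex_shortExact (J K : Ideal R) (a : R) (hK : ∀ r, r ∈ K ↔ a * r ∈ J) :
    (colonComplex J K a hK).ShortExact := by
  refine ModuleCat.shortComplex_shortExact _ ?_ ?_ ?_
  · intro x
    obtain ⟨r, rfl⟩ := Submodule.mkQ_surjective _ x
    change Submodule.Quotient.mk r = (0 : R ⧸ (J ⊔ Ideal.span {a})) ↔
      ∃ y, Submodule.mapQ K J (LinearMap.mulLeft R a) (fun r hr => (hK r).mp hr) y =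
        Submodule.Quotient.mk r
    rw [Submodule.Quotient.mk_eq_zero]
    constructor
    · intro hr
      obtain ⟨j, hj, b, hb, rfl⟩ := Submodule.mem_sup.mp hr
      obtain ⟨c, rfl⟩ := Ideal.mem_span_singleton'.mp hb
      refine ⟨Submodule.Quotient.mk c, ?_⟩
      change Submodule.Quotient.mk (a * c) = (Submodule.Quotient.mk (j + c * a) : R ⧸ J)
      rw [Submodule.Quotient.eq]
      have : a * c - (j + c * a) = -j := by ring
      rw [this]
      exact neg_mem hj
    · rintro ⟨y, hy⟩
      obtain ⟨c, rfl⟩ := Submodule.mkQ_surjective _ y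
      change Submodule.Quotient.mk (a * c) = (Submodule.Quotient.mk r : R ⧸ J) at hy
      rw [Submodule.Quotient.eq] at hy
      have : r = a * c - (a * c - r) := by ring
      rw [this]
      exact sub_mem (Ideal.mem_sup_right (Ideal.mul_mem_right _ _ (Ideal.mem_span_singleton_self a)))
        (Ideal.mem_sup_left hy)
  · change Function.Injective
      (Submodule.mapQ K J (LinearMap.mulLeft R a) fun r hr => (hK r).mp hr)
    rw [← LinearMap.ker_eq_bot, LinearMap.ker_eq_bot']
    intro x hx
    obtain ⟨r, rfl⟩ := Submodule.mkQ_surjective _ x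
    change Submodule.Quotient.mk (a * r) = (0 : R ⧸ J) at hx
    rw [Submodule.Quotient.mk_eq_zero] at hx
    rw [Submodule.mkQ_apply, Submodule.Quotient.mk_eq_zero]
    exact (hK r).mpr hx
  · change Function.Surjective
      (Submodule.mapQ J (J ⊔ Ideal.span {a}) LinearMap.id fun r hr => Ideal.mem_sup_left hr)
    intro x
    obtain ⟨r, rfl⟩ := Submodule.mkQ_surjective _ x
    exact ⟨Submodule.Quotient.mk r, by simp⟩

variable [IsLocalRing R] [IsNoetherianRing R]

/-- If `Extⁱ(k, M)` vanishes for `i > d`, then so does `Extⁱ(R/J, M)` for every ideal `J`. -/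
theorem subsingleton_ext_quotient (M : ModuleCat.{u} R) [Module.Finite R M] {d : ℕ}
    (h : ∀ i, d < i → Subsingleton (Ext (ModuleCat.of R (IsLocalRing.ResidueField R)) M i))
    (J : Ideal R) : ∀ i, d < i → Subsingleton (Ext (ModuleCat.of R (R ⧸ J)) M i) := by
  induction J using IsNoetherian.induction with
  | hgt J ih =>
  intro i hi
  by_cases htop : J = ⊤
  · have : Subsingleton (ModuleCat.of R (R ⧸ J)) := Submodule.Quotient.subsingleton_iff.mpr htop
    exact subsingleton_ext_of_subsingleton_left _ _
  by_cases hprime : Ideal.IsPrime J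
  · by_cases hmax : J = IsLocalRing.maximalIdeal R
    · subst hmax
      exact h i hi
    · obtain ⟨x, hx, hxJ⟩ := SetLike.exists_of_lt
        (lt_of_le_of_ne (IsLocalRing.le_maximalIdeal htop) hmax)
      have hK : ∀ r, r ∈ J ↔ x * r ∈ J := fun r =>
        ⟨fun hr => Ideal.mul_mem_left _ _ hr, fun hr => (hprime.mem_or_mem hr).resolve_left hxJ⟩
      have hlt : J < J ⊔ Ideal.span {x} := by
        refine lt_of_le_of_ne le_sup_left fun heq => hxJ ?_
        rw [heq]
        exact Ideal.mem_sup_right (Ideal.mem_span_singleton_self x)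
      -- For a non-maximal prime J and x ∈ 𝔪 outside it, multiplication by x on R/J has cokernel
      -- R/(J + xR), whose next Ext vanishes by induction. So x acts surjectively on Extⁱ(R/J, M),
      -- and Nakayama's lemma kills it.
      have h3 := ih _ hlt (i + 1) (by omega)
      by_contra hcon
      rw [not_subsingleton_iff_nontrivial] at hcon
      refine Submodule.top_ne_pointwise_smul_of_mem_jacobson_annihilator
        (R := R) (M := Ext (ModuleCat.of R (R ⧸ J)) M i) (r := x)
        ((IsLocalRing.maximalIdeal_le_jacobson _) hx) ?_
      rw [eq_comm, eq_top_iff]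
      intro e _
      obtain ⟨e', he'⟩ := Ext.contravariant_sequence_exact₁ (colonComplex_shortExact J J x hK) M e
        (add_comm 1 i) (Subsingleton.elim (α := Ext (ModuleCat.of R (R ⧸ J ⊔ Ideal.span {x})) M _) _ _)
      have hf : (colonComplex J J x hK).f = x • 𝟙 (ModuleCat.of R (R ⧸ J)) := by
        refine ModuleCat.hom_ext (LinearMap.ext fun y => ?_)
        obtain ⟨r, rfl⟩ := Submodule.mkQ_surjective _ y
        rfl
      rw [hf, Ext.mk₀_smul, Ext.smul_comp, Ext.mk₀_id_comp] at he'
      rw [← he']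
      exact Submodule.smul_mem_pointwise_smul _ _ _ trivial
  -- For J not prime, both J : a and J + aR are strictly larger than J, and R/J is an extension of
  -- the two quotients.
  · obtain ⟨a, ha, b, hb, hab⟩ : ∃ a, a ∉ J ∧ ∃ b, b ∉ J ∧ a * b ∈ J := by
      rw [Ideal.isPrime_iff] at hprime
      push Not at hprime
      obtain ⟨a, b, hab, ha, hb⟩ := hprime htop
      exact ⟨a, ha, b, hb, hab⟩
    have hK : ∀ r, r ∈ Submodule.comap (LinearMap.mulLeft R a) J ↔ a * r ∈ J := fun r => Iff.rfl
    refine subsingleton_ext_X₂ (colonComplex_shortExact J _ a hK) M i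
      (ih _ (lt_of_le_of_ne (fun r hr => Ideal.mul_mem_left _ _ hr) fun heq => hb ?_) i hi)
      (ih _ (lt_of_le_of_ne le_sup_left fun heq => ha ?_) i hi)
    · rw [heq]; exact hab
    · rw [heq]; exact Ideal.mem_sup_right (Ideal.mem_span_singleton_self a)

end ExtVanishing

/-! ### Injective dimension tested on cyclic modules and on the residue field -/

section InjectiveDimension

variable {R : Type u} [CommRing R]

/-- The obstruction to extending a map J → M to R lies in Ext¹(R/J, M). -/
theorem baer_of_subsingleton_ext_one (M : ModuleCat.{u} R)
    (h : ∀ J : Ideal R, Subsingleton (Ext (ModuleCat.of R (R ⧸ J)) M 1)) : Module.Baer R M := by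
  intro J g
  let S : ShortComplex (ModuleCat.{u} R) := ModuleCat.shortComplexOfCompEqZero J.subtype
    (Submodule.mkQ J) (LinearMap.exact_subtype_mkQ J).linearMap_comp_eq_zero
  have hS : S.ShortExact := ModuleCat.shortComplex_shortExact _
    (LinearMap.exact_subtype_mkQ J) J.injective_subtype (Submodule.mkQ_surjective J)
  obtain ⟨e, he⟩ := Ext.contravariant_sequence_exact₁ hS M (Ext.mk₀ (ModuleCat.ofHom g))
    (add_zero 1) (Subsingleton.elim (h := h J) _ _)
  obtain ⟨φ, rfl⟩ := (Ext.mk₀_bijective _ _).2 e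
  rw [Ext.mk₀_comp_mk₀] at he
  have he' := (Ext.mk₀_bijective _ _).1 he
  refine ⟨φ.hom, fun x hx => ?_⟩
  exact congrArg (fun ψ => ψ.hom ⟨x, hx⟩) he'

/-- Dimension shifting along an embedding of `M` into an injective module reduces to Baer's
criterion. -/
theorem hasInjectiveDimensionLE_of_subsingleton_ext (M : ModuleCat.{u} R) (d : ℕ)
    (h : ∀ J : Ideal R, Subsingleton (Ext (ModuleCat.of R (R ⧸ J)) M (d + 1))) :
    HasInjectiveDimensionLE M d := by
  induction d generalizing M with
  | zero =>
    have h1 : Module.Injective R M := (baer_of_subsingleton_ext_one M h).injective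
    rw [HasInjectiveDimensionLE, zero_add, ← injective_iff_hasInjectiveDimensionLT_one]
    exact (Module.injective_iff_injective_object R M).mp h1
  | succ d ih =>
    let ⟨I, _, f, _⟩ := EnoughInjectives.presentation M
    have injf : Function.Injective f.hom := (ModuleCat.mono_iff_injective f).mp ‹_›
    let S : ShortComplex (ModuleCat.{u} R) :=
      ModuleCat.shortComplexOfCompEqZero _ _ f.hom.exact_map_mkQ_range.linearMap_comp_eq_zero
    have hS := ModuleCat.shortComplex_shortExact S
      f.hom.exact_map_mkQ_range injf (Submodule.mkQ_surjective _)
    refine (hS.hasInjectiveDimensionLT_X₃_iff d inferInstance).mp (ih S.X₃ fun J => ?_)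
    refine subsingleton_of_forall_eq 0 fun e => ?_
    obtain ⟨e', rfl⟩ := Ext.covariant_sequence_exact₃ _ hS e rfl
      (Subsingleton.elim (h := h J) _ _)
    have : e' = 0 := Ext.eq_zero_of_injective (I := S.X₂) e'
    rw [this, Ext.zero_comp]

theorem hasInjectiveDimensionLE_of_subsingleton_ext_residueField [IsLocalRing R]
    [IsNoetherianRing R] (M : ModuleCat.{u} R) [Module.Finite R M] {d : ℕ}
    (h : ∀ i, d < i → Subsingleton (Ext (ModuleCat.of R (IsLocalRing.ResidueField R)) M i)) :
    HasInjectiveDimensionLE M d :=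
  hasInjectiveDimensionLE_of_subsingleton_ext M d fun J =>
    subsingleton_ext_quotient M h J (d + 1) (Nat.lt_succ_self d)

end InjectiveDimension

/-! ### `Ext` and regular sequences -/

section Rees

variable {R : Type u} [CommRing R]

open RingTheory.Sequence Pointwise

/-- When the first map induces zero on Ext, the connecting map Extⁱ(N, X₃) → Ext^{i+1}(N, X₁) is
surjective. Here it is applied to multiplication by an element that kills `N`. -/
theorem subsingleton_ext_of_shortExact {S : ShortComplex (ModuleCat.{u} R)} (hS : S.ShortExact)
    {N : ModuleCat.{u} R} {l : ℕ}
    (h0 : ∀ {i : ℕ} (x : Ext N S.X₁ i), x.comp (Ext.mk₀ S.f) (add_zero i) = 0)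
    (h1 : ∀ i < l, Subsingleton (Ext N S.X₃ i)) :
    ∀ i < l + 1, Subsingleton (Ext N S.X₁ i) := by
  intro i hi
  refine subsingleton_of_forall_eq 0 fun x => ?_
  rcases i with _ | i
  · have : Mono S.f := hS.mono_f
    refine Ext.postcomp_mk₀_injective_of_mono N S.f ?_
    rw [map_zero]
    exact h0 x
  · obtain ⟨y, rfl⟩ := Ext.covariant_sequence_exact₁ N hS x (h0 x) rfl
    rw [Subsingleton.elim (h := h1 i (by omega)) y 0, Ext.zero_comp]

theorem bijective_comp_extClass {S : ShortComplex (ModuleCat.{u} R)} (hS : S.ShortExact)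
    {N : ModuleCat.{u} R} {l : ℕ}
    (h0 : ∀ {i : ℕ} (x : Ext N S.X₁ i), x.comp (Ext.mk₀ S.f) (add_zero i) = 0)
    (h2 : Subsingleton (Ext N S.X₂ l)) :
    Function.Bijective fun y : Ext N S.X₃ l => y.comp hS.extClass (rfl : l + 1 = l + 1) := by
  constructor
  · intro y y' hy
    rw [← sub_eq_zero]
    have h4 : (y - y').comp hS.extClass (rfl : l + 1 = l + 1) = 0 := by
      rw [sub_eq_add_neg, Ext.add_comp, Ext.neg_comp, ← sub_eq_add_neg, sub_eq_zero]
      exact hy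
    obtain ⟨x, hx⟩ := Ext.covariant_sequence_exact₃ N hS (y - y') rfl h4
    rw [← hx, Subsingleton.elim x 0, Ext.zero_comp]
  · intro x
    exact Ext.covariant_sequence_exact₁ N hS x (h0 x) rfl

theorem bijective_mk₀_comp_comp {N Q Q' X' X : ModuleCat.{u} R} {l : ℕ} (e : Q ≅ Q')
    (θ : Ext Q' X' l) (η : Ext X' X 1)
    (h1 : Function.Bijective fun g : N ⟶ Q' => (Ext.mk₀ g).comp θ (zero_add _))
    (h2 : Function.Bijective fun y : Ext N X' l => y.comp η (rfl : l + 1 = l + 1)) :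
    Function.Bijective fun f : N ⟶ Q =>
      (Ext.mk₀ f).comp ((Ext.mk₀ e.hom).comp (θ.comp η (rfl : l + 1 = l + 1)) (zero_add _))
        (zero_add _) := by
  have h3 : (fun f : N ⟶ Q =>
      (Ext.mk₀ f).comp ((Ext.mk₀ e.hom).comp (θ.comp η (rfl : l + 1 = l + 1)) (zero_add _))
        (zero_add _)) = (fun y : Ext N X' l => y.comp η (rfl : l + 1 = l + 1)) ∘
      (fun g : N ⟶ Q' => (Ext.mk₀ g).comp θ (zero_add _)) ∘ fun f => f ≫ e.hom := by
    ext f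
    simp only [Function.comp_apply]
    rw [Ext.mk₀_comp_mk₀_assoc, Ext.comp_assoc _ _ _ (zero_add _) rfl (by omega)]
  exact h3 ▸ h2.comp (h1.comp (e.homToEquiv (Z := N)).bijective)

/-- The Rees isomorphism `Hom(N, X/(rs)X) ≃ Extˡ(N, X)` for a module `N` annihilated by the regular
sequence `rs` of length `l`, given by a class in `Extˡ(X/(rs)X, X)`. -/
theorem exists_rees_class (rs : List R) (X : ModuleCat.{u} R) (hrs : IsWeaklyRegular X rs) :
    ∃ θ : Ext (ModuleCat.of R (X ⧸ (Ideal.ofList rs • ⊤ : Submodule R X))) X rs.length,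
      ∀ N : ModuleCat.{u} R, (∀ r ∈ rs, ∀ x : N, r • x = 0) →
        (∀ i < rs.length, Subsingleton (Ext N X i)) ∧
        Function.Bijective fun f : N ⟶ ModuleCat.of R (X ⧸ (Ideal.ofList rs • ⊤ : Submodule R X)) =>
          (Ext.mk₀ f).comp θ (zero_add _) := by
  induction rs generalizing X with
  | nil =>
    let e : (X ⧸ (Ideal.ofList ([] : List R) • ⊤ : Submodule R X)) ≃ₗ[R] X :=
      Submodule.quotEquivOfEqBot _ (by rw [Ideal.ofList_nil, Submodule.bot_smul])
    refine ⟨Ext.mk₀ e.toModuleIso.hom, fun N _ => ⟨fun i hi => absurd hi (Nat.not_lt_zero i), ?_⟩⟩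
    have h1 : (fun f : N ⟶ ModuleCat.of R (X ⧸ (Ideal.ofList ([] : List R) • ⊤ : Submodule R X)) =>
        (Ext.mk₀ f).comp (Ext.mk₀ e.toModuleIso.hom) (zero_add _)) =
        Ext.mk₀ ∘ fun f => f ≫ e.toModuleIso.hom := by
      ext f
      exact Ext.mk₀_comp_mk₀ _ _
    exact h1 ▸ (Ext.mk₀_bijective _ _).comp (e.toModuleIso.homToEquiv (Z := N)).bijective
  | cons r rs ih =>
    rw [isWeaklyRegular_cons_iff] at hrs
    obtain ⟨θ, hθ⟩ := ih (ModuleCat.of R (QuotSMulTop r X)) hrs.2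
    have hS := hrs.1.smulShortComplex_shortExact
    refine ⟨(Ext.mk₀ (Submodule.quotOfListConsSMulTopEquivQuotSMulTopInner X r rs).toModuleIso.hom).comp
      (θ.comp hS.extClass rfl) (zero_add _), fun N hN => ?_⟩
    obtain ⟨h1, h2⟩ := hθ N fun s hs => hN s (List.mem_cons_of_mem _ hs)
    -- r acts on Ext through N, where it is zero. So the connecting map of 0 → X → X → X/rX → 0 is
    -- onto in each degree and bijective in the first degree where Ext(N, X) can be non-zero.
    have h0 : ∀ {i : ℕ} (x : Ext N X i), x.comp (Ext.mk₀ (r • 𝟙 X)) (add_zero i) = 0 :=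
      fun x => (ext_comp_smul_id r x).trans
        (ext_smul_eq_zero_of_smul_left (hN r List.mem_cons_self) x)
    have hvan := subsingleton_ext_of_shortExact hS h0 h1
    exact ⟨hvan, bijective_mk₀_comp_comp _ θ hS.extClass h2
      (bijective_comp_extClass hS h0 (hvan rs.length (Nat.lt_succ_self _)))⟩

end Rees

/-! ### Change of rings -/

section ChangeOfRings

variable {C D : Type*} [Category.{v} C] [Abelian C] [HasExt.{u} C] [Category.{v} D]
  [Abelian D] [HasExt.{u} D] (F : C ⥤ D) [F.Additive] [Limits.PreservesFiniteLimits F]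
  [Limits.PreservesFiniteColimits F]

/-- The map `Extⁱ(N, Y) → Ext^{i+c}(F N, X)` given by a class in `Ext^c(F Y, X)`. -/
def extShift {Y : C} {X : D} {c : ℕ} (θ : Ext (F.obj Y) X c) (N : C) (i : ℕ) :
    Ext N Y i →+ Ext (F.obj N) X (i + c) :=
  (Ext.postcomp θ (F.obj N) (rfl : i + c = i + c)).comp (F.mapExtAddHom N Y i)

theorem extShift_apply {Y : C} {X : D} {c : ℕ} (θ : Ext (F.obj Y) X c) {N : C} {i : ℕ}
    (e : Ext N Y i) : extShift F θ N i e = (e.mapExactFunctor F).comp θ rfl := rfl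

theorem extShift_comp {Y : C} {X : D} {c : ℕ} (θ : Ext (F.obj Y) X c) {N N' : C} {i j k : ℕ}
    (f : Ext N N' j) (e : Ext N' Y i) (hk : j + i = k) :
    extShift F θ N k (f.comp e hk) =
      (f.mapExactFunctor F).comp (extShift F θ N' i e) (by omega) := by
  rw [extShift_apply, extShift_apply, Ext.mapExactFunctor_comp]
  exact Ext.comp_assoc _ _ _ _ _ (by omega)

/-- Induction on i by syzygies 0 → K → Q → N → 0. Projectivity of Q kills Ext(Q, Y) in positive
degrees, and the last clause of `hp` kills Ext(F Q, X) above degree c; the five-lemma chase is then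
explicit. -/
theorem bijective_extShift {Y : C} {X : D} {c : ℕ} (θ : Ext (F.obj Y) X c) (p : C → Prop)
    (hp : ∀ N, p N → ∃ (K Q : C) (f : K ⟶ Q) (g : Q ⟶ N) (w : f ≫ g = 0),
      (ShortComplex.mk f g w).ShortExact ∧ p K ∧ p Q ∧ Projective Q ∧
        ∀ j, c < j → Subsingleton (Ext (F.obj Q) X j))
    (h0 : ∀ N, p N → Function.Bijective fun f : N ⟶ Y =>
      (Ext.mk₀ (F.map f)).comp θ (zero_add c)) (i : ℕ) :
    ∀ N, p N → Function.Bijective (extShift F θ N i) := by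
  have hzero : ∀ N, p N → Function.Bijective (extShift F θ N 0) := by
    intro N hN
    have key : ∀ e : N ⟶ Y, extShift F θ N 0 (Ext.mk₀ e) =
        ((Ext.mk₀ (F.map e)).comp θ rfl : Ext (F.obj N) X (0 + c)) := by
      intro e
      rw [extShift_apply, Ext.mapExactFunctor_mk₀]
    have h0' : Function.Bijective fun f : N ⟶ Y =>
        ((Ext.mk₀ (F.map f)).comp θ rfl : Ext (F.obj N) X (0 + c)) := by
      have := h0 N hN
      generalize_proofs q at *
      have hq : ∀ (b : ℕ) (q : 0 + c = b), (Function.Bijective fun f : N ⟶ Y =>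
        ((Ext.mk₀ (F.map f)).comp θ q : Ext (F.obj N) X b)) → Function.Bijective fun f : N ⟶ Y =>
        ((Ext.mk₀ (F.map f)).comp θ rfl : Ext (F.obj N) X (0 + c)) := by
        rintro b rfl h
        exact h
      exact hq _ (zero_add c) this
    have h2 := h0'.comp (Ext.homEquiv₀ (X := N) (Y := Y)).bijective
    refine (funext fun e => ?_ : _ = ⇑(extShift F θ N 0)) ▸ h2
    obtain ⟨e, rfl⟩ := (Ext.mk₀_bijective _ _).2 e
    rw [key]
    simp [Ext.homEquiv₀]
  induction i with
  | zero => exact hzero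
  | succ i ih =>
    intro N hN
    obtain ⟨K, Q, f, g, w, hS, hK, hQ, hproj, hvan⟩ := hp N hN
    have hS' := hS.map_of_exact F
    have hext : hS.extClass.mapExactFunctor F = hS'.extClass := Ext.mapExactFunctor_extClass F hS
    constructor
    · rw [injective_iff_map_eq_zero]
      intro e' he'
      obtain ⟨e, rfl⟩ := Ext.contravariant_sequence_exact₃ hS Y e'
        (Ext.eq_zero_of_projective (P := Q) _) (add_comm 1 i)
      rw [extShift_comp] at he'
      obtain ⟨z, hz⟩ := Ext.contravariant_sequence_exact₁ hS' X (extShift F θ K i e)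
        (by omega : 1 + (i + c) = i + 1 + c) (by rw [← hext]; exact he')
      -- In degree c the group Ext(F Q, X) need not vanish; there the degree-zero case for Q lifts
      -- z.
      obtain ⟨w', rfl⟩ : ∃ w', extShift F θ Q i w' = z := by
        rcases i with _ | i
        · exact (hzero Q hQ).2 z
        · have := hvan (i + 1 + c) (by omega)
          exact ⟨0, Subsingleton.elim (α := Ext (F.obj Q) X (i + 1 + c)) _ _⟩
      have h3 : e = (Ext.mk₀ f).comp w' (zero_add i) := by
        apply (ih K hK).1
        rw [extShift_comp, Ext.mapExactFunctor_mk₀]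
        exact hz.symm
      have h4 := ShortComplex.ShortExact.extClass_comp hS
      rw [h3, ← Ext.comp_assoc (hS.extClass) (Ext.mk₀ f) w' (by omega : 1 + 0 = 1) (by omega)
        (by omega : 1 + 0 + i = i + 1)]
      rw [h4, Ext.zero_comp]
    · intro y
      obtain ⟨y', hy'⟩ := Ext.contravariant_sequence_exact₃ hS' X y
        (Subsingleton.elim (h := hvan (i + 1 + c) (by omega)) _ _)
        (by omega : 1 + (i + c) = i + 1 + c)
      obtain ⟨e, rfl⟩ := (ih K hK).2 y'
      refine ⟨hS.extClass.comp e (add_comm 1 i), ?_⟩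
      rw [extShift_comp, hext]
      exact hy'

end ChangeOfRings

/-! ### Regular sequences: retracts and lifting injectivity -/

section RegularSequences

open RingTheory.Sequence Pointwise

variable {R : Type u} [CommRing R]

/-- Needed to pass from a sequence regular on R × M to one regular on both factors. -/
theorem isWeaklyRegular_of_retract (rs : List R) {M N : Type v} [AddCommGroup M] [Module R M]
    [AddCommGroup N] [Module R N] (f : M →ₗ[R] N) (g : N →ₗ[R] M) (hgf : g ∘ₗ f = LinearMap.id)
    (h : IsWeaklyRegular N rs) : IsWeaklyRegular M rs := by
  induction rs generalizing M N with
  | nil => exact IsWeaklyRegular.nil R M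
  | cons r rs ih =>
    rw [isWeaklyRegular_cons_iff] at h ⊢
    refine ⟨?_, ih (QuotSMulTop.map r f) (QuotSMulTop.map r g) ?_ h.2⟩
    · have hf : Function.Injective f :=
        Function.LeftInverse.injective (g := g) fun x => LinearMap.congr_fun hgf x
      exact h.1.of_injective f hf
    · rw [← QuotSMulTop.map_comp, hgf, QuotSMulTop.map_id]

theorem mem_ofList_cons_smul_top_iff (r : R) (rs : List R) {M : Type v} [AddCommGroup M]
    [Module R M] (x : M) : x ∈ (Ideal.ofList (r :: rs) • ⊤ : Submodule R M) ↔
      (Submodule.Quotient.mk x : QuotSMulTop r M) ∈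
        (Ideal.ofList rs • ⊤ : Submodule R (QuotSMulTop r M)) := by
  have h1 : (Ideal.ofList rs • ⊤ : Submodule R (QuotSMulTop r M)) =
      (Ideal.ofList rs • ⊤ : Submodule R M).map (Submodule.mkQ (r • ⊤ : Submodule R M)) := by
    rw [Submodule.map_smul'', Submodule.map_top, Submodule.range_mkQ]
  rw [h1, Ideal.ofList_cons, Submodule.sup_smul, Submodule.ideal_span_singleton_smul,
    ← Submodule.mkQ_apply, ← Submodule.mem_comap, Submodule.comap_map_mkQ]

/-- A surjection `X → M` that is injective modulo an `M`-regular sequence is injective. -/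
theorem injective_of_isWeaklyRegular [IsLocalRing R] [IsNoetherianRing R] (rs : List R)
    (hmem : ∀ r ∈ rs, r ∈ IsLocalRing.maximalIdeal R) {X M : Type v} [AddCommGroup X] [Module R X]
    [AddCommGroup M] [Module R M] [Module.Finite R X] (f : X →ₗ[R] M)
    (hf : Function.Surjective f) (hrs : IsWeaklyRegular M rs)
    (hinj : ∀ x, f x ∈ (Ideal.ofList rs • ⊤ : Submodule R M) →
      x ∈ (Ideal.ofList rs • ⊤ : Submodule R X)) : Function.Injective f := by
  induction rs generalizing X M with
  | nil =>
    rw [← LinearMap.ker_eq_bot, LinearMap.ker_eq_bot']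
    intro x hx
    have := hinj x (by rw [hx]; exact zero_mem _)
    simpa using this
  | cons r rs ih =>
    rw [isWeaklyRegular_cons_iff] at hrs
    have h1 : Function.Injective (QuotSMulTop.map r f) := by
      refine ih (fun s hs => hmem s (List.mem_cons_of_mem _ hs)) _
        (QuotSMulTop.map_surjective r hf) hrs.2 fun x hx => ?_
      obtain ⟨x, rfl⟩ := Submodule.mkQ_surjective _ x
      exact (mem_ofList_cons_smul_top_iff r rs x).mp
        (hinj x ((mem_ofList_cons_smul_top_iff r rs (f x)).mpr hx))
    -- The kernel K of f satisfies K = rK: an element of K vanishes modulo r, hence equals ry, and f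
    -- y = 0 because r is regular on M. Nakayama's lemma applies.
    rw [← LinearMap.ker_eq_bot]
    refine Submodule.eq_bot_of_le_smul_of_le_jacobson_bot (Ideal.span {r}) _
      (IsNoetherian.noetherian _) ?_ ?_
    · intro x hx
      have h2 : (Submodule.Quotient.mk x : QuotSMulTop r X) = 0 := by
        apply h1
        rw [map_zero]
        change (Submodule.Quotient.mk (f x) : QuotSMulTop r M) = 0
        rw [LinearMap.mem_ker.mp hx, Submodule.Quotient.mk_zero]
      rw [Submodule.Quotient.mk_eq_zero] at h2
      obtain ⟨y, -, rfl⟩ := h2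
      rw [Submodule.ideal_span_singleton_smul]
      refine Submodule.smul_mem_pointwise_smul _ _ _ ?_
      rw [LinearMap.mem_ker]
      have h3 : r • f y = 0 := by
        rw [← map_smul]
        exact hx
      exact hrs.1.right_eq_zero_of_smul h3
    · rw [Ideal.span_singleton_le_iff_mem]
      exact IsLocalRing.maximalIdeal_le_jacobson _ (hmem r List.mem_cons_self)

end RegularSequences

/-! ### Modules of finite length and the residue field -/

section FiniteLength

variable {R : Type u} [CommRing R]

theorem injective_of_surjective_of_length {P Q : Type v} [AddCommGroup P] [Module R P]
    [AddCommGroup Q] [Module R Q] (f : P →ₗ[R] Q) (hf : Function.Surjective f)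
    (hl : Module.length R P = Module.length R Q) (hfin : IsFiniteLength R P) :
    Function.Injective f := by
  have h1 := Module.length_eq_add_of_exact (LinearMap.ker f).subtype f
    (LinearMap.ker f).injective_subtype hf (LinearMap.exact_subtype_ker_map f)
  rw [← Module.length_ne_top_iff] at hfin
  have h2 : Module.length R (LinearMap.ker f) = 0 := by
    rw [← hl] at h1
    have h3 : (0 : ℕ∞) + Module.length R P = Module.length R (LinearMap.ker f) + Module.length R P := by
      rw [zero_add]; exact h1
    exact (WithTop.add_right_cancel hfin h3).symm
  rw [Module.length_eq_zero_iff] at h2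
  rw [← LinearMap.ker_eq_bot]
  exact (Submodule.subsingleton_iff_eq_bot).mp h2

theorem surjective_of_injective_of_length {P Q : Type v} [AddCommGroup P] [Module R P]
    [AddCommGroup Q] [Module R Q] (f : P →ₗ[R] Q) (hf : Function.Injective f)
    (hl : Module.length R P = Module.length R Q) (hfin : IsFiniteLength R P) :
    Function.Surjective f := by
  have h1 := Module.length_eq_add_of_exact f (LinearMap.range f).mkQ
    hf (Submodule.mkQ_surjective _) (LinearMap.exact_map_mkQ_range f)
  rw [← Module.length_ne_top_iff] at hfin
  have h2 : Module.length R (Q ⧸ LinearMap.range f) = 0 := by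
    rw [← hl] at h1
    have h3 : Module.length R P + 0 = Module.length R P + Module.length R (Q ⧸ LinearMap.range f) := by
      rw [add_zero]; exact h1
    exact (WithTop.add_left_cancel hfin h3).symm
  rw [Module.length_eq_zero_iff, Submodule.Quotient.subsingleton_iff] at h2
  exact LinearMap.range_eq_top.mp h2

variable [IsLocalRing R]

theorem nonempty_equiv_residueField (N : Type v) [AddCommGroup N] [Module R N]
    [IsSimpleModule R N] : Nonempty (N ≃ₗ[R] IsLocalRing.ResidueField R) := by
  obtain ⟨I, hI, ⟨e⟩⟩ := isSimpleModule_iff_quot_maximal.mp ‹IsSimpleModule R N›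
  obtain rfl := IsLocalRing.eq_maximalIdeal hI
  exact ⟨e⟩

instance isSimpleModule_residueField : IsSimpleModule R (IsLocalRing.ResidueField R) :=
  isSimpleModule_iff_quot_maximal.mpr
    ⟨IsLocalRing.maximalIdeal R, inferInstance, ⟨LinearEquiv.refl _ _⟩⟩

theorem exists_injective_residueField (N : Type v) [AddCommGroup N] [Module R N] [Nontrivial N]
    [IsArtinian R N] : ∃ f : IsLocalRing.ResidueField R →ₗ[R] N, Function.Injective f := by
  obtain ⟨P, hP, -⟩ := (eq_bot_or_exists_atom_le (⊤ : Submodule R N)).resolve_left top_ne_bot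
  have : IsSimpleModule R P := isSimpleModule_iff_isAtom.mpr hP
  obtain ⟨e⟩ := nonempty_equiv_residueField (R := R) P
  exact ⟨P.subtype ∘ₗ e.symm.toLinearMap, P.injective_subtype.comp e.symm.injective⟩

end FiniteLength

/-! ### Lengths of Ext modules -/

section Length

variable {R : Type u} [CommRing R]

open IsLocalRing

theorem length_ext_of_shortExact {S : ShortComplex (ModuleCat.{u} R)} (hS : S.ShortExact)
    (M : ModuleCat.{u} R) (d : ℕ) (h1 : ∀ i, i < d → Subsingleton (Ext S.X₁ M i))
    (h3 : Subsingleton (Ext S.X₃ M (d + 1))) :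
    Module.length R (Ext S.X₂ M d) =
      Module.length R (Ext S.X₃ M d) + Module.length R (Ext S.X₁ M d) := by
  refine Module.length_eq_add_of_exact
    (Ext.precompOfLinear (Ext.mk₀ S.g) R M (zero_add d))
    (Ext.precompOfLinear (Ext.mk₀ S.f) R M (zero_add d)) ?_ ?_ ?_
  · rw [← LinearMap.ker_eq_bot, LinearMap.ker_eq_bot']
    intro e he
    rcases d with _ | d
    · have : Epi S.g := hS.epi_g
      exact Ext.precomp_mk₀_injective_of_epi M S.g (he.trans (map_zero _).symm)
    · obtain ⟨e', rfl⟩ := Ext.contravariant_sequence_exact₃ hS M e he (add_comm 1 d)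
      rw [Subsingleton.elim (h := h1 d (Nat.lt_succ_self d)) e' 0, Ext.comp_zero]
  · intro e
    exact Ext.contravariant_sequence_exact₁ hS M e (add_comm 1 d) (Subsingleton.elim _ _)
  · intro e
    constructor
    · intro he
      exact Ext.contravariant_sequence_exact₂ hS M e he
    · rintro ⟨e', rfl⟩
      change (Ext.mk₀ S.f).comp ((Ext.mk₀ S.g).comp e' (zero_add d)) (zero_add d) = 0
      rw [Ext.mk₀_comp_mk₀_assoc, S.zero, Ext.mk₀_zero, Ext.zero_comp]

/-- A composition series of `N` has all its factors isomorphic to k. As only Extᵈ(k, M) survives,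
the long exact sequences collapse to short ones and lengths add up. -/
theorem length_ext_of_isFiniteLength [IsLocalRing R] (M : ModuleCat.{u} R) (d : ℕ)
    (hM : ∀ i, i ≠ d → Subsingleton (Ext (ModuleCat.of R (ResidueField R)) M i))
    (hd : Module.length R (Ext (ModuleCat.of R (ResidueField R)) M d) = 1) (N : Type u)
    [AddCommGroup N] [Module R N] (hN : IsFiniteLength R N) :
    (∀ i, i ≠ d → Subsingleton (Ext (ModuleCat.of R N) M i)) ∧
      Module.length R (Ext (ModuleCat.of R N) M d) = Module.length R N := by
  induction hN with
  | @of_subsingleton N =>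
    have : Subsingleton (ModuleCat.of R N) := ‹_›
    exact ⟨fun i _ => subsingleton_ext_of_subsingleton_left _ _, by
      have := subsingleton_ext_of_subsingleton_left (N := ModuleCat.of R N) M d
      rw [Module.length_eq_zero, Module.length_eq_zero]⟩
  | @of_simple_quotient N _ _ P _ hP ih =>
    obtain ⟨e⟩ := nonempty_equiv_residueField (R := R) (N ⧸ P)
    have hex : Function.Exact P.subtype (e.toLinearMap ∘ₗ P.mkQ) :=
      (LinearMap.exact_subtype_mkQ P).comp_injective e e.injective (map_zero e)
    let S : ShortComplex (ModuleCat.{u} R) :=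
      ModuleCat.shortComplexOfCompEqZero P.subtype (e.toLinearMap ∘ₗ P.mkQ)
        hex.linearMap_comp_eq_zero
    have hS : S.ShortExact := ModuleCat.shortComplex_shortExact S hex P.injective_subtype
      (e.surjective.comp P.mkQ_surjective)
    refine ⟨fun i hi => subsingleton_ext_X₂ hS M i (ih.1 i hi) (hM i hi), ?_⟩
    refine (length_ext_of_shortExact hS M d (fun i hi => ih.1 i hi.ne)
      (hM (d + 1) (Nat.succ_ne_self d))).trans ?_
    have h2 := Module.length_eq_add_of_exact P.subtype (e.toLinearMap ∘ₗ P.mkQ)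
      P.injective_subtype (e.surjective.comp P.mkQ_surjective) hex
    rw [Module.length_eq_one R (ResidueField R)] at h2
    rw [h2, add_comm]
    exact congrArg₂ _ ih.2 hd

end Length

/-! ### The ring has finite injective dimension if and only if its canonical module is cyclic -/

section GorensteinCriterion

open RingTheory.Sequence Pointwise IsLocalRing

variable {R : Type u} [CommRing R]

/-- The Rees isomorphism for a class as in `exists_rees_class`. -/
def reesEquiv {N Q X : ModuleCat.{u} R} {l : ℕ} (θ : Ext Q X l)
    (h : Function.Bijective fun f : N ⟶ Q => (Ext.mk₀ f).comp θ (zero_add l)) :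
    (N ⟶ Q) ≃ₗ[R] Ext N X l :=
  LinearEquiv.ofBijective
    { toFun := fun f => (Ext.mk₀ f).comp θ (zero_add l)
      map_add' := fun f g => by rw [Ext.mk₀_add, Ext.add_comp]
      map_smul' := fun r f => by rw [Ext.mk₀_smul, Ext.smul_comp, RingHom.id_apply] } h

/-- `Hom(R/I, N) = N` if `I` annihilates `N`. -/
def homQuotientEquiv (I : Ideal R) (N : Type u) [AddCommGroup N] [Module R N]
    (h : ∀ r ∈ I, ∀ x : N, r • x = 0) :
    (ModuleCat.of R (R ⧸ I) ⟶ ModuleCat.of R N) ≃ₗ[R] N :=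
  LinearEquiv.ofBijective
    { toFun := fun f => f.hom (Submodule.Quotient.mk 1 : R ⧸ I)
      map_add' := fun f g => rfl
      map_smul' := fun r f => rfl } (by
    constructor
    · intro f g hfg
      refine ModuleCat.hom_ext (Submodule.linearMap_qext _ (LinearMap.ext_ring ?_))
      exact hfg
    · intro x
      refine ⟨ModuleCat.ofHom (Submodule.liftQ I (LinearMap.toSpanSingleton R N x) ?_), ?_⟩
      · intro r hr
        exact h r hr x
      · exact one_smul R x)

theorem ofList_smul_quotient (rs : List R) (X : Type u) [AddCommGroup X] [Module R X] (r : R)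
    (hr : r ∈ Ideal.ofList rs) (x : X ⧸ (Ideal.ofList rs • ⊤ : Submodule R X)) : r • x = 0 := by
  obtain ⟨x, rfl⟩ := Submodule.mkQ_surjective _ x
  rw [← map_smul, Submodule.mkQ_apply, Submodule.Quotient.mk_eq_zero]
  exact Submodule.smul_mem_smul hr trivial

theorem mem_ofList_of_mem {rs : List R} {r : R} (hr : r ∈ rs) : r ∈ Ideal.ofList rs :=
  Ideal.subset_span hr

/-- Each regular element raises the projective dimension by at most one, through 0 → X → X → X/rX →
0. -/
theorem hasProjectiveDimensionLT_quotient (rs : List R) (X : ModuleCat.{u} R)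
    (hrs : IsWeaklyRegular X rs) (c : ℕ) [HasProjectiveDimensionLT X c] :
    HasProjectiveDimensionLT (ModuleCat.of R (X ⧸ (Ideal.ofList rs • ⊤ : Submodule R X)))
      (c + rs.length) := by
  induction rs generalizing X c with
  | nil =>
    let e : (X ⧸ (Ideal.ofList ([] : List R) • ⊤ : Submodule R X)) ≃ₗ[R] X :=
      Submodule.quotEquivOfEqBot _ (by rw [Ideal.ofList_nil, Submodule.bot_smul])
    exact hasProjectiveDimensionLT_of_iso e.toModuleIso.symm c
  | cons r rs ih =>
    rw [isWeaklyRegular_cons_iff] at hrs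
    have h1 : HasProjectiveDimensionLT (ModuleCat.of R (QuotSMulTop r X)) (c + 1) :=
      hrs.1.smulShortComplex_shortExact.hasProjectiveDimensionLT_X₃ c ‹_›
        (hasProjectiveDimensionLT_of_ge X c (c + 1) (Nat.le_succ c))
    have h2 := ih (ModuleCat.of R (QuotSMulTop r X)) hrs.2 (c + 1)
    rw [List.length_cons, add_comm rs.length 1, ← add_assoc]
    exact hasProjectiveDimensionLT_of_iso
      (Submodule.quotOfListConsSMulTopEquivQuotSMulTopInner X r rs).toModuleIso.symm _

variable [IsLocalRing R]

theorem support_residueField :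
    Module.support R (ResidueField R) = PrimeSpectrum.zeroLocus (maximalIdeal R) := by
  have : Module.annihilator R (ResidueField R) = maximalIdeal R :=
    Ideal.annihilator_quotient
  rw [Module.support_eq_zeroLocus, this]

/-- The residue field is annihilated by the maximal ideal. -/
theorem smul_residueField_eq_zero {r : R} (hr : r ∈ maximalIdeal R) (x : ResidueField R) :
    r • x = 0 := by
  rw [Algebra.smul_def, ResidueField.algebraMap_eq, (residue_eq_zero_iff r).mpr hr, zero_mul]

theorem subsingleton_ext_residueField_of_isWeaklyRegular (M : ModuleCat.{u} R) (rs : List R)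
    (hmem : ∀ r ∈ rs, r ∈ maximalIdeal R) (hrs : IsWeaklyRegular M rs) (i : ℕ) (hi : i < rs.length) :
    Subsingleton (Ext (ModuleCat.of R (ResidueField R)) M i) := by
  obtain ⟨θ, hθ⟩ := exists_rees_class rs M hrs
  exact (hθ (ModuleCat.of R (ResidueField R)) fun r hr x =>
    smul_residueField_eq_zero (hmem r hr) x).1 i hi

variable [IsNoetherianRing R]

theorem exists_isRegular_of_subsingleton_ext (M : ModuleCat.{u} R) [Module.Finite R M]
    [Nontrivial M] (d : ℕ) (h : ∀ i < d, Subsingleton (Ext (ModuleCat.of R (ResidueField R)) M i)) :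
    ∃ rs : List R, rs.length = d ∧ (∀ r ∈ rs, r ∈ maximalIdeal R) ∧ IsRegular M rs := by
  refine ModuleCat.exists_isRegular_of_exists_subsingleton_ext (maximalIdeal R) d M ?_
    (ModuleCat.of R (ResidueField R)) support_residueField h
  exact lt_of_le_of_ne le_top (Ne.symm
    (Submodule.top_ne_ideal_smul_of_le_jacobson_annihilator
      (IsLocalRing.maximalIdeal_le_jacobson _)))

/-- A common regular sequence for `R` and `M`. -/
theorem exists_common_isWeaklyRegular (M : ModuleCat.{u} R) [Module.Finite R M] (d : ℕ)
    (hM : ∀ i < d, Subsingleton (Ext (ModuleCat.of R (ResidueField R)) M i))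
    (hR : ∀ i < d, Subsingleton (Ext (ModuleCat.of R (ResidueField R)) (ModuleCat.of R R) i)) :
    ∃ rs : List R, rs.length = d ∧ (∀ r ∈ rs, r ∈ maximalIdeal R) ∧ IsWeaklyRegular R rs ∧
      IsWeaklyRegular M rs := by
  -- Apply the Ext criterion for regular sequences to R × M: its Ext groups vanish below d because
  -- those of both factors do.
  let S : ShortComplex (ModuleCat.{u} R) :=
    ModuleCat.shortComplexOfCompEqZero (LinearMap.inl R R M) (LinearMap.snd R R M)
      (LinearMap.snd_comp_inl ..)
  have hS : S.ShortExact := ModuleCat.shortComplex_shortExact S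
    Function.Exact.inl_snd LinearMap.inl_injective LinearMap.snd_surjective
  have h1 : ∀ i < d, Subsingleton (Ext (ModuleCat.of R (ResidueField R)) S.X₂ i) := by
    intro i hi
    refine subsingleton_of_forall_eq 0 fun e => ?_
    obtain ⟨e', rfl⟩ := Ext.covariant_sequence_exact₂ _ hS e
      (Subsingleton.elim (h := hM i hi) _ _)
    rw [Subsingleton.elim (h := hR i hi) e' 0, Ext.zero_comp]
  have : Nontrivial (ModuleCat.of R (R × M)) := inferInstanceAs (Nontrivial (R × M))
  obtain ⟨rs, h2, h3, h4⟩ := exists_isRegular_of_subsingleton_ext (ModuleCat.of R (R × M)) d h1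
  exact ⟨rs, h2, h3,
    isWeaklyRegular_of_retract rs (LinearMap.inl R R M) (LinearMap.fst R R M)
      (LinearMap.fst_comp_inl ..) h4.1,
    isWeaklyRegular_of_retract rs (LinearMap.inr R R M) (LinearMap.snd R R M)
      (LinearMap.snd_comp_inr ..) h4.1⟩

/-- Each regular element lowers the dimension by one, so R modulo a regular sequence of length dim R
has dimension zero. -/
theorem isArtinian_quotient_ofList (rs : List R) (hmem : ∀ r ∈ rs, r ∈ maximalIdeal R)
    (hrs : IsWeaklyRegular R rs) (hdim : ringKrullDim R = rs.length) (X : Type u) [AddCommGroup X]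
    [Module R X] [Module.Finite R X] :
    IsArtinian R (X ⧸ (Ideal.ofList rs • ⊤ : Submodule R X)) := by
  have h1 := ringKrullDim_add_length_eq_ringKrullDim_of_isRegular rs
    (IsRegular.of_isWeaklyRegular_of_mem_maximalIdeal R hmem hrs)
  have h2 : ringKrullDim (R ⧸ Ideal.ofList rs) ≤ 0 := by
    rw [hdim] at h1
    induction hd : ringKrullDim (R ⧸ Ideal.ofList rs) with
    | bot => exact bot_le
    | coe d =>
      rw [hd] at h1
      have h4 : d + (rs.length : ℕ∞) = 0 + (rs.length : ℕ∞) := by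
        rw [zero_add]
        exact WithBot.coe_injective h1
      rw [WithTop.add_right_cancel (ENat.natCast_ne_top _) h4]
      exact le_rfl
  have h3 : IsArtinianRing (R ⧸ Ideal.ofList rs) := by
    rw [isArtinianRing_iff_krullDimLE_zero, Ring.KrullDimLE, Order.krullDimLE_iff]
    exact h2
  have h4 : Module.Finite (R ⧸ Ideal.ofList rs) (X ⧸ (Ideal.ofList rs • ⊤ : Submodule R X)) :=
    Module.Finite.of_restrictScalars_finite R _ _
  exact isArtinian_of_surjective_algebraMap (R := R ⧸ Ideal.ofList rs) (S := R)
    (M := X ⧸ (Ideal.ofList rs • ⊤ : Submodule R X)) Ideal.Quotient.mk_surjective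

/-- The bound descends one step at a time. The residue field embeds into the Artinian module R/(rs),
whose projective dimension is at most the length of rs. So Extⁱ(k, R) is caught between Extⁱ(R/(rs),
R) and the Ext^{i+1} of a cokernel, and both vanish. -/
theorem hasInjectiveDimensionLE_length (rs : List R) (hmem : ∀ r ∈ rs, r ∈ maximalIdeal R)
    (hrs : IsWeaklyRegular R rs) (hdim : ringKrullDim R = rs.length) (t : ℕ)
    (ht : HasInjectiveDimensionLE (ModuleCat.of R R) (rs.length + t)) :
    HasInjectiveDimensionLE (ModuleCat.of R R) rs.length := by
  induction t with
  | zero => exact ht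
  | succ t ih =>
    refine ih (hasInjectiveDimensionLE_of_subsingleton_ext_residueField _ fun i hi => ?_)
    have hart := isArtinian_quotient_ofList rs hmem hrs hdim R
    have hreg := IsRegular.of_isWeaklyRegular_of_mem_maximalIdeal R hmem hrs
    have hnt : Nontrivial (R ⧸ (Ideal.ofList rs • ⊤ : Submodule R R)) :=
      Submodule.Quotient.nontrivial_iff.mpr hreg.2.symm
    obtain ⟨f, hf⟩ := exists_injective_residueField (R := R)
      (R ⧸ (Ideal.ofList rs • ⊤ : Submodule R R))
    let S : ShortComplex (ModuleCat.{u} R) :=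
      ModuleCat.shortComplexOfCompEqZero f (LinearMap.range f).mkQ
        f.exact_map_mkQ_range.linearMap_comp_eq_zero
    have hS : S.ShortExact := ModuleCat.shortComplex_shortExact S f.exact_map_mkQ_range hf
      (Submodule.mkQ_surjective _)
    have hpd := hasProjectiveDimensionLT_quotient rs (ModuleCat.of R R) hrs 1
    have h2 : Subsingleton (Ext S.X₂ (ModuleCat.of R R) i) :=
      HasProjectiveDimensionLT.subsingleton S.X₂ (1 + rs.length) i (by omega) _
    have h3 : Subsingleton (Ext S.X₃ (ModuleCat.of R R) (i + 1)) :=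
      HasInjectiveDimensionLT.subsingleton (ModuleCat.of R R) (rs.length + (t + 1) + 1) (i + 1)
        (by omega) S.X₃
    refine subsingleton_of_forall_eq 0 fun e => ?_
    obtain ⟨e', rfl⟩ := Ext.contravariant_sequence_exact₁ hS _ e (add_comm 1 i)
      (Subsingleton.elim _ _)
    rw [Subsingleton.elim e' 0, Ext.comp_zero]

/-- Over a local ring with a maximal Cohen–Macaulay module `M` of type one and of finite injective
dimension, the ring itself has finite injective dimension if and only if `M` is cyclic. -/
theorem hasInjectiveDimensionLE_iff_exists_span_eq_top (M : Type u) [AddCommGroup M] [Module R M]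
    [Module.Finite R M] (d : ℕ) (hdim : ringKrullDim R = d)
    (hR : ∀ i < d, Subsingleton (Ext (ModuleCat.of R (ResidueField R)) (ModuleCat.of R R) i))
    (hM : ∀ i, i ≠ d → Subsingleton (Ext (ModuleCat.of R (ResidueField R)) (ModuleCat.of R M) i))
    (hd : Nonempty (Ext (ModuleCat.of R (ResidueField R)) (ModuleCat.of R M) d ≃ₗ[R]
      ResidueField R)) :
    (∃ e, HasInjectiveDimensionLE (ModuleCat.of R R) e) ↔
      ∃ m : M, Submodule.span R {m} = ⊤ := by
  obtain ⟨ys, hlen, hmem, hyR, hyM⟩ := exists_common_isWeaklyRegular (ModuleCat.of R M) d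
    (fun i hi => hM i hi.ne) hR
  subst hlen
  obtain ⟨ε⟩ := hd
  have hl1 : Module.length R (Ext (ModuleCat.of R (ResidueField R)) (ModuleCat.of R M) ys.length)
      = 1 := by rw [ε.length_eq, Module.length_eq_one]
  have hartR := isArtinian_quotient_ofList ys hmem hyR hdim R
  have hartM := isArtinian_quotient_ofList ys hmem hyR hdim M
  have hflR : IsFiniteLength R (R ⧸ (Ideal.ofList ys • ⊤ : Submodule R R)) :=
    isFiniteLength_iff_isNoetherian_isArtinian.mpr ⟨inferInstance, hartR⟩
  have hflM : IsFiniteLength R (M ⧸ (Ideal.ofList ys • ⊤ : Submodule R M)) :=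
    isFiniteLength_iff_isNoetherian_isArtinian.mpr ⟨inferInstance, hartM⟩
  have hkill : ∀ (X : Type u) [AddCommGroup X] [Module R X], ∀ r ∈ ys,
      ∀ x : X ⧸ (Ideal.ofList ys • ⊤ : Submodule R X), r • x = 0 := fun X _ _ r hr x =>
    ofList_smul_quotient ys X r (mem_ofList_of_mem hr) x
  have hkillk : ∀ r ∈ ys, ∀ x : ResidueField R, r • x = 0 := fun r hr x =>
    smul_residueField_eq_zero (hmem r hr) x
  obtain ⟨θM, hθM⟩ := exists_rees_class ys (ModuleCat.of R M) hyM
  -- Hom(R/(ys), M/(ys)M) is M/(ys)M itself. By the Rees isomorphism it is also Extᵈ(R/(ys), M),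
  -- which has the length of R/(ys).
  have hlen : Module.length R (R ⧸ (Ideal.ofList ys • ⊤ : Submodule R R)) =
      Module.length R (M ⧸ (Ideal.ofList ys • ⊤ : Submodule R M)) := by
    rw [← (length_ext_of_isFiniteLength (ModuleCat.of R M) ys.length hM hl1 _ hflR).2]
    refine ((reesEquiv θM (hθM (ModuleCat.of R (R ⧸ (Ideal.ofList ys • ⊤ : Submodule R R)))
      (hkill R)).2).symm.trans (homQuotientEquiv _ _ fun r hr x => ?_)).length_eq
    exact ofList_smul_quotient ys M r (by simpa using hr) x
  have hnt : Nontrivial (M ⧸ (Ideal.ofList ys • ⊤ : Submodule R M)) := by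
    rw [← Module.length_pos_iff (R := R), ← hlen, Module.length_pos_iff]
    exact Submodule.Quotient.nontrivial_iff.mpr
      (IsRegular.of_isWeaklyRegular_of_mem_maximalIdeal R hmem hyR).2.symm
  constructor
  · rintro ⟨e, he⟩
    obtain ⟨θR, hθR⟩ := exists_rees_class ys (ModuleCat.of R R) hyR
    have hinj := hasInjectiveDimensionLE_length ys hmem hyR hdim e
      (hasInjectiveDimensionLT_of_ge _ (e + 1) _ (by omega))
    have hntR : Nontrivial (R ⧸ (Ideal.ofList ys • ⊤ : Submodule R R)) := by
      rw [← Module.length_pos_iff (R := R), hlen, Module.length_pos_iff]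
      exact hnt
    obtain ⟨s, hs⟩ := exists_injective_residueField (R := R)
      (R ⧸ (Ideal.ofList ys • ⊤ : Submodule R R))
    obtain ⟨φ, hφ⟩ := exists_injective_residueField (R := R)
      (M ⧸ (Ideal.ofList ys • ⊤ : Submodule R M))
    -- Extend the socle map s along φ. The obstruction lies in an Ext^{d+1}(·, R), which vanishes by
    -- the bound on the injective dimension, and the Rees isomorphism turns the extended class into
    -- a homomorphism.
    obtain ⟨ψ, hψ⟩ : ∃ ψ : (M ⧸ (Ideal.ofList ys • ⊤ : Submodule R M)) →ₗ[R]
        (R ⧸ (Ideal.ofList ys • ⊤ : Submodule R R)), ψ ∘ₗ φ = s := by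
      let S : ShortComplex (ModuleCat.{u} R) :=
        ModuleCat.shortComplexOfCompEqZero φ (LinearMap.range φ).mkQ
          φ.exact_map_mkQ_range.linearMap_comp_eq_zero
      have hS : S.ShortExact := ModuleCat.shortComplex_shortExact S φ.exact_map_mkQ_range hφ
        (Submodule.mkQ_surjective _)
      have h3 : Subsingleton (Ext S.X₃ (ModuleCat.of R R) (ys.length + 1)) :=
        HasInjectiveDimensionLT.subsingleton (ModuleCat.of R R) (ys.length + 1) _ le_rfl S.X₃
      obtain ⟨e, he⟩ := Ext.contravariant_sequence_exact₁ hS (ModuleCat.of R R)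
        ((Ext.mk₀ (ModuleCat.ofHom s)).comp θR (zero_add _)) (add_comm 1 _) (Subsingleton.elim _ _)
      obtain ⟨ψ, rfl⟩ := (hθR S.X₂ (hkill M)).2.2 e
      refine ⟨ψ.hom, ?_⟩
      have h4 : S.f ≫ ψ = ModuleCat.ofHom s := by
        apply (hθR S.X₁ hkillk).2.1
        refine Eq.trans ?_ he
        exact (Ext.mk₀_comp_mk₀_assoc _ _ _).symm
      exact congrArg ModuleCat.Hom.hom h4
    -- A non-zero kernel would contain a copy of k. Since Hom(k, M/(ys)M) ≅ Extᵈ(k, M) is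
    -- one-dimensional, that copy is a multiple of φ; but s = ψ ∘ φ is injective, so the multiple is
    -- zero.
    have hinjψ : Function.Injective ψ := by
      by_contra hcon
      have hnt' : Nontrivial (LinearMap.ker ψ) := by
        rw [Submodule.nontrivial_iff_ne_bot]
        exact fun h => hcon (LinearMap.ker_eq_bot.mp h)
      obtain ⟨u, hu⟩ := exists_injective_residueField (R := R) (LinearMap.ker ψ)
      let E := (reesEquiv θM (hθM (ModuleCat.of R (ResidueField R)) hkillk).2).trans ε
      have hφ0 : E (ModuleCat.ofHom φ) ≠ 0 := by
        intro h0
        rw [LinearEquiv.map_eq_zero_iff] at h0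
        have h1 : φ 1 = 0 := congrArg (fun f => f.hom (1 : ResidueField R)) h0
        exact one_ne_zero (hφ (h1.trans (map_zero φ).symm))
      obtain ⟨a, ha⟩ := residue_surjective
        (E (ModuleCat.ofHom ((LinearMap.ker ψ).subtype ∘ₗ u)) / E (ModuleCat.ofHom φ))
      have h1 : ModuleCat.ofHom ((LinearMap.ker ψ).subtype ∘ₗ u) = a • ModuleCat.ofHom φ := by
        apply E.injective
        refine Eq.trans ?_ (map_smul E a _).symm
        exact ((Algebra.smul_def a (E (ModuleCat.ofHom φ))).trans
          ((congrArg (· * E (ModuleCat.ofHom φ)) ha).trans (div_mul_cancel₀ _ hφ0))).symm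
      have h2 : (u 1 : M ⧸ (Ideal.ofList ys • ⊤ : Submodule R M)) = a • φ 1 :=
        congrArg (fun f => f.hom (1 : ResidueField R)) h1
      have h3 : s (a • 1) = 0 := by
        rw [← hψ, LinearMap.comp_apply, map_smul, ← h2]
        exact (u 1).2
      have h4 : a • (1 : ResidueField R) = 0 := hs (h3.trans (map_zero s).symm)
      rw [← map_smul, h4, map_zero] at h2
      exact one_ne_zero (hu ((Subtype.ext h2).trans (map_zero u).symm))
    -- Equal lengths make ψ bijective, so M/(ys)M is cyclic; Nakayama's lemma lifts the generator.
    obtain ⟨m', hm'⟩ := surjective_of_injective_of_length ψ hinjψ hlen.symm hflM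
      (Submodule.Quotient.mk 1)
    obtain ⟨m, rfl⟩ := Submodule.mkQ_surjective _ m'
    refine ⟨m, top_le_iff.mp (Submodule.le_of_le_smul_of_le_jacobson_bot (I := Ideal.ofList ys)
      Module.Finite.fg_top ?_ ?_)⟩
    · exact (Ideal.span_le.mpr hmem).trans (maximalIdeal_le_jacobson _)
    · intro x _
      obtain ⟨r, hr⟩ := Submodule.mkQ_surjective _ (ψ (Submodule.Quotient.mk x))
      have h1 : ψ (Submodule.Quotient.mk x) = ψ (Submodule.Quotient.mk (r • m)) := by
        rw [Submodule.Quotient.mk_smul, map_smul]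
        rw [Submodule.mkQ_apply] at hm'
        rw [hm', ← hr, ← Submodule.Quotient.mk_smul]
        exact congrArg Submodule.Quotient.mk (mul_one r).symm
      have h2 := (Submodule.Quotient.eq _).mp (hinjψ h1)
      have h3 : x = r • m + (x - r • m) := by abel
      rw [h3]
      exact Submodule.add_mem_sup (Submodule.smul_mem _ _ (Submodule.mem_span_singleton_self m)) h2
  · rintro ⟨m, hm⟩
    have hsurj : Function.Surjective (LinearMap.toSpanSingleton R M m) := by
      rw [← LinearMap.range_eq_top, ← LinearMap.span_singleton_eq_range, hm]
    have hbij : Function.Bijective (LinearMap.toSpanSingleton R M m) := by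
      -- The surjection R/(ys) → M/(ys)M between modules of equal finite length is injective, and
      -- injectivity lifts along the M-regular sequence. So R ≅ M inherits the finite injective
      -- dimension of M.
      refine ⟨injective_of_isWeaklyRegular ys hmem _ hsurj hyM fun x hx => ?_, hsurj⟩
      have hle : (Ideal.ofList ys • ⊤ : Submodule R R) ≤
          (Ideal.ofList ys • ⊤ : Submodule R M).comap (LinearMap.toSpanSingleton R M m) := by
        rw [← Submodule.map_le_iff_le_comap, Submodule.map_smul'']
        exact Submodule.smul_mono le_rfl le_top
      have h1 : Function.Injective (Submodule.mapQ _ _ (LinearMap.toSpanSingleton R M m) hle) := by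
        refine injective_of_surjective_of_length _ ?_ hlen hflR
        intro x
        obtain ⟨x, rfl⟩ := Submodule.mkQ_surjective _ x
        obtain ⟨r, rfl⟩ := hsurj x
        exact ⟨Submodule.Quotient.mk r, rfl⟩
      rw [← Submodule.Quotient.mk_eq_zero]
      apply h1
      rw [map_zero]
      exact (Submodule.Quotient.mk_eq_zero _).mpr hx
    have h2 := hasInjectiveDimensionLE_of_subsingleton_ext_residueField (ModuleCat.of R M)
      (d := ys.length) fun i hi => hM i hi.ne'
    exact ⟨ys.length, hasInjectiveDimensionLT_of_iso
      (LinearEquiv.ofBijective _ hbij).toModuleIso.symm _⟩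

end GorensteinCriterion

end HomologicalAlgebra

/-! ### Existence and uniqueness of residues -/

/-- A radical ideal is the intersection of its finitely many minimal primes: take y in all the
others but not in P. -/
theorem exists_mul_mem_of_mem_minimalPrimes_of_isRadical {R : Type*} [CommRing R]
    [IsNoetherianRing R] {I P : Ideal R} (hI : I.IsRadical) (hP : P ∈ I.minimalPrimes) {x : R}
    (hx : x ∈ P) : ∃ y, y ∉ P ∧ y * x ∈ I := by
  classical
  have hfin := I.finite_minimalPrimes_of_isNoetherianRing
  let T : Finset (Ideal R) := hfin.toFinset.erase P
  have hprime : P.IsPrime := hP.1.1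
  have h1 : ¬ T.inf id ≤ P := by
    intro hle
    obtain ⟨Q, hQ, hQP⟩ := (Ideal.IsPrime.inf_le' hprime).mp hle
    have hQ' : Q ≠ P ∧ Q ∈ I.minimalPrimes := by simpa [T] using hQ
    exact hQ'.1 (le_antisymm hQP (hP.2 hQ'.2.1 hQP))
  obtain ⟨y, hy, hyP⟩ := SetLike.not_le_iff_exists.mp h1
  refine ⟨y, hyP, ?_⟩
  rw [← hI.radical, ← Ideal.sInf_minimalPrimes, Submodule.mem_sInf]
  intro Q hQ
  rcases eq_or_ne Q P with rfl | hne
  · exact Ideal.mul_mem_left _ _ hx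
  · have hQT : Q ∈ T := by simp [T, hne, hQ]
    exact Ideal.mul_mem_right _ _ ((Finset.inf_le hQT : T.inf id ≤ Q) hy)

section Residue

variable {n : ℕ} {h : OS n}

theorem algebraMap_OD_eq_zero_iff (a : OS n) :
    algebraMap (OS n) (OD h) a = 0 ↔ a ∈ Ideal.span {h} := Ideal.Quotient.eq_zero_iff_mem

theorem algebraMap_OD_mem_nonZeroDivisors_iff (g : OS n) : algebraMap (OS n) (OD h) g ∈ (OD h)⁰ ↔
    ∀ x, x * g ∈ Ideal.span {h} → x ∈ Ideal.span {h} := by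
  rw [mem_nonZeroDivisors_iff_right]
  constructor
  · intro hg x hx
    rw [← algebraMap_OD_eq_zero_iff] at hx ⊢
    rw [map_mul] at hx
    exact hg _ hx
  · intro hg x hx
    obtain ⟨x, rfl⟩ := Ideal.Quotient.mk_surjective x
    change algebraMap (OS n) (OD h) x * _ = 0 at hx
    rw [← map_mul, algebraMap_OD_eq_zero_iff] at hx
    exact (algebraMap_OD_eq_zero_iff _).mpr (hg x hx)

variable (h) in
/-- The Jacobian ideal of a reduced divisor contains a non-zero-divisor. -/
theorem exists_partial_combination (h_ne : h ≠ 0) (h_red : IsReduced (OD h)) :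
    ∃ c : Fin n → OS n, algebraMap (OS n) (OD h) (∑ i, c i * partialS i h) ∈ (OD h)⁰ := by
  classical
  have hrad : (Ideal.span {h}).IsRadical := Ideal.isRadical_iff_quotient_reduced _ |>.mpr h_red
  have hfin := (Ideal.span {h}).finite_minimalPrimes_of_isNoetherianRing
  let J : Ideal (OS n) := Ideal.span (Set.range fun i : Fin n => partialS i h)
  have h1 : ∀ P ∈ (Ideal.span {h}).minimalPrimes, ¬ J ≤ P := by
    intro P hP hJ
    have hprime : P.IsPrime := hP.1.1
    -- For f ∈ P choose s ∉ P with s f = b h. Differentiating, s ∂f is a combination of ∂h, h and f,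
    -- all in P; hence ∂f ∈ P.
    have hbot : P = ⊥ := by
      refine eq_zero_of_partialS_stable hprime.ne_top fun f hf i => ?_
      obtain ⟨s, hs, hsf⟩ := exists_mul_mem_of_mem_minimalPrimes_of_isRadical hrad hP hf
      obtain ⟨b, hb⟩ := Ideal.mem_span_singleton'.mp hsf
      have h2 := congrArg (partialS i) hb
      simp only [Derivation.leibniz, smul_eq_mul] at h2
      have h3 : s * partialS i f ∈ P := by
        have h4 : s * partialS i f = b * partialS i h + h * partialS i b - f * partialS i s := by
          rw [h2]; ring
        rw [h4]
        refine sub_mem (add_mem (P.mul_mem_left _ (hJ (Ideal.subset_span ⟨i, rfl⟩))) ?_)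
          (P.mul_mem_right _ hf)
        exact P.mul_mem_right _ (hP.1.2 (Ideal.mem_span_singleton_self h))
      exact (hprime.mem_or_mem h3).resolve_left hs
    have h5 : h ∈ P := hP.1.2 (Ideal.mem_span_singleton_self h)
    rw [hbot] at h5
    exact h_ne h5
  -- Prime avoidance yields one combination of the partials outside every minimal prime at once.
  have h2 : ¬ (J : Set (OS n)) ⊆ ⋃ P ∈ (↑hfin.toFinset : Set (Ideal (OS n))), (P : Set (OS n)) := by
    intro hsub
    obtain ⟨P, hP, hJP⟩ := (Ideal.subset_union_prime (f := id) ⊥ ⊥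
      (fun P hP _ _ => ((Set.Finite.mem_toFinset hfin).mp hP).1.1)).mp hsub
    exact h1 P ((Set.Finite.mem_toFinset hfin).mp hP) hJP
  obtain ⟨g, hgJ, hg⟩ := Set.not_subset.mp h2
  obtain ⟨c, rfl⟩ := (Submodule.mem_span_range_iff_exists_fun _).mp hgJ
  refine ⟨c, (algebraMap_OD_mem_nonZeroDivisors_iff _).mpr fun x hx => ?_⟩
  rw [← hrad.radical, ← Ideal.sInf_minimalPrimes, Submodule.mem_sInf]
  intro P hP
  have hprime : Ideal.IsPrime P := hP.1.1
  refine (hprime.mem_or_mem (hP.1.2 hx)).resolve_right fun hgP => hg ?_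
  simp only [Set.mem_iUnion]
  exact ⟨P, by simpa using hP, hgP⟩

/-- A multiple of `dh/h` with holomorphic coefficients is holomorphic only if its coefficient is
divisible by `h`. -/
theorem mem_span_of_mul_partialS_mem {c : Fin n → OS n}
    (hc : algebraMap (OS n) (OD h) (∑ i, c i * partialS i h) ∈ (OD h)⁰) {x : OS n}
    (hx : ∀ i, x * partialS i h ∈ Ideal.span {h}) : x ∈ Ideal.span {h} := by
  refine (algebraMap_OD_mem_nonZeroDivisors_iff _).mp hc x ?_
  rw [Finset.mul_sum]
  refine Ideal.sum_mem _ fun i _ => ?_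
  rw [mul_left_comm]
  exact Ideal.mul_mem_left _ _ (hx i)

theorem algebraMap_MS_injective : Function.Injective (algebraMap (OS n) (MS n)) :=
  IsFractionRing.injective _ _

theorem algebraMap_MS_ne_zero {a : OS n} (ha : a ≠ 0) : algebraMap (OS n) (MS n) a ≠ 0 := by
  simpa using ha

theorem algebraMap_mul_partialM_div (h_ne : h ≠ 0) (i : Fin n) (a : OS n) :
    algebraMap (OS n) (MS n) h * (algebraMap (OS n) (MS n) h *
      partialM i (algebraMap (OS n) (MS n) a / algebraMap (OS n) (MS n) h)) =
      algebraMap (OS n) (MS n) (partialS i a * h - a * partialS i h) := by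
  have h0 := algebraMap_MS_ne_zero h_ne
  rw [partialM, fracDer_div _ _ _ h_ne, map_sub, map_mul, map_mul]
  field_simp

/-- The wedge product of `dh` with a logarithmic form is holomorphic. -/
theorem mem_logForms1_iff (h_ne : h ≠ 0) {ω : OmegaM n} {a : Fin n → OS n}
    (ha : ∀ i, algebraMap (OS n) (MS n) h * ω i = algebraMap (OS n) (MS n) (a i)) :
    ω ∈ logForms1 h ↔ ∀ i j, partialS i h * a j - partialS j h * a i ∈ Ideal.span {h} := by
  have h0 := algebraMap_MS_ne_zero h_ne
  have hω : ∀ i, ω i = algebraMap (OS n) (MS n) (a i) / algebraMap (OS n) (MS n) h := fun i => by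
    rw [eq_div_iff h0, mul_comm, ha]
  have key : ∀ i j, algebraMap (OS n) (MS n) h * (algebraMap (OS n) (MS n) h * dM ω i j) =
      algebraMap (OS n) (MS n) ((partialS i (a j) - partialS j (a i)) * h -
        (partialS i h * a j - partialS j h * a i)) := by
    intro i j
    rw [dM, hω i, hω j, mul_sub, mul_sub, algebraMap_mul_partialM_div h_ne,
      algebraMap_mul_partialM_div h_ne, ← map_sub]
    congr 1
    ring
  constructor
  · rintro ⟨-, h2⟩ i j
    obtain ⟨b, hb⟩ := h2 i j
    have h3 := key i j
    rw [hb, ← map_mul] at h3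
    have h4 := algebraMap_MS_injective h3
    have h5 : partialS i h * a j - partialS j h * a i =
        (partialS i (a j) - partialS j (a i) - b) * h := by linear_combination h4
    rw [h5]
    exact Ideal.mul_mem_left _ _ (Ideal.mem_span_singleton_self h)
  · intro h1
    refine ⟨fun i => ⟨a i, ha i⟩, fun i j => ?_⟩
    obtain ⟨e, he⟩ := Ideal.mem_span_singleton'.mp (h1 i j)
    refine ⟨partialS i (a j) - partialS j (a i) - e, ?_⟩
    apply mul_left_cancel₀ h0
    rw [key, ← map_mul, ← he]
    congr 1
    ring

theorem exists_numerators {ω : OmegaM n} (hω : ω ∈ logForms1 h) : ∃ a : Fin n → OS n,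
    ∀ i, algebraMap (OS n) (MS n) h * ω i = algebraMap (OS n) (MS n) (a i) :=
  ⟨fun i => (hω.1 i).choose, fun i => (hω.1 i).choose_spec⟩

/-- An equation `g ω = ξ dh/h + η` in terms of numerators. -/
theorem smul_eq_smul_dlog_add_iff (h_ne : h ≠ 0) {ω : OmegaM n} {a : Fin n → OS n}
    (ha : ∀ i, algebraMap (OS n) (MS n) h * ω i = algebraMap (OS n) (MS n) (a i)) (g ξ : OS n)
    (η : OmegaS n) : g • ω = ξ • dlog h + toMero η ↔
      ∀ i, g * a i = ξ * partialS i h + h * η i := by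
  have h0 := algebraMap_MS_ne_zero h_ne
  have key : ∀ i, (g • ω) i = (ξ • dlog h + toMero η) i ↔
      g * a i = ξ * partialS i h + h * η i := by
    intro i
    have h1 : algebraMap (OS n) (MS n) h * (g • ω) i = algebraMap (OS n) (MS n) (g * a i) := by
      rw [Pi.smul_apply, Algebra.smul_def, mul_left_comm, ha, map_mul]
    have h2 : algebraMap (OS n) (MS n) h * (ξ • dlog h + toMero η) i =
        algebraMap (OS n) (MS n) (ξ * partialS i h + h * η i) := by
      rw [Pi.add_apply, Pi.smul_apply, Algebra.smul_def, mul_add, mul_left_comm, mul_dlog, map_add,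
        map_mul, map_mul]
      rfl
    rw [← algebraMap_MS_injective.eq_iff, ← h1, ← h2]
    exact (mul_right_injective₀ h0).eq_iff.symm
  rw [funext_iff]
  exact forall_congr' key

theorem algebraMap_OD_MD (x : OS n) : algebraMap (OS n) (MD h) x =
    algebraMap (OD h) (MD h) (algebraMap (OS n) (OD h) x) :=
  IsScalarTower.algebraMap_apply _ _ _ _

theorem isUnit_algebraMap_MD {g : OS n} (hg : algebraMap (OS n) (OD h) g ∈ (OD h)⁰) :
    IsUnit (algebraMap (OS n) (MD h) g) := by
  rw [algebraMap_OD_MD]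
  exact IsLocalization.map_units (MD h) (⟨_, hg⟩ : (OD h)⁰)

theorem algebraMap_MD_eq_zero_iff (x : OS n) :
    algebraMap (OS n) (MD h) x = 0 ↔ x ∈ Ideal.span {h} := by
  rw [algebraMap_OD_MD, ← algebraMap_OD_eq_zero_iff (h := h)]
  exact map_eq_zero_iff _ (IsFractionRing.injective (OD h) (MD h))

section

variable {c : Fin n → OS n}

/-- Contracting dh ∧ hω ∈ h Ω² with the vector field ∑ cᵢ ∂/∂xᵢ yields the required decomposition.
The denominator ∑ cᵢ ∂h/∂xᵢ serves for every form. -/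
theorem exists_isResidue (h_ne : h ≠ 0)
    (hc : algebraMap (OS n) (OD h) (∑ i, c i * partialS i h) ∈ (OD h)⁰) {ω : OmegaM n}
    (hω : ω ∈ logForms1 h) : ∃ m, IsResidue h ω m := by
  obtain ⟨a, ha⟩ := exists_numerators hω
  have h1 := (mem_logForms1_iff h_ne ha).mp hω
  choose e he using fun i j => Ideal.mem_span_singleton'.mp (h1 i j)
  obtain ⟨u, hu⟩ := isUnit_algebraMap_MD hc
  refine ⟨((u⁻¹ : (MD h)ˣ) : MD h) * algebraMap (OS n) (MD h) (∑ i, c i * a i), ∑ i, c i * a i,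
    fun j => ∑ i, c i * e i j, _, hc, ?_, ?_⟩
  · rw [smul_eq_smul_dlog_add_iff h_ne ha]
    intro j
    rw [Finset.sum_mul, Finset.sum_mul, Finset.mul_sum, ← Finset.sum_add_distrib]
    refine Finset.sum_congr rfl fun i _ => ?_
    linear_combination (-c i) * he i j
  · rw [← hu, ← mul_assoc, Units.mul_inv, one_mul]

theorem IsResidue.add {ω ω' : OmegaM n} {m m' : MD h} (hm : IsResidue h ω m)
    (hm' : IsResidue h ω' m') : IsResidue h (ω + ω') (m + m') := by
  obtain ⟨ξ, η, g, hg, h1, h2⟩ := hm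
  obtain ⟨ξ', η', g', hg', h1', h2'⟩ := hm'
  refine ⟨g' * ξ + g * ξ', g' • η + g • η', g * g', by rw [map_mul]; exact mul_mem hg hg', ?_, ?_⟩
  · have e1 : (g * g') • (ω + ω') = g' • (g • ω) + g • (g' • ω') := by module
    rw [e1, h1, h1', map_add, map_smul, map_smul]
    module
  · rw [map_add, map_mul, map_mul, map_mul]
    linear_combination (algebraMap (OS n) (MD h) g') * h2 + (algebraMap (OS n) (MD h) g) * h2'

theorem IsResidue.smul {ω : OmegaM n} {m : MD h} (b : OS n) (hm : IsResidue h ω m) :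
    IsResidue h (b • ω) (b • m) := by
  obtain ⟨ξ, η, g, hg, h1, h2⟩ := hm
  refine ⟨b * ξ, b • η, g, hg, ?_, ?_⟩
  · rw [smul_comm, h1, map_smul]
    module
  · rw [Algebra.smul_def, mul_left_comm, h2, map_mul]

theorem isResidue_toMero (η : OmegaS n) : IsResidue h (toMero η) 0 :=
  ⟨0, η, 1, by rw [map_one]; exact one_mem _, by simp, by simp⟩

/-- Residue zero means h ∣ ξ, so g aᵢ ∈ (h) for every numerator aᵢ, and g can be cancelled modulo h.
-/
theorem exists_toMero_of_isResidue_zero (h_ne : h ≠ 0) {ω : OmegaM n} (hω : ω ∈ logForms1 h)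
    (h0 : IsResidue h ω 0) : ∃ η, toMero η = ω := by
  obtain ⟨ξ, η, g, hg, h1, h2⟩ := h0
  obtain ⟨a, ha⟩ := exists_numerators hω
  rw [mul_zero, eq_comm, algebraMap_MD_eq_zero_iff] at h2
  rw [smul_eq_smul_dlog_add_iff h_ne ha] at h1
  have h3 : ∀ i, a i ∈ Ideal.span {h} := fun i => by
    refine (algebraMap_OD_mem_nonZeroDivisors_iff _).mp hg _ ?_
    rw [mul_comm, h1]
    exact add_mem (Ideal.mul_mem_right _ _ h2)
      (Ideal.mul_mem_right _ _ (Ideal.mem_span_singleton_self h))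
  choose b hb using fun i => Ideal.mem_span_singleton'.mp (h3 i)
  refine ⟨b, funext fun i => ?_⟩
  apply mul_left_cancel₀ (algebraMap_MS_ne_zero h_ne)
  rw [ha, ← hb, map_mul, mul_comm]
  rfl

theorem isResidue_zero_right (h_ne : h ≠ 0)
    (hc : algebraMap (OS n) (OD h) (∑ i, c i * partialS i h) ∈ (OD h)⁰) {m : MD h}
    (hm : IsResidue h 0 m) : m = 0 := by
  obtain ⟨ξ, η, g, hg, h1, h2⟩ := hm
  rw [smul_eq_smul_dlog_add_iff h_ne (a := 0) (by simp)] at h1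
  have h3 : ξ ∈ Ideal.span {h} := mem_span_of_mul_partialS_mem hc fun i => by
    refine Ideal.mem_span_singleton'.mpr ⟨-η i, ?_⟩
    have h4 := h1 i
    rw [Pi.zero_apply, mul_zero] at h4
    linear_combination h4
  rw [(algebraMap_MD_eq_zero_iff ξ).mpr h3] at h2
  exact (isUnit_algebraMap_MD hg).mul_right_eq_zero.mp h2

theorem IsResidue.unique (h_ne : h ≠ 0)
    (hc : algebraMap (OS n) (OD h) (∑ i, c i * partialS i h) ∈ (OD h)⁰) {ω : OmegaM n}
    {m m' : MD h} (hm : IsResidue h ω m) (hm' : IsResidue h ω m') : m = m' := by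
  have h1 := hm.add (hm'.smul (-1))
  have h2 : ω + (-1 : OS n) • ω = 0 := by module
  rw [h2] at h1
  have h3 := isResidue_zero_right h_ne hc h1
  rwa [neg_smul, one_smul, ← sub_eq_add_neg, sub_eq_zero] at h3

/-- The residue map. -/
def residueMap (h_ne : h ≠ 0)
    (hc : algebraMap (OS n) (OD h) (∑ i, c i * partialS i h) ∈ (OD h)⁰) :
    logForms1 h →ₗ[OS n] RD h where
  toFun ω := ⟨(exists_isResidue h_ne hc ω.2).choose,
    ω, ω.2, (exists_isResidue h_ne hc ω.2).choose_spec⟩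
  map_add' ω ω' := Subtype.ext (IsResidue.unique h_ne hc
    (exists_isResidue h_ne hc (ω + ω').2).choose_spec
    ((exists_isResidue h_ne hc ω.2).choose_spec.add (exists_isResidue h_ne hc ω'.2).choose_spec))
  map_smul' b ω := Subtype.ext (IsResidue.unique h_ne hc
    (exists_isResidue h_ne hc (b • ω).2).choose_spec
    ((exists_isResidue h_ne hc ω.2).choose_spec.smul b))

theorem isResidueMap_residueMap (h_ne : h ≠ 0)
    (hc : algebraMap (OS n) (OD h) (∑ i, c i * partialS i h) ∈ (OD h)⁰) :
    IsResidueMap h (residueMap h_ne hc) := by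
  intro ω m
  have h1 : IsResidue h ω (residueMap h_ne hc ω : MD h) :=
    (exists_isResidue h_ne hc ω.2).choose_spec
  exact ⟨fun hm => hm.unique h_ne hc h1, fun hm => hm ▸ h1⟩

end

end Residue

/-! ### The diagram -/

section Diagram

variable {n : ℕ} {h : OS n}

theorem mem_logForms0_iff (h_ne : h ≠ 0) {c : Fin n → OS n}
    (hc : algebraMap (OS n) (OD h) (∑ i, c i * partialS i h) ∈ (OD h)⁰) (f : MS n) :
    f ∈ logForms0 h ↔ ∃ a : OS n, algebraMap (OS n) (MS n) a = f := by
  have h0 := algebraMap_MS_ne_zero h_ne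
  constructor
  · rintro ⟨⟨a, ha⟩, h2⟩
    have hf : f = algebraMap (OS n) (MS n) a / algebraMap (OS n) (MS n) h := by
      rw [eq_div_iff h0, mul_comm, ha]
    have h3 : a ∈ Ideal.span {h} := mem_span_of_mul_partialS_mem hc fun i => by
      obtain ⟨b, hb⟩ := h2 i
      have h4 := algebraMap_mul_partialM_div h_ne i a
      rw [← hf, hb, ← map_mul] at h4
      refine Ideal.mem_span_singleton'.mpr ⟨partialS i a - b, ?_⟩
      linear_combination -(algebraMap_MS_injective h4)
    obtain ⟨b, rfl⟩ := Ideal.mem_span_singleton'.mp h3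
    refine ⟨b, ?_⟩
    rw [hf, eq_div_iff h0, map_mul]
  · rintro ⟨a, rfl⟩
    refine ⟨algebraMap_mem_poleModule h a, fun i => ?_⟩
    rw [partialM, fracDer_algebraMap]
    exact algebraMap_mem_poleModule h _

theorem mem_dlogWedge_iff (h_ne : h ≠ 0) {c : Fin n → OS n}
    (hc : algebraMap (OS n) (OD h) (∑ i, c i * partialS i h) ∈ (OD h)⁰) (ω : logForms1 h) :
    ω ∈ dlogWedge h ↔
      ∃ f : OS n, f • (⟨dlog h, dlog_mem h⟩ : logForms1 h) = ω := by
  rw [dlogWedge, Submodule.mem_comap, Submodule.mem_map]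
  constructor
  · rintro ⟨f, hf, hω⟩
    obtain ⟨a, rfl⟩ := (mem_logForms0_iff h_ne hc f).mp hf
    refine ⟨a, Subtype.ext (Eq.trans ?_ hω)⟩
    exact funext fun i => Algebra.smul_def a (dlog h i)
  · rintro ⟨a, rfl⟩
    refine ⟨algebraMap (OS n) (MS n) a, (mem_logForms0_iff h_ne hc _).mpr ⟨a, rfl⟩, ?_⟩
    exact (funext fun i => Algebra.smul_def a (dlog h i)).symm

theorem omegaIncl_smul_dS (f : OS n) : omegaIncl h (f • dS h) =
    (h * f) • (⟨dlog h, dlog_mem h⟩ : logForms1 h) := by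
  refine Subtype.ext (funext fun i => ?_)
  change algebraMap (OS n) (MS n) (f * partialS i h) = (h * f) • dlog h i
  rw [Algebra.smul_def, map_mul, map_mul, ← mul_dlog h i]
  ring

theorem residueMap_smul_dlog (h_ne : h ≠ 0) {c : Fin n → OS n}
    (hc : algebraMap (OS n) (OD h) (∑ i, c i * partialS i h) ∈ (OD h)⁰) (f : OS n) :
    residueMap h_ne hc (f • (⟨dlog h, dlog_mem h⟩ : logForms1 h)) =
      inclRD h (algebraMap (OS n) (OD h) f) := by
  refine Subtype.ext ?_
  rw [map_smul]
  have h1 := (isResidueMap_residueMap h_ne hc ⟨dlog h, dlog_mem h⟩ 1).mp (isResidue_dlog h)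
  change f • ((residueMap h_ne hc _ : RD h) : MD h) = algebraMap (OS n) (OD h) f • (1 : MD h)
  rw [← h1, algebraMap_smul]

theorem residueMap_omegaIncl (h_ne : h ≠ 0) {c : Fin n → OS n}
    (hc : algebraMap (OS n) (OD h) (∑ i, c i * partialS i h) ∈ (OD h)⁰) (η : OmegaS n) :
    residueMap h_ne hc (omegaIncl h η) = 0 :=
  Subtype.ext ((isResidueMap_residueMap h_ne hc (omegaIncl h η) 0).mp (isResidue_toMero η)).symm

theorem omegaIncl_injective : Function.Injective (omegaIncl h) := by
  intro η η' hη
  refine funext fun i => algebraMap_MS_injective ?_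
  exact congrFun (congrArg Subtype.val hη) i

theorem exact_omegaIncl_residueMap (h_ne : h ≠ 0) {c : Fin n → OS n}
    (hc : algebraMap (OS n) (OD h) (∑ i, c i * partialS i h) ∈ (OD h)⁰) :
    Function.Exact (omegaIncl h) (residueMap h_ne hc) := by
  intro ω
  constructor
  · intro h0
    have h1 : IsResidue h ω 0 :=
      (isResidueMap_residueMap h_ne hc ω 0).mpr (congrArg Subtype.val h0).symm
    obtain ⟨η, hη⟩ := exists_toMero_of_isResidue_zero h_ne ω.2 h1
    exact ⟨η, Subtype.ext hη⟩
  · rintro ⟨η, rfl⟩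
    exact residueMap_omegaIncl h_ne hc η

theorem residueMap_surjective (h_ne : h ≠ 0) {c : Fin n → OS n}
    (hc : algebraMap (OS n) (OD h) (∑ i, c i * partialS i h) ∈ (OD h)⁰) :
    Function.Surjective (residueMap h_ne hc) := by
  rintro ⟨m, ω, hω, hm⟩
  exact ⟨⟨ω, hω⟩, Subtype.ext ((isResidueMap_residueMap h_ne hc ⟨ω, hω⟩ m).mp hm).symm⟩

/-- The residue of f dh/h is f restricted to D. If the form is holomorphic, h divides f and the form
is a multiple of dh. -/
theorem smul_dlog_eq_omegaIncl (h_ne : h ≠ 0) {c : Fin n → OS n}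
    (hc : algebraMap (OS n) (OD h) (∑ i, c i * partialS i h) ∈ (OD h)⁰) {f : OS n} {η : OmegaS n}
    (hf : f • (⟨dlog h, dlog_mem h⟩ : logForms1 h) = omegaIncl h η) :
    η ∈ Submodule.span (OS n) {dS h} := by
  have h1 : inclRD h (algebraMap (OS n) (OD h) f) = 0 := by
    rw [← residueMap_smul_dlog h_ne hc, hf, residueMap_omegaIncl]
  have h2 : f ∈ Ideal.span {h} := by
    rw [← algebraMap_MD_eq_zero_iff, algebraMap_OD_MD]
    have h3 := congrArg Subtype.val h1
    change algebraMap (OS n) (OD h) f • (1 : MD h) = 0 at h3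
    rwa [Algebra.smul_def, mul_one] at h3
  obtain ⟨b, rfl⟩ := Ideal.mem_span_singleton'.mp h2
  rw [mul_comm, ← omegaIncl_smul_dS] at hf
  rw [← omegaIncl_injective hf]
  exact Submodule.smul_mem _ _ (Submodule.mem_span_singleton_self _)

variable (h) in
/-- The map `Ω¹_{S/T} → Ω¹(log h)` induced by the inclusion `Ω¹_S ⊆ Ω¹(log D)`. -/
def relFormsIncl (h_ne : h ≠ 0) {c : Fin n → OS n}
    (hc : algebraMap (OS n) (OD h) (∑ i, c i * partialS i h) ∈ (OD h)⁰) :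
    RelForms h →ₗ[OS n] RelLogForms h :=
  Submodule.mapQ _ _ (omegaIncl h) (by
    rw [Submodule.span_singleton_le_iff_mem, Submodule.mem_comap, mem_dlogWedge_iff h_ne hc]
    refine ⟨h, ?_⟩
    have h1 := omegaIncl_smul_dS (h := h) 1
    rw [one_smul, mul_one] at h1
    exact h1.symm)

variable (h) in
/-- The map `Ω¹(log h) → ℛ_h` induced by the residue map. -/
def relResidueMap (h_ne : h ≠ 0) {c : Fin n → OS n}
    (hc : algebraMap (OS n) (OD h) (∑ i, c i * partialS i h) ∈ (OD h)⁰) :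
    RelLogForms h →ₗ[OS n] Rh h :=
  Submodule.liftQ _ (((LinearMap.range (inclRD h)).mkQ.restrictScalars (OS n)) ∘ₗ
    residueMap h_ne hc) (by
    intro ω hω
    obtain ⟨f, rfl⟩ := (mem_dlogWedge_iff h_ne hc ω).mp hω
    rw [LinearMap.mem_ker, LinearMap.comp_apply, residueMap_smul_dlog]
    exact (Submodule.Quotient.mk_eq_zero _).mpr ⟨_, rfl⟩)

theorem isShortExact_rel (h_ne : h ≠ 0) {c : Fin n → OS n}
    (hc : algebraMap (OS n) (OD h) (∑ i, c i * partialS i h) ∈ (OD h)⁰) :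
    IsShortExact (relFormsIncl h h_ne hc) (relResidueMap h h_ne hc) := by
  refine ⟨?_, ?_, ?_⟩
  · rw [← LinearMap.ker_eq_bot, LinearMap.ker_eq_bot']
    intro x hx
    obtain ⟨η, rfl⟩ := Submodule.mkQ_surjective _ x
    have h1 : omegaIncl h η ∈ dlogWedge h := (Submodule.Quotient.mk_eq_zero _).mp hx
    obtain ⟨f, hf⟩ := (mem_dlogWedge_iff h_ne hc _).mp h1
    exact (Submodule.Quotient.mk_eq_zero _).mpr (smul_dlog_eq_omegaIncl h_ne hc hf)
  · intro x
    obtain ⟨ω, rfl⟩ := Submodule.mkQ_surjective _ x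
    constructor
    · intro hx
      have h1 : residueMap h_ne hc ω ∈ LinearMap.range (inclRD h) :=
        (Submodule.Quotient.mk_eq_zero _).mp hx
      obtain ⟨a, ha⟩ := h1
      obtain ⟨a, rfl⟩ := Ideal.Quotient.mk_surjective a
      -- Subtracting a dh/h removes the residue a without changing the class in Ω¹(log h).
      have h2 : residueMap h_ne hc (ω - a • ⟨dlog h, dlog_mem h⟩) = 0 := by
        rw [map_sub, residueMap_smul_dlog, sub_eq_zero]
        exact ha.symm
      obtain ⟨η, hη⟩ := (exact_omegaIncl_residueMap h_ne hc _).mp h2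
      refine ⟨Submodule.Quotient.mk η, ?_⟩
      change Submodule.Quotient.mk (omegaIncl h η) = (Submodule.Quotient.mk ω : RelLogForms h)
      rw [hη, Submodule.Quotient.eq]
      refine (mem_dlogWedge_iff h_ne hc _).mpr ⟨-a, ?_⟩
      module
    · rintro ⟨y, hy⟩
      obtain ⟨η, rfl⟩ := Submodule.mkQ_surjective _ y
      rw [← hy]
      change Submodule.Quotient.mk (residueMap h_ne hc (omegaIncl h η)) = (0 : Rh h)
      rw [residueMap_omegaIncl, Submodule.Quotient.mk_zero]
  · intro x
    obtain ⟨m, rfl⟩ := Submodule.mkQ_surjective _ x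
    obtain ⟨ω, rfl⟩ := residueMap_surjective h_ne hc m
    exact ⟨Submodule.Quotient.mk ω, rfl⟩

theorem exact_toSpanSingleton_mkQ {R M : Type} [CommRing R] [AddCommGroup M] [Module R M] (x : M)
    (P : Submodule R M) (hP : ∀ y, y ∈ P ↔ ∃ r : R, r • x = y)
    (hx : ∀ r : R, r • x = 0 → r = 0) :
    IsShortExact (LinearMap.toSpanSingleton R M x) P.mkQ := by
  refine ⟨?_, ?_, P.mkQ_surjective⟩
  · rw [← LinearMap.ker_eq_bot, LinearMap.ker_eq_bot']
    exact hx
  · intro y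
    rw [Submodule.mkQ_apply, Submodule.Quotient.mk_eq_zero, hP]
    rfl

/-- Not all partials of h vanish: otherwise 1 would lie in (h), although h is not a unit. -/
theorem eq_zero_of_mul_partialS_eq_zero (h_zero : valueAtZero h = 0) {c : Fin n → OS n}
    (hc : algebraMap (OS n) (OD h) (∑ i, c i * partialS i h) ∈ (OD h)⁰) {f : OS n}
    (hf : ∀ i, f * partialS i h = 0) : f = 0 := by
  have hnt : (1 : OS n) ∉ Ideal.span {h} := by
    intro h1
    rw [Ideal.mem_span_singleton, ← isUnit_iff_dvd_one, isUnit_iff_valueAtZero_ne_zero] at h1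
    exact h1 h_zero
  by_contra hf0
  refine hnt (mem_span_of_mul_partialS_mem hc fun i => ?_)
  rw [(mul_eq_zero.mp (hf i)).resolve_left hf0, mul_zero]
  exact zero_mem _

theorem exists_diagram (h_ne : h ≠ 0) (h_zero : valueAtZero h = 0) (h_red : IsReduced (OD h)) :
    ∃ (ρ : logForms1 h →ₗ[OS n] RD h) (ι : RelForms h →ₗ[OS n] RelLogForms h)
        (σ : RelLogForms h →ₗ[OS n] Rh h),
      IsResidueMap h ρ ∧
      IsShortExact (LinearMap.mulLeft (OS n) h) (Algebra.linearMap (OS n) (OD h)) ∧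
      IsShortExact (omegaIncl h) ρ ∧
      IsShortExact ι σ ∧
      IsShortExact (LinearMap.toSpanSingleton (OS n) (OmegaS n) (dS h))
        (Submodule.span (OS n) {dS h}).mkQ ∧
      IsShortExact (LinearMap.toSpanSingleton (OS n) (logForms1 h) ⟨dlog h, dlog_mem h⟩)
        (dlogWedge h).mkQ ∧
      IsShortExact (inclRD h) (LinearMap.range (inclRD h)).mkQ ∧
      (∀ f : OS n, omegaIncl h (f • dS h) =
        (h * f) • (⟨dlog h, dlog_mem h⟩ : logForms1 h)) ∧
      (∀ f : OS n, ρ (f • (⟨dlog h, dlog_mem h⟩ : logForms1 h)) =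
        inclRD h (algebraMap (OS n) (OD h) f)) ∧
      (∀ η : OmegaS n, ι ((Submodule.span (OS n) {dS h}).mkQ η) =
        (dlogWedge h).mkQ (omegaIncl h η)) ∧
      (∀ ω : logForms1 h, σ ((dlogWedge h).mkQ ω) =
        (LinearMap.range (inclRD h)).mkQ (ρ ω)) := by
  obtain ⟨c, hc⟩ := exists_partial_combination h h_ne h_red
  refine ⟨residueMap h_ne hc, relFormsIncl h h_ne hc, relResidueMap h h_ne hc,
    isResidueMap_residueMap h_ne hc, ⟨?_, ?_, Ideal.Quotient.mk_surjective⟩,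
    ⟨omegaIncl_injective, exact_omegaIncl_residueMap h_ne hc, residueMap_surjective h_ne hc⟩,
    isShortExact_rel h_ne hc, ?_, ?_, ⟨?_, LinearMap.exact_map_mkQ_range _, Submodule.mkQ_surjective _⟩,
    omegaIncl_smul_dS, residueMap_smul_dlog h_ne hc, fun η => rfl, fun ω => rfl⟩
  · exact mul_right_injective₀ h_ne
  · intro x
    rw [Algebra.linearMap_apply, algebraMap_OD_eq_zero_iff, Ideal.mem_span_singleton']
    simp only [Set.mem_range, LinearMap.mulLeft_apply, mul_comm h]
  · refine exact_toSpanSingleton_mkQ _ _ (fun y => Submodule.mem_span_singleton) fun f hf => ?_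
    exact eq_zero_of_mul_partialS_eq_zero h_zero hc fun i => congrFun hf i
  · refine exact_toSpanSingleton_mkQ _ _ (mem_dlogWedge_iff h_ne hc) fun f hf => ?_
    refine eq_zero_of_mul_partialS_eq_zero h_zero hc fun i => algebraMap_MS_injective ?_
    have h1 : f • dlog h i = 0 := congrFun (congrArg Subtype.val hf) i
    rw [Algebra.smul_def] at h1
    rw [map_mul, ← mul_dlog, mul_left_comm, h1, mul_zero, map_zero]
  · rw [← LinearMap.ker_eq_bot, LinearMap.ker_eq_bot']
    intro a ha
    have h1 : a • (1 : MD h) = 0 := congrArg Subtype.val ha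
    rw [Algebra.smul_def, mul_one] at h1
    exact (map_eq_zero_iff _ (IsFractionRing.injective (OD h) (MD h))).mp h1

end Diagram

section Duality

open CategoryTheory CategoryTheory.Abelian

universe u v

/-! ### `Ext` over a regular local ring and over a quotient of it -/

section RegularLocal

open RingTheory.Sequence Pointwise IsLocalRing

variable {S : Type u} [CommRing S]

theorem isWeaklyRegular_of_flat {rs : List S} (h : IsWeaklyRegular S rs) (K : Type u)
    [AddCommGroup K] [Module S K] [Module.Flat S K] : IsWeaklyRegular K rs :=
  ((TensorProduct.rid S K).isWeaklyRegular_congr rs).mp (h.isWeaklyRegular_lTensor (M₂ := K))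

theorem quotient_smul_top_eq (J : Ideal S) : (J • ⊤ : Submodule S S) = J :=
  (smul_eq_mul _ _).trans (Ideal.mul_top J)

variable [IsLocalRing S] {xs : List S} (hxs : Ideal.ofList xs = maximalIdeal S)

include hxs

theorem isSimpleModule_quotient_ofList :
    IsSimpleModule S (S ⧸ (Ideal.ofList xs • ⊤ : Submodule S S)) :=
  isSimpleModule_iff_quot_maximal.mpr ⟨maximalIdeal S, inferInstance,
    ⟨Submodule.quotEquivOfEq _ _ ((quotient_smul_top_eq _).trans hxs)⟩⟩

theorem nonempty_iso_quotient_ofList (N : ModuleCat.{u} S) [IsSimpleModule S N] :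
    Nonempty (N ≅ ModuleCat.of S (S ⧸ (Ideal.ofList xs • ⊤ : Submodule S S))) := by
  have := isSimpleModule_quotient_ofList hxs
  obtain ⟨e⟩ := nonempty_equiv_residueField (R := S) N
  obtain ⟨e'⟩ := nonempty_equiv_residueField (R := S) (S ⧸ (Ideal.ofList xs • ⊤ : Submodule S S))
  exact ⟨(e.trans e'.symm).toModuleIso⟩

theorem smul_eq_zero_of_isSimpleModule (N : ModuleCat.{u} S) [IsSimpleModule S N] :
    ∀ r ∈ xs, ∀ x : N, r • x = 0 := by
  intro r hr x
  obtain ⟨e⟩ := nonempty_equiv_residueField (R := S) N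
  apply e.injective
  rw [map_smul, map_zero]
  exact smul_residueField_eq_zero (hxs ▸ mem_ofList_of_mem hr) _

theorem subsingleton_ext_of_lt_length (N : ModuleCat.{u} S) [IsSimpleModule S N]
    (X : ModuleCat.{u} S) (hX : IsWeaklyRegular X xs) (i : ℕ) (hi : i < xs.length) :
    Subsingleton (Ext N X i) := by
  obtain ⟨θ, hθ⟩ := exists_rees_class xs X hX
  exact (hθ N (smul_eq_zero_of_isSimpleModule hxs N)).1 i hi

/-- A simple module is S/(xs), whose projective dimension is at most the length of xs. -/
theorem subsingleton_ext_of_length_lt (hreg : IsWeaklyRegular S xs) (N : ModuleCat.{u} S)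
    [IsSimpleModule S N] (X : ModuleCat.{u} S) (i : ℕ) (hi : xs.length < i) :
    Subsingleton (Ext N X i) := by
  obtain ⟨e⟩ := nonempty_iso_quotient_ofList hxs N
  have h1 : HasProjectiveDimensionLT (ModuleCat.of S (S ⧸ (Ideal.ofList xs • ⊤ : Submodule S S)))
      (1 + xs.length) := hasProjectiveDimensionLT_quotient xs (ModuleCat.of S S) hreg 1
  exact subsingleton_ext_of_iso e.symm X i
    (HasProjectiveDimensionLT.subsingleton _ (1 + xs.length) i (by omega) X)

/-- By the Rees isomorphism this is Hom(k, S/(xs)) = Hom(k, k) ≅ k. -/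
theorem isSimpleModule_ext_length (hreg : IsWeaklyRegular S xs) (N : ModuleCat.{u} S)
    [IsSimpleModule S N] : IsSimpleModule S (Ext N (ModuleCat.of S S) xs.length) := by
  obtain ⟨e⟩ := nonempty_iso_quotient_ofList hxs N
  obtain ⟨θ, hθ⟩ := exists_rees_class xs (ModuleCat.of S S) hreg
  have hQ := isSimpleModule_quotient_ofList hxs
  have e1 := reesEquiv θ (hθ N (smul_eq_zero_of_isSimpleModule hxs N)).2
  have e2 := Linear.homCongr S e (Iso.refl
    (ModuleCat.of S (S ⧸ (Ideal.ofList xs • ⊤ : Submodule S S))))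
  have e3 := homQuotientEquiv (Ideal.ofList xs • ⊤ : Submodule S S)
    (S ⧸ (Ideal.ofList xs • ⊤ : Submodule S S)) fun r hr x => by
      rw [quotient_smul_top_eq] at hr
      exact ofList_smul_quotient xs S r hr x
  exact IsSimpleModule.congr (e1.symm.trans (e2.trans e3))

end RegularLocal

/-! ### Duality along a surjection S → A -/

section Quotient

open RingTheory.Sequence Pointwise IsLocalRing

variable {S A : Type u} [CommRing S] [CommRing A] [Algebra S A]

/-- A morphism of modules given by its underlying function. -/
def moduleHom {M N : ModuleCat.{u} S} (f : M → N) (hadd : ∀ x y, f (x + y) = f x + f y)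
    (hsmul : ∀ (s : S) x, f (s • x) = s • f x) : M ⟶ N :=
  ModuleCat.ofHom { toFun := f, map_add' := hadd, map_smul' := hsmul }

theorem hom_ext_of_forall {M N : ModuleCat.{u} S} {f g : M ⟶ N} (h : ∀ x, f.hom x = g.hom x) :
    f = g := ModuleCat.hom_ext (LinearMap.ext h)

/-- The identity of M is a sum of maps through Z. For M = Aᵐ and Z = A this avoids identifying the
restriction of scalars of a product. -/
theorem subsingleton_ext_of_sum_comp {M Z : ModuleCat.{u} S} (X : ModuleCat.{u} S) (j : ℕ) {m : ℕ}
    (u : Fin m → (M ⟶ Z)) (v : Fin m → (Z ⟶ M)) (huv : ∀ x, ∑ i, (v i).hom ((u i).hom x) = x)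
    (h : Subsingleton (Ext Z X j)) : Subsingleton (Ext M X j) := by
  have h1 : 𝟙 M = ∑ i, u i ≫ v i := by
    refine hom_ext_of_forall fun x => ?_
    rw [ModuleCat.hom_sum, LinearMap.sum_apply]
    exact (huv x).symm
  refine subsingleton_of_forall_eq 0 fun e => ?_
  rw [← Ext.mk₀_id_comp e, h1, Ext.mk₀_sum, Ext.sum_comp]
  refine Finset.sum_eq_zero fun i _ => ?_
  rw [← Ext.mk₀_comp_mk₀_assoc, Subsingleton.elim ((Ext.mk₀ (v i)).comp e (zero_add j)) 0,
    Ext.comp_zero]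

theorem subsingleton_ext_restrictScalars_pi (X : ModuleCat.{u} S) (j m : ℕ)
    (h : Subsingleton (Ext (ModuleCat.of S A) X j)) : Subsingleton
      (Ext ((ModuleCat.restrictScalars (algebraMap S A)).obj (ModuleCat.of A (Fin m → A))) X j) := by
  classical
  refine subsingleton_ext_of_sum_comp X j
    (fun i => moduleHom (fun x => (x : Fin m → A) i) (fun x y => rfl) fun s x => ?_)
    (fun i => moduleHom (fun a : A => (Pi.single i a : Fin m → A))
      (fun x y => Pi.single_add (f := fun _ => A) i (x : A) (y : A)) fun s x => ?_) (fun x => ?_) h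
  · exact (Algebra.smul_def s ((x : Fin m → A) i)).symm
  · change (Pi.single i (s • (x : A)) : Fin m → A) = algebraMap S A s • (Pi.single i x : Fin m → A)
    rw [Algebra.smul_def, ← smul_eq_mul, Pi.single_smul]
  · exact Finset.univ_sum_single (x : Fin m → A)

variable [IsNoetherianRing A]

/-- Duality for a quotient `A` of `S` of projective dimension `c`: an `A`-module that represents
`N ↦ Ext^c_S(N, X)` also computes the higher `Ext^{i+c}_S(N, X)`. -/
theorem bijective_extShift_restrictScalars {X : ModuleCat.{u} S} {Y : ModuleCat.{u} A} {c : ℕ}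
    (θ : Ext ((ModuleCat.restrictScalars (algebraMap S A)).obj Y) X c)
    (hX : ∀ j, c < j → Subsingleton (Ext (ModuleCat.of S A) X j))
    (h0 : ∀ N : ModuleCat.{u} A, Function.Bijective fun f : N ⟶ Y =>
      (Ext.mk₀ ((ModuleCat.restrictScalars (algebraMap S A)).map f)).comp θ (zero_add c))
    (N : ModuleCat.{u} A) [Module.Finite A N] (i : ℕ) :
    Function.Bijective (extShift (ModuleCat.restrictScalars (algebraMap S A)) θ N i) := by
  refine bijective_extShift _ θ (fun N => Module.Finite A N) ?_ (fun N _ => h0 N) i N ‹_›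
  intro N hN
  obtain ⟨m, f, hf⟩ := Module.Finite.exists_fin' A N
  have hex := LinearMap.exact_subtype_ker_map f
  exact ⟨ModuleCat.of A (LinearMap.ker f), ModuleCat.of A (Fin m → A),
    ModuleCat.ofHom (LinearMap.ker f).subtype, ModuleCat.ofHom f,
    ModuleCat.hom_ext hex.linearMap_comp_eq_zero,
    ModuleCat.shortComplex_shortExact _ hex (LinearMap.ker f).injective_subtype hf,
    inferInstanceAs (Module.Finite A (LinearMap.ker f)),
    inferInstanceAs (Module.Finite A (Fin m → A)),
    ModuleCat.projective_of_free (Pi.basisFun A (Fin m)),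
    fun j hj => subsingleton_ext_restrictScalars_pi X j m (hX j hj)⟩

omit [IsNoetherianRing A] in
-- `extShift` is only an additive map; S-linearity is what carries simplicity of the S-module Ext
-- back to A.
theorem extShift_smul {X : ModuleCat.{u} S} {Y : ModuleCat.{u} A} {c : ℕ}
    (θ : Ext ((ModuleCat.restrictScalars (algebraMap S A)).obj Y) X c) (N : ModuleCat.{u} A)
    (i : ℕ) (s : S) (e : Ext N Y i) :
    extShift (ModuleCat.restrictScalars (algebraMap S A)) θ N i (algebraMap S A s • e) =
      s • extShift (ModuleCat.restrictScalars (algebraMap S A)) θ N i e := by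
  have h1 : algebraMap S A s • e = (Ext.mk₀ (algebraMap S A s • 𝟙 N)).comp e (zero_add i) := by
    rw [Ext.mk₀_smul, Ext.smul_comp, Ext.mk₀_id_comp]
  have h2 : (ModuleCat.restrictScalars (algebraMap S A)).map (algebraMap S A s • 𝟙 N) =
      s • 𝟙 ((ModuleCat.restrictScalars (algebraMap S A)).obj N) := rfl
  rw [h1, extShift_comp, Ext.mapExactFunctor_mk₀, h2, Ext.mk₀_smul, Ext.smul_comp,
    Ext.mk₀_id_comp]

section

omit [IsNoetherianRing A]

variable {Y : Type u} [AddCommGroup Y] [Module A Y] [Module S Y] [IsScalarTower S A Y]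

/-- An `S`-linear map out of an `A`-module, considered as a map out of its restriction of
scalars. -/
def ofRestrictScalars {Q : Type u} [AddCommGroup Q] [Module S Q] (j : Y →ₗ[S] Q) :
    (ModuleCat.restrictScalars (algebraMap S A)).obj (ModuleCat.of A Y) ⟶ ModuleCat.of S Q :=
  have h (s : S) (y : Y) : j (algebraMap S A s • y) = s • j y := by
    rw [algebraMap_smul, map_smul]
  moduleHom (fun y => j (y : Y)) (fun x y => map_add j (x : Y) (y : Y)) h

/-- An S-linear map from an A-module lands in the part of Q killed by the kernel of S → A, and that
part is j(Y). Surjectivity of S → A makes the factorization A-linear. -/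
theorem bijective_map_comp_ofRestrictScalars (hS : Function.Surjective (algebraMap S A))
    {Q : Type u} [AddCommGroup Q] [Module S Q]
    (j : Y →ₗ[S] Q) (hj : Function.Injective j)
    (hrange : ∀ b : Q, (∀ s : S, algebraMap S A s = 0 → s • b = 0) → ∃ y, j y = b)
    (N : ModuleCat.{u} A) : Function.Bijective fun f : N ⟶ ModuleCat.of A Y =>
      (ModuleCat.restrictScalars (algebraMap S A)).map f ≫ ofRestrictScalars (A := A) j := by
  constructor
  · intro f g hfg
    refine ModuleCat.hom_ext (LinearMap.ext fun x => hj ?_)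
    have h1 := congrArg (fun φ => φ.hom x) hfg
    exact h1
  · intro φ
    have hsmul : ∀ (s : S) (x : N), φ.hom (algebraMap S A s • x : N) = s • (φ.hom x : Q) :=
      fun s x => φ.hom.map_smul s x
    have h1 : ∀ x : N, ∃ y, j y = φ.hom x := fun x => by
      refine hrange _ fun s hs => ?_
      refine (hsmul s x).symm.trans ?_
      rw [hs, zero_smul]
      exact map_zero φ.hom
    choose f hf using h1
    refine ⟨moduleHom f (fun x y => hj ?_) fun a x => hj ?_, hom_ext_of_forall hf⟩
    · rw [map_add, hf, hf, hf]
      exact map_add φ.hom x y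
    · obtain ⟨s, rfl⟩ := hS a
      refine (hf _).trans ((hsmul s x).trans ?_)
      rw [← hf, ← map_smul]
      exact congrArg j (algebraMap_smul A s (f x)).symm

/-- The dualizing class of a quotient `A` of `S`: the pull-back of the Rees class. -/
theorem exists_duality_class (hS : Function.Surjective (algebraMap S A)) (rs : List S)
    (hrs : IsWeaklyRegular S rs) (hker : ∀ r ∈ rs, algebraMap S A r = 0)
    (j : Y →ₗ[S] (S ⧸ (Ideal.ofList rs • ⊤ : Submodule S S))) (hj : Function.Injective j)
    (hrange : ∀ b, (∀ s : S, algebraMap S A s = 0 → s • b = 0) → ∃ y, j y = b) :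
    ∃ θ : Ext ((ModuleCat.restrictScalars (algebraMap S A)).obj (ModuleCat.of A Y))
        (ModuleCat.of S S) rs.length,
      ∀ N : ModuleCat.{u} A, Function.Bijective fun f : N ⟶ ModuleCat.of A Y =>
        (Ext.mk₀ ((ModuleCat.restrictScalars (algebraMap S A)).map f)).comp θ (zero_add _) := by
  obtain ⟨θ, hθ⟩ := exists_rees_class rs (ModuleCat.of S S) hrs
  refine ⟨(Ext.mk₀ (ofRestrictScalars j)).comp θ (zero_add _), fun N => ?_⟩
  have h1 := (hθ ((ModuleCat.restrictScalars (algebraMap S A)).obj N) fun r hr x => by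
    rw [ModuleCat.restrictScalars.smul_def, hker r hr]
    exact zero_smul A (x : N)).2.comp (bijective_map_comp_ofRestrictScalars hS j hj hrange N)
  have h2 : ∀ f : N ⟶ ModuleCat.of A Y,
      (Ext.mk₀ ((ModuleCat.restrictScalars (algebraMap S A)).map f)).comp
        ((Ext.mk₀ (ofRestrictScalars j)).comp θ (zero_add _)) (zero_add _) =
      (Ext.mk₀ ((ModuleCat.restrictScalars (algebraMap S A)).map f ≫
        ofRestrictScalars (A := A) j)).comp θ (zero_add _) := fun f => Ext.mk₀_comp_mk₀_assoc _ _ _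
  rw [funext h2]
  exact h1

end

end Quotient

/-! ### Ext of the residue field into the dual module -/

section CanonicalModule

open RingTheory.Sequence Pointwise IsLocalRing

variable {S A : Type} [CommRing S] [CommRing A] [Algebra S A] [IsLocalRing A]
  {Y : Type} [AddCommGroup Y] [Module A Y] [Module S Y]
  [IsScalarTower S A Y]

theorem isSimpleModule_restrictScalars_residueField (hS : Function.Surjective (algebraMap S A)) :
    IsSimpleModule S ((ModuleCat.restrictScalars (algebraMap S A)).obj
      (ModuleCat.of A (ResidueField A))) := by
  rw [isSimpleModule_iff_toSpanSingleton_surjective]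
  have h1 := isSimpleModule_iff_toSpanSingleton_surjective.mp
    (isSimpleModule_residueField (R := A))
  refine ⟨h1.1, fun x hx y => ?_⟩
  obtain ⟨a, ha⟩ := h1.2 x hx y
  obtain ⟨s, rfl⟩ := hS a
  exact ⟨s, ha⟩

variable [IsLocalRing S] [IsNoetherianRing A]

/-- Write c and n for the lengths of rs and xs. Duality gives Extⁱ over A of (k, Y) ≅ Ext^{i+c} over
S of (k, S), which is zero unless i + c = n and simple then. -/
theorem ext_residueField_of_quotient (hS : Function.Surjective (algebraMap S A)) {xs : List S}
    (hxs : Ideal.ofList xs = maximalIdeal S) (hreg : IsWeaklyRegular S xs) {rs : List S}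
    (hlen : rs.length ≤ xs.length)
    (hrs : IsWeaklyRegular S rs) (hker : ∀ r ∈ rs, algebraMap S A r = 0)
    (j : Y →ₗ[S] (S ⧸ (Ideal.ofList rs • ⊤ : Submodule S S))) (hj : Function.Injective j)
    (hrange : ∀ b, (∀ s : S, algebraMap S A s = 0 → s • b = 0) → ∃ y, j y = b)
    (hpd : ∀ i, rs.length < i → Subsingleton (Ext (ModuleCat.of S A) (ModuleCat.of S S) i)) :
    (∀ i, i ≠ xs.length - rs.length →
      Subsingleton (Ext (ModuleCat.of A (ResidueField A)) (ModuleCat.of A Y) i)) ∧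
    Nonempty (Ext (ModuleCat.of A (ResidueField A)) (ModuleCat.of A Y) (xs.length - rs.length)
      ≃ₗ[A] ResidueField A) := by
  have hsimple := isSimpleModule_restrictScalars_residueField hS
  obtain ⟨θ, hθ⟩ := exists_duality_class hS rs hrs hker j hj hrange
  have hfin : Module.Finite A (ModuleCat.of A (ResidueField A)) :=
    inferInstanceAs (Module.Finite A (ResidueField A))
  have hbij := bijective_extShift_restrictScalars θ hpd hθ (ModuleCat.of A (ResidueField A))
  constructor
  · intro i hi
    have h1 : Subsingleton (Ext ((ModuleCat.restrictScalars (algebraMap S A)).obj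
        (ModuleCat.of A (ResidueField A))) (ModuleCat.of S S) (i + rs.length)) := by
      rcases lt_or_gt_of_ne (show i + rs.length ≠ xs.length by omega) with h2 | h2
      · exact subsingleton_ext_of_lt_length hxs _ _ hreg _ h2
      · exact subsingleton_ext_of_length_lt hxs hreg _ _ _ h2
    exact (hbij i).1.subsingleton
  · have h1 : IsSimpleModule S (Ext ((ModuleCat.restrictScalars (algebraMap S A)).obj
        (ModuleCat.of A (ResidueField A))) (ModuleCat.of S S)
        (xs.length - rs.length + rs.length)) := by
      rw [Nat.sub_add_cancel hlen]
      exact isSimpleModule_ext_length hxs hreg _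
    have h2 := isSimpleModule_iff_toSpanSingleton_surjective.mp h1
    have h3 := hbij (xs.length - rs.length)
    have h4 : IsSimpleModule A (Ext (ModuleCat.of A (ResidueField A)) (ModuleCat.of A Y)
        (xs.length - rs.length)) := by
      rw [isSimpleModule_iff_toSpanSingleton_surjective]
      refine ⟨(Equiv.ofBijective _ h3).nontrivial_congr.mpr h2.1, fun e he e' => ?_⟩
      obtain ⟨s, hs⟩ := h2.2 _ (fun h0 => he (h3.1 (h0.trans (map_zero _).symm)))
        (extShift (ModuleCat.restrictScalars (algebraMap S A)) θ _ _ e')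
      exact ⟨algebraMap S A s, h3.1 ((extShift_smul θ _ _ s e).trans hs)⟩
    exact nonempty_equiv_residueField _

end CanonicalModule

/-! ### Depth and dimension -/

section Depth

open RingTheory.Sequence Pointwise IsLocalRing

theorem exists_coe_of_add_natCast_eq {x : WithBot ℕ∞} {c n : ℕ} (hx : 0 ≤ x)
    (h : x + (c : WithBot ℕ∞) = (n : WithBot ℕ∞)) : c ≤ n ∧ x = ((n - c : ℕ) : WithBot ℕ∞) := by
  induction x with
  | bot => simp at hx
  | coe e =>
    have h1 : e + (c : ℕ∞) = (n : ℕ∞) := WithBot.coe_injective h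
    induction e with
    | top => exact absurd h1 (by simp)
    | coe e =>
      have h2 : e + c = n := by exact_mod_cast h1
      refine ⟨by omega, ?_⟩
      rw [← h2, Nat.add_sub_cancel]
      rfl

variable {A : Type} [CommRing A] [IsLocalRing A]

theorem le_depth {M : Type} [AddCommGroup M] [Module A M] (rs : List A)
    (hmem : ∀ r ∈ rs, r ∈ maximalIdeal A) (hrs : IsRegular M rs) : (rs.length : ℕ∞) ≤ depth A M :=
  le_iSup₂_of_le rs ⟨hmem, hrs⟩ le_rfl

theorem depth_le_of_nontrivial_ext (M : Type) [AddCommGroup M] [Module A M] {d : ℕ}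
    (h : Nontrivial (Ext (ModuleCat.of A (ResidueField A)) (ModuleCat.of A M) d)) :
    depth A M ≤ d := by
  refine iSup₂_le fun rs hrs => ?_
  by_contra hlt
  have hlt' : d < rs.length := by
    rw [not_le] at hlt
    exact_mod_cast hlt
  have h1 := subsingleton_ext_residueField_of_isWeaklyRegular (ModuleCat.of A M) rs hrs.1 hrs.2.1
    d hlt'
  exact not_subsingleton _ h1

variable [IsNoetherianRing A]

theorem length_le_ringKrullDim (rs : List A) (hrs : IsRegular A rs) :
    (rs.length : WithBot ℕ∞) ≤ ringKrullDim A := by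
  rw [← ringKrullDim_add_length_eq_ringKrullDim_of_isRegular rs hrs]
  have h1 : Nontrivial (A ⧸ Ideal.ofList rs) := by
    refine Ideal.Quotient.nontrivial_iff.mpr fun h => hrs.2 ?_
    rw [h, Submodule.top_smul]
  exact le_add_of_nonneg_left ringKrullDim_nonneg_of_nontrivial

theorem depth_self_le {d : ℕ} (hdim : ringKrullDim A = d) : depth A A ≤ d := by
  refine iSup₂_le fun rs hrs => ?_
  have h1 := (length_le_ringKrullDim rs hrs.2).trans_eq hdim
  exact_mod_cast h1

theorem le_depth_of_subsingleton_ext (M : Type) [AddCommGroup M] [Module A M] [Module.Finite A M]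
    [Nontrivial M] {d : ℕ}
    (h : ∀ i < d, Subsingleton (Ext (ModuleCat.of A (ResidueField A)) (ModuleCat.of A M) i)) :
    (d : ℕ∞) ≤ depth A M := by
  obtain ⟨rs, rfl, hmem, hrs⟩ := exists_isRegular_of_subsingleton_ext (ModuleCat.of A M) d h
  exact le_depth rs hmem hrs

end Depth

/-! ### Cohen–Macaulay quotients of a regular local ring -/

section Quotient

open RingTheory.Sequence Pointwise IsLocalRing

variable {S A : Type} [CommRing S] [CommRing A] [Algebra S A] [IsLocalRing S] [IsLocalRing A]
  [IsNoetherianRing S]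

theorem ringKrullDim_of_ofList_eq_maximalIdeal {xs : List S}
    (hxs : Ideal.ofList xs = maximalIdeal S) (hreg : IsWeaklyRegular S xs) :
    ringKrullDim S = xs.length := by
  have hmem : ∀ r ∈ xs, r ∈ maximalIdeal S := fun r hr => hxs ▸ mem_ofList_of_mem hr
  have h1 := ringKrullDim_add_length_eq_ringKrullDim_of_isRegular xs
    (IsRegular.of_isWeaklyRegular_of_mem_maximalIdeal S hmem hreg)
  have h2 : ringKrullDim (S ⧸ Ideal.ofList xs) = 0 := by
    rw [hxs]
    exact ringKrullDim_eq_zero_of_field (ResidueField S)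
  rw [← h1, h2, zero_add]

/-- A is a quotient of S/(rs), and the regular sequence rs lowers the dimension of S by its length.
-/
theorem ringKrullDim_quotient_le (hS : Function.Surjective (algebraMap S A)) {xs : List S}
    (hxs : Ideal.ofList xs = maximalIdeal S) (hreg : IsWeaklyRegular S xs) {rs : List S}
    (hrs : IsWeaklyRegular S rs) (hker : ∀ r ∈ rs, algebraMap S A r = 0) :
    rs.length ≤ xs.length ∧ ringKrullDim A ≤ ((xs.length - rs.length : ℕ) : WithBot ℕ∞) := by
  have hmem : ∀ r ∈ rs, r ∈ maximalIdeal S := fun r hr => by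
    rw [mem_maximalIdeal, mem_nonunits_iff]
    intro hu
    have h1 := hu.map (algebraMap S A)
    rw [hker r hr] at h1
    exact not_isUnit_zero h1
  have hreg' := IsRegular.of_isWeaklyRegular_of_mem_maximalIdeal S hmem hrs
  have h1 := ringKrullDim_add_length_eq_ringKrullDim_of_isRegular rs hreg'
  rw [ringKrullDim_of_ofList_eq_maximalIdeal hxs hreg] at h1
  have h2 : Ideal.ofList rs ≤ RingHom.ker (algebraMap S A) := Ideal.span_le.mpr hker
  have h3 : Function.Surjective (Ideal.Quotient.lift (Ideal.ofList rs) (algebraMap S A) h2) :=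
    Ideal.Quotient.lift_surjective_of_surjective _ _ hS
  have h4 : Nontrivial (S ⧸ Ideal.ofList rs) := h3.nontrivial
  obtain ⟨h5, h6⟩ := exists_coe_of_add_natCast_eq ringKrullDim_nonneg_of_nontrivial h1
  exact ⟨h5, h6 ▸ ringKrullDim_le_of_surjective _ h3⟩

/-- The Ext criterion over S produces an A-regular sequence in S; its image in A is the sequence
sought. -/
theorem exists_isRegular_quotient (hS : Function.Surjective (algebraMap S A)) (d : ℕ)
    (hext : ∀ i < d, Subsingleton
      (Ext (ModuleCat.of S (ResidueField S)) (ModuleCat.of S A) i)) :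
    ∃ as : List A, as.length = d ∧ (∀ a ∈ as, a ∈ maximalIdeal A) ∧ IsRegular A as := by
  have hfin : Module.Finite S (ModuleCat.of S A) :=
    Module.Finite.of_surjective (Algebra.linearMap S A) hS
  have hnt : Nontrivial (ModuleCat.of S A) := inferInstanceAs (Nontrivial A)
  obtain ⟨rs, hlen, hmem, hrs⟩ := exists_isRegular_of_subsingleton_ext (ModuleCat.of S A) d hext
  have hloc : IsLocalHom (algebraMap S A) := hS.isLocalHom _
  have hmem' : ∀ a ∈ rs.map (algebraMap S A), a ∈ maximalIdeal A := by
    intro a ha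
    obtain ⟨r, hr, rfl⟩ := List.mem_map.mp ha
    rw [mem_maximalIdeal, mem_nonunits_iff, isUnit_map_iff]
    exact (mem_maximalIdeal r).mp (hmem r hr)
  refine ⟨rs.map (algebraMap S A), by rw [List.length_map, hlen], hmem', ?_⟩
  have hnoeth : IsNoetherianRing A := isNoetherianRing_of_surjective S A (algebraMap S A) hS
  exact IsRegular.of_isWeaklyRegular_of_mem_maximalIdeal A hmem'
    ((isWeaklyRegular_map_algebraMap_iff A A rs).mpr hrs.1)

variable {Y : Type} [AddCommGroup Y] [Module A Y] [Module S Y] [IsScalarTower S A Y]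

/-- A quotient `A` of a regular local ring `S` whose projective dimension equals the length of an
`S`-regular sequence in the kernel is Cohen–Macaulay; the annihilator of the kernel modulo the
sequence is a canonical module, and `A` is Gorenstein if and only if that module is cyclic. -/
theorem isCanonicalModule_of_quotient (hS : Function.Surjective (algebraMap S A)) {xs : List S}
    (hxs : Ideal.ofList xs = maximalIdeal S) (hreg : IsWeaklyRegular S xs) {rs : List S}
    (hrs : IsWeaklyRegular S rs) (hker : ∀ r ∈ rs, algebraMap S A r = 0)
    (j : Y →ₗ[S] (S ⧸ (Ideal.ofList rs • ⊤ : Submodule S S))) (hj : Function.Injective j)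
    (hrange : ∀ b, (∀ s : S, algebraMap S A s = 0 → s • b = 0) → ∃ y, j y = b)
    (hpd : ∀ i, rs.length < i → Subsingleton (Ext (ModuleCat.of S A) (ModuleCat.of S S) i))
    (hext : ∀ i, i + rs.length < xs.length → Subsingleton
      (Ext (ModuleCat.of S (ResidueField S)) (ModuleCat.of S A) i)) :
    IsCohenMacaulay A ∧ IsCanonicalModule A Y ∧
      (IsGorenstein A ↔ ∃ y : Y, Submodule.span A {y} = ⊤) := by
  have hnoeth : IsNoetherianRing A := isNoetherianRing_of_surjective S A (algebraMap S A) hS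
  obtain ⟨hlen, hdim'⟩ := ringKrullDim_quotient_le hS hxs hreg hrs hker
  obtain ⟨as, has, hasm, hasr⟩ := exists_isRegular_quotient hS (xs.length - rs.length)
    fun i hi => hext i (by omega)
  have hdim : ringKrullDim A = ((xs.length - rs.length : ℕ) : WithBot ℕ∞) :=
    le_antisymm hdim' (has ▸ length_le_ringKrullDim as hasr)
  have hdepth : depth A A = ((xs.length - rs.length : ℕ) : ℕ∞) :=
    le_antisymm (depth_self_le hdim) (has ▸ le_depth as hasm hasr)
  have hCM : IsCohenMacaulay A := Or.inr ⟨inferInstance, hnoeth, by rw [hdepth, hdim]; rfl⟩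
  obtain ⟨hvan, ⟨ε⟩⟩ := ext_residueField_of_quotient hS hxs hreg hlen hrs hker j hj hrange hpd
  have hfinS : Module.Finite S Y := Module.Finite.of_injective j hj
  have hfin : Module.Finite A Y := Module.Finite.of_restrictScalars_finite S A Y
  have hntE := ε.toEquiv.nontrivial
  have hntY : Nontrivial Y := by
    by_contra hcon
    rw [not_nontrivial_iff_subsingleton] at hcon
    have h0 : 𝟙 (ModuleCat.of A Y) = 0 := hom_ext_of_forall fun x => Subsingleton.elim (α := Y) _ _
    obtain ⟨e, he⟩ := exists_ne (0 : Ext (ModuleCat.of A (ResidueField A)) (ModuleCat.of A Y)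
      (xs.length - rs.length))
    refine he ?_
    rw [← Ext.comp_mk₀_id e, h0, Ext.mk₀_zero, Ext.comp_zero]
  have hinj : HasInjectiveDimensionLE (ModuleCat.of A Y) (xs.length - rs.length) :=
    hasInjectiveDimensionLE_of_subsingleton_ext_residueField (ModuleCat.of A Y)
      fun i hi => hvan i hi.ne'
  refine ⟨hCM, ⟨hCM, Or.inr ⟨inferInstance, _, hdim, hfin, ?_, ⟨ε⟩, _, hinj⟩⟩, ?_⟩
  · exact le_antisymm (depth_le_of_nontrivial_ext Y hntE)
      (le_depth_of_subsingleton_ext Y fun i hi => hvan i hi.ne)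
  · rw [← hasInjectiveDimensionLE_iff_exists_span_eq_top Y _ hdim (fun i hi =>
      subsingleton_ext_residueField_of_isWeaklyRegular (ModuleCat.of A A) as hasm hasr.1 i
        (has ▸ hi)) hvan ⟨ε⟩]
    constructor
    · rintro (hsub | ⟨hloc, -, e, he⟩)
      · exact absurd hsub (not_subsingleton A)
      · exact ⟨e, he⟩
    · rintro ⟨e, he⟩
      exact Or.inr ⟨inferInstance, hnoeth, e, he⟩

end Quotient

/-! ### Consequences of a free resolution of length two -/

section Resolution

variable {R : Type u} [CommRing R]

theorem subsingleton_ext_X₃ {S : ShortComplex (ModuleCat.{u} R)} (hS : S.ShortExact)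
    (N : ModuleCat.{u} R) (i : ℕ) (h₂ : Subsingleton (Ext N S.X₂ i))
    (h₁ : Subsingleton (Ext N S.X₁ (i + 1))) : Subsingleton (Ext N S.X₃ i) := by
  refine subsingleton_of_forall_eq 0 fun e => ?_
  obtain ⟨e', rfl⟩ := Ext.covariant_sequence_exact₃ N hS e rfl (Subsingleton.elim _ _)
  rw [Subsingleton.elim e' 0, Ext.zero_comp]

/-- The exact sequence `0 → ker f → M → range f → 0`. -/
theorem exists_shortExact_ker_range {M N : Type u} [AddCommGroup M] [Module R M] [AddCommGroup N]
    [Module R N] (f : M →ₗ[R] N) : ∃ (u : ModuleCat.of R (LinearMap.ker f) ⟶ ModuleCat.of R M)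
      (v : ModuleCat.of R M ⟶ ModuleCat.of R (LinearMap.range f)) (w : u ≫ v = 0),
      (ShortComplex.mk u v w).ShortExact := by
  have hex : Function.Exact (LinearMap.ker f).subtype f.rangeRestrict := by
    intro x
    rw [← LinearMap.mem_ker, LinearMap.ker_rangeRestrict]
    exact (LinearMap.exact_subtype_ker_map f) x
  exact ⟨ModuleCat.ofHom (LinearMap.ker f).subtype, ModuleCat.ofHom f.rangeRestrict,
    ModuleCat.hom_ext hex.linearMap_comp_eq_zero,
    ModuleCat.shortComplex_shortExact _ hex (LinearMap.ker f).injective_subtype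
      f.surjective_rangeRestrict⟩

variable {A : Type u} [CommRing A] [Algebra R A]

theorem exists_shortExact_ker_algebraMap (hA : Function.Surjective (algebraMap R A))
    (I : Submodule R R) (hI : ∀ r, r ∈ I ↔ algebraMap R A r = 0) :
    ∃ (u : ModuleCat.of R I ⟶ ModuleCat.of R R) (v : ModuleCat.of R R ⟶ ModuleCat.of R A)
      (w : u ≫ v = 0), (ShortComplex.mk u v w).ShortExact := by
  have hex : Function.Exact I.subtype (Algebra.linearMap R A) := by
    intro x
    rw [Algebra.linearMap_apply, ← hI]
    simp
  exact ⟨ModuleCat.ofHom I.subtype, ModuleCat.ofHom (Algebra.linearMap R A),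
    ModuleCat.hom_ext hex.linearMap_comp_eq_zero,
    ModuleCat.shortComplex_shortExact _ hex I.injective_subtype hA⟩

variable {F : Type u} [AddCommGroup F] [Module R F] [Module.Free R F]

/-- 0 → ker ψ → F → R → A → 0 is a free resolution of length 2; the strict bound is therefore 3. -/
theorem hasProjectiveDimensionLT_three (hA : Function.Surjective (algebraMap R A))
    (ψ : F →ₗ[R] R) (hψ : ∀ r, r ∈ LinearMap.range ψ ↔ algebraMap R A r = 0)
    (hK : Module.Free R (LinearMap.ker ψ)) : HasProjectiveDimensionLT (ModuleCat.of R A) 3 := by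
  obtain ⟨u, v, w, h1⟩ := exists_shortExact_ker_range ψ
  obtain ⟨u', v', w', h2⟩ := exists_shortExact_ker_algebraMap hA _ hψ
  have p0 : Projective (ModuleCat.of R (LinearMap.ker ψ)) :=
    ModuleCat.projective_of_free (Module.Free.chooseBasis R (LinearMap.ker ψ))
  have p1 : Projective (ModuleCat.of R F) :=
    ModuleCat.projective_of_free (Module.Free.chooseBasis R F)
  have p2 : Projective (ModuleCat.of R R) :=
    ModuleCat.projective_of_free (Module.Free.chooseBasis R R)
  have h3 : HasProjectiveDimensionLT (ModuleCat.of R (LinearMap.range ψ)) 2 :=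
    h1.hasProjectiveDimensionLT_X₃ 1 inferInstance (hasProjectiveDimensionLT_of_ge _ 1 2 (by omega))
  exact h2.hasProjectiveDimensionLT_X₃ 2 h3 (hasProjectiveDimensionLT_of_ge _ 1 3 (by omega))

/-- The same resolution, read in the second variable of Ext: vanishing on free modules below m costs
two degrees when passed on to A. -/
theorem subsingleton_ext_of_resolution (hA : Function.Surjective (algebraMap R A))
    (ψ : F →ₗ[R] R) (hψ : ∀ r, r ∈ LinearMap.range ψ ↔ algebraMap R A r = 0)
    (hK : Module.Free R (LinearMap.ker ψ)) (N : ModuleCat.{u} R) (m : ℕ)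
    (hN : ∀ (X : Type u) [AddCommGroup X] [Module R X] [Module.Free R X], ∀ i < m,
      Subsingleton (Ext N (ModuleCat.of R X) i)) (i : ℕ) (hi : i + 2 < m) :
    Subsingleton (Ext N (ModuleCat.of R A) i) := by
  obtain ⟨u, v, w, h1⟩ := exists_shortExact_ker_range ψ
  obtain ⟨u', v', w', h2⟩ := exists_shortExact_ker_algebraMap hA _ hψ
  exact subsingleton_ext_X₃ h2 N i (hN R i (by omega))
    (subsingleton_ext_X₃ h1 N (i + 1) (hN F _ (by omega)) (hN _ _ (by omega)))

end Resolution

/-! ### The resolution of 𝒪_Z for a free divisor -/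

section FreeDivisor

variable {n : ℕ} (h : OS n)

theorem algebraMap_OZ_surjective : Function.Surjective (algebraMap (OS n) (OZ h)) :=
  Ideal.Quotient.mk_surjective.comp Ideal.Quotient.mk_surjective

/-- The presentation `(c, f) ↦ ∑ cᵢ ∂h/∂xᵢ + f h` of the ideal of `Z`. -/
def jacobianPresentation : ((Fin n → OS n) × OS n) →ₗ[OS n] OS n :=
  LinearMap.coprod (Fintype.linearCombination (OS n) fun i => partialS i h)
    (LinearMap.toSpanSingleton (OS n) (OS n) h)

theorem jacobianPresentation_apply (x : (Fin n → OS n) × OS n) :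
    jacobianPresentation h x = ∑ i, x.1 i * partialS i h + x.2 * h := rfl

theorem mem_range_jacobianPresentation_iff (r : OS n) :
    r ∈ LinearMap.range (jacobianPresentation h) ↔ algebraMap (OS n) (OZ h) r = 0 := by
  have h1 : algebraMap (OS n) (OZ h) r = 0 ↔ algebraMap (OS n) (OD h) r ∈ jacobianIdeal h :=
    Ideal.Quotient.eq_zero_iff_mem
  rw [h1]
  constructor
  · rintro ⟨x, rfl⟩
    have h2 : algebraMap (OS n) (OD h) h = 0 :=
      (algebraMap_OD_eq_zero_iff h).mpr (Ideal.mem_span_singleton_self h)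
    rw [jacobianPresentation_apply, map_add, map_sum, map_mul, h2, mul_zero, add_zero]
    refine Ideal.sum_mem _ fun i _ => ?_
    rw [map_mul]
    exact Ideal.mul_mem_left _ _ (Ideal.subset_span ⟨i, rfl⟩)
  · intro hr
    obtain ⟨c, hc⟩ := (Submodule.mem_span_range_iff_exists_fun _).mp hr
    choose c' hc' using fun i => Ideal.Quotient.mk_surjective (c i)
    have h2 : r - ∑ i, c' i * partialS i h ∈ Ideal.span {h} := by
      rw [← algebraMap_OD_eq_zero_iff, map_sub, sub_eq_zero, ← hc, map_sum]
      refine Finset.sum_congr rfl fun i _ => ?_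
      rw [map_mul, smul_eq_mul, ← hc' i]
      rfl
    obtain ⟨b, hb⟩ := Ideal.mem_span_singleton'.mp h2
    refine ⟨(c', b), ?_⟩
    rw [jacobianPresentation_apply, hb]
    ring

theorem partialS_sum_smul (c : Fin n → OS n) (f : OS n) :
    (∑ i, c i • partialS i) f = ∑ i, c i * partialS i f := by
  have h1 := congrFun (map_sum (Derivation.coeFnAddMonoidHom (R := ℂ) (A := OS n) (M := OS n))
    (fun i => c i • partialS i) Finset.univ) f
  rw [Finset.sum_apply] at h1
  exact h1

/-- The syzygies of `∂h/∂x₁, …, ∂h/∂xₙ, h` are the logarithmic vector fields. -/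
def syzygyToDerLog : LinearMap.ker (jacobianPresentation h) →ₗ[OS n] derLog h :=
  LinearMap.codRestrict (derLog h)
    (Fintype.linearCombination (OS n) (fun i : Fin n => partialS i) ∘ₗ
      LinearMap.fst (OS n) (Fin n → OS n) (OS n) ∘ₗ (LinearMap.ker (jacobianPresentation h)).subtype)
    (fun x => by
      change (∑ i, x.1.1 i • partialS i) h ∈ Ideal.span {h}
      rw [partialS_sum_smul]
      have h1 : ∑ i, x.1.1 i * partialS i h + x.1.2 * h = 0 := x.2
      exact Ideal.mem_span_singleton'.mpr ⟨-x.1.2, by linear_combination -h1⟩)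

variable {h}

/-- A vector field δ is determined by its coefficients δ(xᵢ). If it is logarithmic, the last entry
of the syzygy is forced to be -δ(h)/h. -/
theorem bijective_syzygyToDerLog (h_ne : h ≠ 0) : Function.Bijective (syzygyToDerLog h) := by
  classical
  constructor
  · rw [← LinearMap.ker_eq_bot, LinearMap.ker_eq_bot']
    intro x hx
    have h1 : (∑ i, x.1.1 i • partialS i : Derivation ℂ (OS n) (OS n)) = 0 :=
      congrArg Subtype.val hx
    have h2 : x.1.1 = 0 := funext fun j => by
      have h3 := partialS_sum_smul x.1.1 (coordS j)
      rw [h1] at h3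
      simpa [partialS_coordS] using h3.symm
    have h4 : ∑ i, x.1.1 i * partialS i h + x.1.2 * h = 0 := x.2
    rw [h2] at h4
    have h5 : x.1.2 = 0 := by simpa [h_ne] using h4
    exact Subtype.ext (Prod.ext h2 h5)
  · rintro ⟨δ, hδ⟩
    obtain ⟨b, hb⟩ := Ideal.mem_span_singleton'.mp (show δ h ∈ Ideal.span {h} from hδ)
    have h1 := derivation_eq_sum δ
    have h2 : δ h = ∑ i, δ (coordS i) * partialS i h := by
      conv_lhs => rw [h1]
      exact partialS_sum_smul _ h
    refine ⟨⟨(fun i => δ (coordS i), -b), ?_⟩, Subtype.ext h1.symm⟩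
    rw [LinearMap.mem_ker, jacobianPresentation_apply, ← h2, ← hb]
    ring

theorem free_syzygies (h_ne : h ≠ 0) (hfree : IsFreeDivisor h) :
    Module.Free (OS n) (LinearMap.ker (jacobianPresentation h)) :=
  haveI : Module.Free (OS n) (derLog h) := hfree
  Module.Free.of_equiv (LinearEquiv.ofBijective _ (bijective_syzygyToDerLog h_ne)).symm

end FreeDivisor

/-! ### ℛ_h as the annihilator of the ideal of Z in 𝒪_S/(h, g) -/

section Embedding

open RingTheory.Sequence Pointwise

variable {n : ℕ} {h : OS n}

theorem isWeaklyRegular_pair (h_ne : h ≠ 0) {g : OS n}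
    (hg : algebraMap (OS n) (OD h) g ∈ (OD h)⁰) : IsWeaklyRegular (OS n) [h, g] := by
  rw [isWeaklyRegular_cons_iff, isWeaklyRegular_singleton_iff]
  refine ⟨fun x y hxy => mul_left_cancel₀ h_ne hxy, ?_⟩
  rw [isSMulRegular_iff_right_eq_zero_of_smul]
  intro x hx
  obtain ⟨x, rfl⟩ := Submodule.mkQ_surjective _ x
  have h1 : ∀ y : OS n, (Submodule.Quotient.mk y : QuotSMulTop h (OS n)) = 0 ↔
      y ∈ Ideal.span {h} := fun y => by
    rw [Submodule.Quotient.mk_eq_zero, ← Submodule.ideal_span_singleton_smul, smul_eq_mul,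
      Ideal.mul_top]
  have h2 : (Submodule.Quotient.mk (g • x) : QuotSMulTop h (OS n)) = 0 := hx
  rw [h1, smul_eq_mul, mul_comm] at h2
  exact (h1 x).mpr ((algebraMap_OD_mem_nonZeroDivisors_iff g).mp hg x h2)

theorem sum_partial_smul_mem (c : Fin n → OS n) (m : RD h) :
    algebraMap (OS n) (OD h) (∑ i, c i * partialS i h) • (m : MD h) ∈
      LinearMap.range (Algebra.linearMap (OD h) (MD h)) := by
  rw [map_sum, Finset.sum_smul]
  refine Submodule.sum_mem _ fun i _ => ?_
  obtain ⟨a, ha⟩ := partial_smul_mem h m.2 i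
  rw [map_mul, mul_smul, ha]
  exact Submodule.smul_mem _ _ ⟨a, rfl⟩

variable (h) in
/-- Multiplication by `g = ∑ cᵢ ∂h/∂xᵢ`, as a map `ℛ_D → 𝒪_D`. -/
def mulRD (c : Fin n → OS n) : RD h →ₗ[OD h] OD h :=
  (LinearEquiv.ofInjective (Algebra.linearMap (OD h) (MD h))
    (IsFractionRing.injective (OD h) (MD h))).symm.toLinearMap ∘ₗ
  LinearMap.codRestrict _
    (LinearMap.lsmul (OD h) (MD h) (algebraMap (OS n) (OD h) (∑ i, c i * partialS i h)) ∘ₗ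
      (RD h).subtype) (sum_partial_smul_mem c)

theorem algebraMap_mulRD (c : Fin n → OS n) (m : RD h) :
    algebraMap (OD h) (MD h) (mulRD h c m) =
      algebraMap (OS n) (OD h) (∑ i, c i * partialS i h) • (m : MD h) :=
  congrArg Subtype.val (LinearEquiv.apply_symm_apply
    (LinearEquiv.ofInjective (Algebra.linearMap (OD h) (MD h))
      (IsFractionRing.injective (OD h) (MD h))) _)

variable (h) in
theorem span_le_ofList_smul_top (g : OS n) :
    Ideal.span {h} ≤ (Ideal.ofList [h, g] • ⊤ : Submodule (OS n) (OS n)) := by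
  rw [quotient_smul_top_eq, Ideal.span_singleton_le_iff_mem]
  exact mem_ofList_of_mem List.mem_cons_self

theorem mem_ofList_pair_iff (g x : OS n) :
    x ∈ (Ideal.ofList [h, g] • ⊤ : Submodule (OS n) (OS n)) ↔
      ∃ a, x - a * g ∈ Ideal.span {h} := by
  rw [quotient_smul_top_eq, Ideal.ofList_cons, Ideal.ofList_singleton]
  constructor
  · intro hx
    obtain ⟨y, hy, z, hz, rfl⟩ := Submodule.mem_sup.mp hx
    obtain ⟨a, rfl⟩ := Ideal.mem_span_singleton'.mp hz
    exact ⟨a, by rwa [add_sub_cancel_right]⟩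
  · rintro ⟨a, ha⟩
    rw [← sub_add_cancel x (a * g)]
    exact Submodule.add_mem_sup ha (Ideal.mem_span_singleton'.mpr ⟨a, rfl⟩)

variable (h) in
/-- Multiplication by `g = ∑ cᵢ ∂h/∂xᵢ`, as a map `ℛ_D → 𝒪_S / (h, g)`. -/
def mulRDQuotient (c : Fin n → OS n) : RD h →ₗ[OS n]
    (OS n ⧸ (Ideal.ofList [h, ∑ i, c i * partialS i h] • ⊤ : Submodule (OS n) (OS n))) :=
  Submodule.factor (span_le_ofList_smul_top h _) ∘ₗ (mulRD h c).restrictScalars (OS n)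

theorem mulRDQuotient_eq (c : Fin n → OS n) (m : RD h) (ξ : OS n)
    (hξ : mulRD h c m = algebraMap (OS n) (OD h) ξ) :
    mulRDQuotient h c m = Submodule.Quotient.mk ξ :=
  congrArg (Submodule.factor (span_le_ofList_smul_top h _)) hξ

theorem mulRD_eq_iff (c : Fin n → OS n) (m : RD h) (ξ : OS n) :
    mulRD h c m = algebraMap (OS n) (OD h) ξ ↔
      algebraMap (OS n) (MD h) (∑ i, c i * partialS i h) * m = algebraMap (OS n) (MD h) ξ := by
  rw [← (IsFractionRing.injective (OD h) (MD h)).eq_iff, algebraMap_mulRD, Algebra.smul_def,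
    ← algebraMap_OD_MD, ← algebraMap_OD_MD]

/-- g m lies in g 𝒪_D if and only if m lies in 𝒪_D, because g is a unit of ℳ_D. -/
theorem mulRDQuotient_eq_zero_iff {c : Fin n → OS n}
    (hc : algebraMap (OS n) (OD h) (∑ i, c i * partialS i h) ∈ (OD h)⁰) (m : RD h) :
    mulRDQuotient h c m = 0 ↔ m ∈ LinearMap.range (inclRD h) := by
  obtain ⟨ξ, hξ⟩ := Ideal.Quotient.mk_surjective (mulRD h c m)
  rw [mulRDQuotient_eq c m ξ hξ.symm, Submodule.Quotient.mk_eq_zero, mem_ofList_pair_iff]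
  have hξ' := (mulRD_eq_iff c m ξ).mp hξ.symm
  constructor
  · rintro ⟨a, ha⟩
    rw [← algebraMap_MD_eq_zero_iff, map_sub, sub_eq_zero, ← hξ', map_mul,
      mul_comm (algebraMap (OS n) (MD h) a)] at ha
    refine ⟨algebraMap (OS n) (OD h) a, Subtype.ext ?_⟩
    change algebraMap (OS n) (OD h) a • (1 : MD h) = m
    rw [Algebra.smul_def, mul_one, ← algebraMap_OD_MD]
    exact ((isUnit_algebraMap_MD hc).mul_left_cancel ha).symm
  · rintro ⟨a, rfl⟩
    obtain ⟨a, rfl⟩ := Ideal.Quotient.mk_surjective a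
    refine ⟨a, ?_⟩
    rw [← algebraMap_MD_eq_zero_iff, map_sub, sub_eq_zero, ← hξ', map_mul, mul_comm]
    congr 1
    change algebraMap (OS n) (OD h) a • (1 : MD h) = _
    rw [Algebra.smul_def, mul_one, ← algebraMap_OD_MD]

variable (h) in
/-- Multiplication by `g = ∑ cᵢ ∂h/∂xᵢ`, as a map `ℛ_h → 𝒪_S / (h, g)`. -/
def mulRh {c : Fin n → OS n}
    (hc : algebraMap (OS n) (OD h) (∑ i, c i * partialS i h) ∈ (OD h)⁰) : Rh h →ₗ[OS n]
    (OS n ⧸ (Ideal.ofList [h, ∑ i, c i * partialS i h] • ⊤ : Submodule (OS n) (OS n))) :=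
  Submodule.liftQ ((LinearMap.range (inclRD h)).restrictScalars (OS n)) (mulRDQuotient h c)
    (fun m hm => (mulRDQuotient_eq_zero_iff hc m).mpr hm) ∘ₗ
  (Submodule.Quotient.restrictScalarsEquiv (OS n) (LinearMap.range (inclRD h))).symm.toLinearMap

theorem mulRh_mk {c : Fin n → OS n}
    (hc : algebraMap (OS n) (OD h) (∑ i, c i * partialS i h) ∈ (OD h)⁰) (m : RD h) :
    mulRh h hc (Submodule.Quotient.mk m) = mulRDQuotient h c m := rfl

theorem mulRh_injective {c : Fin n → OS n}
    (hc : algebraMap (OS n) (OD h) (∑ i, c i * partialS i h) ∈ (OD h)⁰) :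
    Function.Injective (mulRh h hc) := by
  rw [← LinearMap.ker_eq_bot, LinearMap.ker_eq_bot']
  intro x hx
  obtain ⟨m, rfl⟩ := Submodule.mkQ_surjective _ x
  exact (Submodule.Quotient.mk_eq_zero _).mpr ((mulRDQuotient_eq_zero_iff hc m).mp hx)

/-- The image of `ℛ_h` in `𝒪_S / (h, g)` is the annihilator of the Jacobian ideal. -/
theorem exists_mulRh_eq (h_ne : h ≠ 0) {c : Fin n → OS n}
    (hc : algebraMap (OS n) (OD h) (∑ i, c i * partialS i h) ∈ (OD h)⁰)
    (b : OS n ⧸ (Ideal.ofList [h, ∑ i, c i * partialS i h] • ⊤ : Submodule (OS n) (OS n)))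
    (hb : ∀ s : OS n, algebraMap (OS n) (OZ h) s = 0 → s • b = 0) : ∃ y, mulRh h hc y = b := by
  obtain ⟨ξ, rfl⟩ := Submodule.mkQ_surjective _ b
  have h1 : ∀ i, ∃ a e, partialS i h * ξ - a * (∑ i, c i * partialS i h) = e * h := fun i => by
    have h2 : algebraMap (OS n) (OZ h) (partialS i h) = 0 :=
      Ideal.Quotient.eq_zero_iff_mem.mpr (Ideal.subset_span ⟨i, rfl⟩)
    have h3 := (Submodule.Quotient.mk_eq_zero _).mp (hb _ h2)
    obtain ⟨a, ha⟩ := (mem_ofList_pair_iff _ _).mp h3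
    obtain ⟨e, he⟩ := Ideal.mem_span_singleton'.mp ha
    exact ⟨a, e, he.symm⟩
  choose a e hae using h1
  have h0 := algebraMap_MS_ne_zero h_ne
  -- From ξ ∂ᵢh = aᵢ g + eᵢ h, the form ∑ aᵢ dxᵢ/h should have residue ξ/g. It is logarithmic:
  -- eliminating ξ shows that h divides g (∂ᵢh aⱼ - ∂ⱼh aᵢ), and g cancels modulo h.
  let ω : OmegaM n := fun i => algebraMap (OS n) (MS n) (a i) / algebraMap (OS n) (MS n) h
  have ha : ∀ i, algebraMap (OS n) (MS n) h * ω i = algebraMap (OS n) (MS n) (a i) := fun i =>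
    mul_div_cancel₀ _ h0
  have hω : ω ∈ logForms1 h := by
    rw [mem_logForms1_iff h_ne ha]
    intro i j
    refine (algebraMap_OD_mem_nonZeroDivisors_iff _).mp hc _ (Ideal.mem_span_singleton'.mpr
      ⟨partialS j h * e i - partialS i h * e j, ?_⟩)
    linear_combination (-partialS j h) * hae i + (partialS i h) * hae j
  obtain ⟨u, hu⟩ := isUnit_algebraMap_MD hc
  have hm : algebraMap (OS n) (MD h) (∑ i, c i * partialS i h) *
      (((u⁻¹ : (MD h)ˣ) : MD h) * algebraMap (OS n) (MD h) ξ) = algebraMap (OS n) (MD h) ξ := by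
    rw [← hu, ← mul_assoc, Units.mul_inv, one_mul]
  have hres : IsResidue h ω (((u⁻¹ : (MD h)ˣ) : MD h) * algebraMap (OS n) (MD h) ξ) := by
    refine ⟨ξ, -e, _, hc, ?_, hm⟩
    rw [smul_eq_smul_dlog_add_iff h_ne ha]
    intro i
    rw [Pi.neg_apply]
    linear_combination -hae i
  refine ⟨Submodule.Quotient.mk ⟨_, ω, hω, hres⟩, ?_⟩
  rw [mulRh_mk]
  exact mulRDQuotient_eq c _ ξ ((mulRD_eq_iff c _ ξ).mpr hm)

instance isScalarTower_OZ_Rh : IsScalarTower (OS n) (OZ h) (Rh h) where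
  smul_assoc s a x := by
    obtain ⟨a, rfl⟩ := Ideal.Quotient.mk_surjective a
    have h1 : ∀ b : OD h, (Ideal.Quotient.mk (jacobianIdeal h) b) • x = b • x := fun b => rfl
    have h2 : s • (Ideal.Quotient.mk (jacobianIdeal h) a) =
        Ideal.Quotient.mk (jacobianIdeal h) (s • a) := rfl
    rw [h2, h1, h1, smul_assoc]

end Embedding

/-! ### The canonical module and the Gorenstein criterion for Z -/

section FreeDivisor

variable {n : ℕ} {h : OS n}

/-- `ℛ_h` is cyclic if and only if `ℛ_D` is generated by `1` and one more residue. -/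
theorem exists_span_Rh_eq_top_iff : (∃ y : Rh h, Submodule.span (OZ h) {y} = ⊤) ↔
    ∃ r : MD h, RD h = Submodule.span (OD h) {1, r} := by
  have hsmul : ∀ (b : OD h) (x : Rh h),
      (Ideal.Quotient.mk (jacobianIdeal h) b) • x = b • x := fun b x => rfl
  constructor
  · rintro ⟨y, hy⟩
    obtain ⟨r, rfl⟩ := Submodule.mkQ_surjective _ y
    refine ⟨r, le_antisymm (fun m hm => ?_) ?_⟩
    · obtain ⟨a, ha⟩ := Submodule.mem_span_singleton.mp
        (hy ▸ Submodule.mem_top : (Submodule.Quotient.mk ⟨m, hm⟩ : Rh h) ∈ _)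
      obtain ⟨a, rfl⟩ := Ideal.Quotient.mk_surjective a
      rw [hsmul] at ha
      have h1 : (Submodule.Quotient.mk (a • r) : Rh h) = Submodule.Quotient.mk ⟨m, hm⟩ := ha
      obtain ⟨b, hb⟩ := (Submodule.Quotient.eq _).mp h1.symm
      have h2 : b • (1 : MD h) = m - a • (r : MD h) := congrArg Subtype.val hb
      exact Submodule.mem_span_pair.mpr ⟨b, a, by rw [h2]; abel⟩
    · rw [Submodule.span_le]
      rintro _ (rfl | rfl)
      · exact one_mem_RD h
      · exact r.2
  · rintro ⟨r, hr⟩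
    have hrm : r ∈ RD h := hr ▸ Submodule.subset_span (Or.inr rfl)
    refine ⟨Submodule.Quotient.mk ⟨r, hrm⟩, top_le_iff.mp fun x _ => ?_⟩
    obtain ⟨m, rfl⟩ := Submodule.mkQ_surjective _ x
    obtain ⟨b, a, hab⟩ := Submodule.mem_span_pair.mp (hr.le m.2)
    refine Submodule.mem_span_singleton.mpr ⟨Ideal.Quotient.mk _ a, ?_⟩
    rw [hsmul]
    refine (Submodule.Quotient.eq _).mpr ⟨-b, Subtype.ext ?_⟩
    change -b • (1 : MD h) = a • r - m
    rw [← hab]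
    module

theorem isCanonicalModule_Rh (h_ne : h ≠ 0) (h_red : IsReduced (OD h))
    (hfree : IsFreeDivisor h) :
    IsCohenMacaulay (OZ h) ∧ IsCanonicalModule (OZ h) (Rh h) ∧
      (IsGorenstein (OZ h) ↔ ∃ r : MD h, RD h = Submodule.span (OD h) {1, r}) := by
  rw [← exists_span_Rh_eq_top_iff]
  rcases subsingleton_or_nontrivial (OZ h) with hsub | hnt
  · have h1 : Subsingleton (Rh h) := Module.subsingleton (OZ h) (Rh h)
    exact ⟨Or.inl hsub, ⟨Or.inl hsub, Or.inl ⟨hsub, h1⟩⟩,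
      ⟨fun _ => ⟨0, Subsingleton.elim _ _⟩, fun _ => Or.inl hsub⟩⟩
  · obtain ⟨c, hc⟩ := exists_partial_combination h h_ne h_red
    have hloc : IsLocalRing (OZ h) :=
      IsLocalRing.of_surjective' (algebraMap (OS n) (OZ h)) (algebraMap_OZ_surjective h)
    have hK := free_syzygies h_ne hfree
    have hψ := mem_range_jacobianPresentation_iff h
    have hker : ∀ r ∈ [h, ∑ i, c i * partialS i h], algebraMap (OS n) (OZ h) r = 0 := by
      intro r hr
      rw [← hψ]
      rcases List.mem_pair.mp hr with rfl | rfl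
      · exact ⟨(0, 1), by simp [jacobianPresentation_apply]⟩
      · exact ⟨(c, 0), by simp [jacobianPresentation_apply]⟩
    have hpd := hasProjectiveDimensionLT_three (algebraMap_OZ_surjective h)
      (jacobianPresentation h) hψ hK
    -- The sequence h, g has length 2, matching the length of the free resolution of 𝒪_Z; this
    -- equality makes both the duality and the depth estimate sharp.
    refine isCanonicalModule_of_quotient (algebraMap_OZ_surjective h) (ofList_coordList n)
      (isWeaklyRegular_coordList n) (isWeaklyRegular_pair h_ne hc) hker (mulRh h hc)
      (mulRh_injective hc) (exists_mulRh_eq h_ne hc) (fun i hi => ?_) (fun i hi => ?_)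
    · exact HasProjectiveDimensionLT.subsingleton (ModuleCat.of (OS n) (OZ h)) 3 i hi _
    · have hsimple : IsSimpleModule (OS n)
          (ModuleCat.of (OS n) (IsLocalRing.ResidueField (OS n))) := isSimpleModule_residueField
      refine subsingleton_ext_of_resolution (algebraMap_OZ_surjective h)
        (jacobianPresentation h) hψ hK _ (coordList n).length (fun X _ _ _ i hi => ?_) i hi
      exact subsingleton_ext_of_lt_length (ofList_coordList n) _ (ModuleCat.of (OS n) X)
        (isWeaklyRegular_of_flat (isWeaklyRegular_coordList n) X) i hi

end FreeDivisor

end Duality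

end LogResidue

end

theorem proposition4p1 (n : ℕ) (h : LogResidue.OS n)
    (h_ne : h ≠ 0)
    (h_zero : LogResidue.valueAtZero h = 0)
    (h_red : IsReduced (LogResidue.OD h)) :
    Module.IsTorsionBySet (LogResidue.OD h) (LogResidue.Rh h) (LogResidue.jacobianIdeal h) ∧
    (∃ (ρ : LogResidue.logForms1 h →ₗ[LogResidue.OS n] LogResidue.RD h)
        (ι : LogResidue.RelForms h →ₗ[LogResidue.OS n] LogResidue.RelLogForms h)
        (σ : LogResidue.RelLogForms h →ₗ[LogResidue.OS n] LogResidue.Rh h),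
      LogResidue.IsResidueMap h ρ ∧
      -- the rows
      LogResidue.IsShortExact (LinearMap.mulLeft (LogResidue.OS n) h)
        (Algebra.linearMap (LogResidue.OS n) (LogResidue.OD h)) ∧
      LogResidue.IsShortExact (LogResidue.omegaIncl h) ρ ∧
      LogResidue.IsShortExact ι σ ∧
      -- the columns
      LogResidue.IsShortExact
        (LinearMap.toSpanSingleton (LogResidue.OS n) (LogResidue.OmegaS n) (LogResidue.dS h))
        (Submodule.span (LogResidue.OS n) {LogResidue.dS h}).mkQ ∧
      LogResidue.IsShortExact
        (LinearMap.toSpanSingleton (LogResidue.OS n) (LogResidue.logForms1 h)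
          ⟨LogResidue.dlog h, LogResidue.dlog_mem h⟩)
        (LogResidue.dlogWedge h).mkQ ∧
      LogResidue.IsShortExact (LogResidue.inclRD h)
        (LinearMap.range (LogResidue.inclRD h)).mkQ ∧
      -- the four squares commute
      (∀ f : LogResidue.OS n,
        LogResidue.omegaIncl h (f • LogResidue.dS h) =
          (h * f) • (⟨LogResidue.dlog h, LogResidue.dlog_mem h⟩ : LogResidue.logForms1 h)) ∧
      (∀ f : LogResidue.OS n,
        ρ (f • (⟨LogResidue.dlog h, LogResidue.dlog_mem h⟩ : LogResidue.logForms1 h)) =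
          LogResidue.inclRD h (algebraMap (LogResidue.OS n) (LogResidue.OD h) f)) ∧
      (∀ η : LogResidue.OmegaS n,
        ι ((Submodule.span (LogResidue.OS n) {LogResidue.dS h}).mkQ η) =
          (LogResidue.dlogWedge h).mkQ (LogResidue.omegaIncl h η)) ∧
      (∀ ω : LogResidue.logForms1 h,
        σ ((LogResidue.dlogWedge h).mkQ ω) =
          (LinearMap.range (LogResidue.inclRD h)).mkQ (ρ ω))) ∧
    (LogResidue.IsFreeDivisor h →
      LogResidue.IsCohenMacaulay (LogResidue.OZ h) ∧
      LogResidue.IsCanonicalModule (LogResidue.OZ h) (LogResidue.Rh h) ∧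
      (LogResidue.IsGorenstein (LogResidue.OZ h) ↔
        ∃ r : LogResidue.MD h,
          LogResidue.RD h = Submodule.span (LogResidue.OD h) {1, r})) := by
  exact ⟨LogResidue.isTorsionBySet_Rh h, LogResidue.exists_diagram h_ne h_zero h_red,
    LogResidue.isCanonicalModule_Rh h_ne h_red⟩
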